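/- In the (undirected) kTree problem the input is a finite simple undirected graph $G$ (the host, given by its adjacency matrix) and a tree $T$ on $k$ nodes, and the question is whether $G$ contains a subgraph, not necessarily induced, that is isomorphic to $T$. In the Set Cover problem the input is a ground set $[n]=\{1,\dots,n\}$ and a collection of $m$ subsets of it, and the goal is to find a smallest sub-collection whose union is the entire ground set (or to report that the union of all the sets is not the ground set). Algorithms are deterministic and run on a random access machine, where every instruction is charged the total bit length of the numbers that it handles. A problem can be solved in time $O^*(f)$ if one algorithm solves every instance in time at most $f$ times a fixed polynomial in the size of the instance, which is $|V(G)|+k$ for kTree and $n+m$ for Set Cover. Theorem. For every fixed $\varepsilon>0$ there is $\delta=\delta(\varepsilon)>0$ such that the following holds: if kTree can be solved in time $O^*((2-\varepsilon)^k)$, then Set Cover on $n$ elements and $m$ sets can be solved in time $O^*((2-\delta)^n)$. -/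

import Mathlib

/-!
### Random access machines with logarithmic cost

A machine has registers (a program names only finitely many of them) and a memory that is
addressed indirectly; both hold natural numbers of any size. Every instruction is charged
the lengths in bits of all the numbers (operands and addresses) that it handles.
-/

/-- The contents of the registers and of the memory of a random access machine. -/
structure RAMState where
  reg : ℕ → ℕ
  mem : ℕ → ℕ

namespace RAMState

/-- Write `v` into register `r`. -/
def setReg (σ : RAMState) (r v : ℕ) : RAMState :=
  { σ with reg := Function.update σ.reg r v }

/-- Write `v` into the memory cell with address `a`. -/
def setMem (σ : RAMState) (a v : ℕ) : RAMState :=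
  { σ with mem := Function.update σ.mem a v }

/-- The start state: the input is in the memory cells `0, 1, 2, …`, all else is zero. -/
def start (input : List ℕ) : RAMState where
  reg := fun _ => 0
  mem := fun a => input.getD a 0

end RAMState

/-- Programs of a random access machine. The arguments `r`, `a`, `b` are names of registers. -/
inductive RAMProg : Type
  /-- do nothing -/
  | skip : RAMProg
  /-- `reg r := v` -/
  | imm (r v : ℕ) : RAMProg
  /-- `reg r := reg a + reg b` -/
  | add (r a b : ℕ) : RAMProg
  /-- `reg r := max (reg a - reg b) 0` -/
  | sub (r a b : ℕ) : RAMProg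
  /-- `reg r := mem (reg a)` -/
  | load (r a : ℕ) : RAMProg
  /-- `mem (reg a) := reg b` -/
  | store (a b : ℕ) : RAMProg
  /-- first `p`, then `q` -/
  | seq (p q : RAMProg) : RAMProg
  /-- if `reg a ≠ 0` then `p` else `q` -/
  | branch (a : ℕ) (p q : RAMProg) : RAMProg
  /-- while `reg a ≠ 0` do `p` -/
  | loop (a : ℕ) (p : RAMProg) : RAMProg

/-- `RAMExec p σ t τ`: started in the state `σ`, the program `p` halts in the state `τ`, and
the run has logarithmic cost `t`. (`Nat.size x` is the number of binary digits of `x`.) -/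
inductive RAMExec : RAMProg → RAMState → ℕ → RAMState → Prop
  | skip (σ : RAMState) : RAMExec .skip σ 1 σ
  | imm (σ : RAMState) (r v : ℕ) :
      RAMExec (.imm r v) σ (1 + Nat.size v) (σ.setReg r v)
  | add (σ : RAMState) (r a b : ℕ) :
      RAMExec (.add r a b) σ (1 + Nat.size (σ.reg a) + Nat.size (σ.reg b))
        (σ.setReg r (σ.reg a + σ.reg b))
  | sub (σ : RAMState) (r a b : ℕ) :
      RAMExec (.sub r a b) σ (1 + Nat.size (σ.reg a) + Nat.size (σ.reg b))
        (σ.setReg r (σ.reg a - σ.reg b))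
  | load (σ : RAMState) (r a : ℕ) :
      RAMExec (.load r a) σ (1 + Nat.size (σ.reg a) + Nat.size (σ.mem (σ.reg a)))
        (σ.setReg r (σ.mem (σ.reg a)))
  | store (σ : RAMState) (a b : ℕ) :
      RAMExec (.store a b) σ (1 + Nat.size (σ.reg a) + Nat.size (σ.reg b))
        (σ.setMem (σ.reg a) (σ.reg b))
  | seq {p q : RAMProg} {σ σ' σ'' : RAMState} {t t' : ℕ} :
      RAMExec p σ t σ' → RAMExec q σ' t' σ'' → RAMExec (.seq p q) σ (t + t') σ''
  | branch_true {a : ℕ} {p q : RAMProg} {σ σ' : RAMState} {t : ℕ} :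
      σ.reg a ≠ 0 → RAMExec p σ t σ' →
        RAMExec (.branch a p q) σ (1 + Nat.size (σ.reg a) + t) σ'
  | branch_false {a : ℕ} {p q : RAMProg} {σ σ' : RAMState} {t : ℕ} :
      σ.reg a = 0 → RAMExec q σ t σ' → RAMExec (.branch a p q) σ (1 + t) σ'
  | loop_true {a : ℕ} {p : RAMProg} {σ σ' σ'' : RAMState} {t t' : ℕ} :
      σ.reg a ≠ 0 → RAMExec p σ t σ' → RAMExec (.loop a p) σ' t' σ'' →
        RAMExec (.loop a p) σ (1 + Nat.size (σ.reg a) + t + t') σ''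
  | loop_false {a : ℕ} {p : RAMProg} {σ : RAMState} :
      σ.reg a = 0 → RAMExec (.loop a p) σ 1 σ

/-! ### Computational problems and `O*` running times -/

/-- A computational problem: its instances, how they are written as input of a machine, their
size, and which final states of a machine present a correct answer. -/
structure CompProblem where
  Inst : Type
  encode : Inst → List ℕ
  size : Inst → ℕ
  Correct : Inst → RAMState → Prop

/-- `P` can be solved in time `O*(f)`: a single program halts with a correct answer on every
instance `x` within time `f x` times a fixed polynomial in the size of `x`. -/
def CompProblem.SolvableInOStar (P : CompProblem) (f : P.Inst → ℝ) : Prop :=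
  ∃ (p : RAMProg) (c : ℕ), ∀ x : P.Inst, ∃ (t : ℕ) (τ : RAMState),
    RAMExec p (RAMState.start (P.encode x)) t τ ∧ P.Correct x τ ∧
      (t : ℝ) ≤ (c : ℝ) * ((P.size x : ℝ) + 1) ^ c * f x

open Classical in
/-- The 0/1 matrix of a relation, row by row. -/
noncomputable def bitMatrix {a b : ℕ} (R : Fin a → Fin b → Prop) : List ℕ :=
  (List.finRange a).flatMap fun i => (List.finRange b).map fun j => if R i j then 1 else 0

/-! ### The problem kTree -/

/-- An instance of (undirected) kTree: a host graph `G` and a pattern tree `T` on `k` nodes. -/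
structure KTreeInst where
  N : ℕ
  k : ℕ
  G : SimpleGraph (Fin N)
  T : SimpleGraph (Fin k)
  isTree : T.IsTree

/-- The problem kTree: decide whether `G` contains a (not necessarily induced) subgraph that is
isomorphic to `T`. The answer is given in register `0`; graphs are given by their adjacency
matrices. -/
noncomputable def kTree : CompProblem where
  Inst := KTreeInst
  encode x := x.N :: x.k :: (bitMatrix x.G.Adj ++ bitMatrix x.T.Adj)
  size x := x.N + x.k
  Correct x τ := (x.T.IsContained x.G ∧ τ.reg 0 = 1) ∨ (¬ x.T.IsContained x.G ∧ τ.reg 0 = 0)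

/-! ### The problem Set Cover -/

/-- An instance of Set Cover: a collection of `m` subsets of a ground set of `n` elements. -/
structure SetCoverInst where
  n : ℕ
  m : ℕ
  S : Fin m → Finset (Fin n)

/-- The sub-collection `C` covers the ground set. -/
def SetCoverInst.IsCover (x : SetCoverInst) (C : Finset (Fin x.m)) : Prop :=
  ∀ e : Fin x.n, ∃ i ∈ C, e ∈ x.S i

/-- The sub-collection `C` is a smallest one that covers the ground set. -/
def SetCoverInst.IsMinCover (x : SetCoverInst) (C : Finset (Fin x.m)) : Prop :=
  x.IsCover C ∧ ∀ D : Finset (Fin x.m), x.IsCover D → C.card ≤ D.card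

/-- The problem Set Cover: find a smallest sub-collection whose union is the ground set, or
report that there is none. Register `0` tells whether there is one; if so, the memory cells
`0, …, m - 1` hold its indicator vector. The input is the set-element incidence matrix. -/
noncomputable def setCover : CompProblem where
  Inst := SetCoverInst
  encode x := x.n :: x.m :: bitMatrix fun i e => e ∈ x.S i
  size x := x.n + x.m
  Correct x τ :=
    (τ.reg 0 = 1 ∧ ∃ C : Finset (Fin x.m), x.IsMinCover C ∧
      ∀ i : Fin x.m, τ.mem i = if i ∈ C then 1 else 0) ∨
    (τ.reg 0 = 0 ∧ ∀ C : Finset (Fin x.m), ¬ x.IsCover C)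

/-! The covering problem is turned into a tree problem in which the elements become leaves. For a
large constant `g` the tree has only n + O(n/g) vertices, and it has to be tried for poly ·
2^(O(n/g)) guesses. An algorithm for kTree with a base below 2 then stays below 2^n.

Cut a cover with at most n sets into groups of `g ^ 2` sets, leaving an incomplete last group.
Choose a maximal family of groups such that the family covers more than n/g elements per member; it
has fewer than `g` members. Together with the incomplete group these are fewer than `g ^ 3` sets,
which are guessed outright in (m+1)^(g^3) ways. By maximality every other group covers at most n/g
of the set U of elements that are still open.

The host graph joins a root to all (m+1)^(g^2) codes of groups, and joins a code to the elements of
U that it covers, provided that there are at most n/g of them. The pattern tree has one child of the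
root for each of the `s` remaining groups, with leaves for the elements assigned to the group. The
numbers of leaves are unknown; rounding them up to multiples of `g` makes them describable by at
most n/g + n/g^2 bits, and the surplus leaves go to at most g · (n/g^2) dummy elements adjacent to
all codes. Root and tree also carry `D` pendant paths of length two, where `D` exceeds all degrees
on the side of the codes.

Conversely, in any copy of the tree the root cannot lie on the side of the codes, for reasons of
degree (`IsPatternCopy.not_odd_root`), so the two bipartitions agree. The dummies in use are counted
such that the side of the elements is filled completely. Hence every open element has a neighbour
among the images of D + s vertices, and D of these are used up by the paths
(`cover_of_isContained`). The other direction is `isContained_of_cover`, with the guess supplied by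
`exists_accepts`.

Deciding the existence of a cover of given size yields a smallest cover by self-reduction: n
attempts to lower the size, then one attempt per set to do without it (`Progress`).

On the machine, the algorithm is written in a small language whose compilation costs a polynomial
factor (`RAMCmd.exists_compRuns`). The kTree program is run as an oracle. Its memory cannot be
erased cheaply, since the addresses that it uses are unknown, so the runs get interleaved disjoint
copies of the memory; an address then grows by polynomially many bits only. -/

theorem Nat.size_le_self_nat (n : ℕ) : Nat.size n ≤ n := Nat.size_le.2 n.lt_two_pow_self

/-! ### Runs of random access machines with bounded cost -/

namespace RAMState

@[simp] theorem reg_setReg (σ : RAMState) (r v r' : ℕ) :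
    (σ.setReg r v).reg r' = if r' = r then v else σ.reg r' := by
  simp [setReg, Function.update_apply]

@[simp] theorem mem_setReg (σ : RAMState) (r v : ℕ) : (σ.setReg r v).mem = σ.mem := rfl

@[simp] theorem mem_setMem (σ : RAMState) (a v a' : ℕ) :
    (σ.setMem a v).mem a' = if a' = a then v else σ.mem a' := by
  simp [setMem, Function.update_apply]

end RAMState

/-- Every rule charges at least one unit. In the main theorem this rules out a negative time bound,
that is, ε > 2. -/
theorem RAMExec.cost_pos {p : RAMProg} {σ τ : RAMState} {t : ℕ} (h : RAMExec p σ t τ) : 0 < t := by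
  induction h <;> omega

/-- Started in `σ`, the program `p` halts with cost at most `T` in a state that satisfies `Q`. -/
def RAMProg.Runs (p : RAMProg) (σ : RAMState) (T : ℕ) (Q : RAMState → Prop) : Prop :=
  ∃ t τ, RAMExec p σ t τ ∧ t ≤ T ∧ Q τ

namespace RAMProg.Runs

variable {p q : RAMProg} {σ : RAMState} {T T' T₁ : ℕ} {Q Q' : RAMState → Prop} {r a b v : ℕ}

theorem mono (h : p.Runs σ T Q) (hT : T ≤ T') (hQ : ∀ τ, Q τ → Q' τ) : p.Runs σ T' Q' := by
  obtain ⟨t, τ, h, ht, hq⟩ := h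
  exact ⟨t, τ, h, ht.trans hT, hQ _ hq⟩

theorem skip (h : Q σ) : Runs .skip σ 1 Q := ⟨_, _, .skip σ, le_rfl, h⟩

theorem imm (h : Q (σ.setReg r v)) : Runs (.imm r v) σ (1 + Nat.size v) Q :=
  ⟨_, _, .imm σ r v, le_rfl, h⟩

theorem add (h : Q (σ.setReg r (σ.reg a + σ.reg b))) :
    Runs (.add r a b) σ (1 + Nat.size (σ.reg a) + Nat.size (σ.reg b)) Q :=
  ⟨_, _, .add σ r a b, le_rfl, h⟩

theorem sub (h : Q (σ.setReg r (σ.reg a - σ.reg b))) :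
    Runs (.sub r a b) σ (1 + Nat.size (σ.reg a) + Nat.size (σ.reg b)) Q :=
  ⟨_, _, .sub σ r a b, le_rfl, h⟩

theorem load (h : Q (σ.setReg r (σ.mem (σ.reg a)))) :
    Runs (.load r a) σ (1 + Nat.size (σ.reg a) + Nat.size (σ.mem (σ.reg a))) Q :=
  ⟨_, _, .load σ r a, le_rfl, h⟩

theorem store (h : Q (σ.setMem (σ.reg a) (σ.reg b))) :
    Runs (.store a b) σ (1 + Nat.size (σ.reg a) + Nat.size (σ.reg b)) Q :=
  ⟨_, _, .store σ a b, le_rfl, h⟩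

/-- The total budget `T` stays fixed and the second program receives what is left of it. A long
sequence can so be peeled off one instruction at a time, with linear side conditions. -/
theorem seq (h : p.Runs σ T₁ (fun τ => q.Runs τ (T - T₁) Q)) (hT : T₁ ≤ T) :
    Runs (.seq p q) σ T Q := by
  obtain ⟨t, τ, h, ht, t', τ', h', ht', hq⟩ := h
  exact ⟨_, _, .seq h h', by omega, hq⟩

theorem branch (h₁ : σ.reg a ≠ 0 → p.Runs σ T Q) (h₂ : σ.reg a = 0 → q.Runs σ T Q) :
    Runs (.branch a p q) σ (1 + Nat.size (σ.reg a) + T) Q := by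
  by_cases h : σ.reg a = 0
  · obtain ⟨t, τ, h', ht, hq⟩ := h₂ h
    exact ⟨_, _, .branch_false h h', by omega, hq⟩
  · obtain ⟨t, τ, h', ht, hq⟩ := h₁ h
    exact ⟨_, _, .branch_true h h', by omega, hq⟩

/-- A loop whose register `a` counts down. -/
theorem loop (I : ℕ → RAMState → Prop) {K S : ℕ} (hI : ∀ k τ, I k τ → τ.reg a = k)
    (hS : Nat.size K ≤ S) (hb : ∀ k < K, ∀ τ, I (k + 1) τ → p.Runs τ T (I k)) (h : I K σ) :
    Runs (.loop a p) σ (K * (1 + S + T) + 1) (I 0) := by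
  induction K generalizing σ with
  | zero => exact ⟨_, _, .loop_false (hI _ _ h), by omega, h⟩
  | succ k ih =>
    obtain ⟨t, τ, h', ht, hq⟩ := hb k (by omega) σ h
    obtain ⟨t', τ', h'', ht', hq'⟩ :=
      ih ((Nat.size_le_size (Nat.le_succ k)).trans hS) (fun j hj => hb j (by omega)) hq
    have hk := hI _ _ h
    refine ⟨_, _, .loop_true (by omega) h' h'', ?_, hq'⟩
    rw [hk]
    have : (k + 1) * (1 + S + T) = k * (1 + S + T) + (1 + S + T) := by ring
    omega

end RAMProg.Runs

/-! ### Arithmetic expressions -/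

/-- Arithmetic expressions over variables and a memory. -/
inductive RAMExp : Type
  | var (x : ℕ) : RAMExp
  | const (c : ℕ) : RAMExp
  | add (a b : RAMExp) : RAMExp
  | sub (a b : RAMExp) : RAMExp
  | mul (a b : RAMExp) : RAMExp
  /-- `a / (b + 1)` -/
  | div (a b : RAMExp) : RAMExp
  | read (a : RAMExp) : RAMExp
  /-- if `c ≠ 0` then `a` else `b` -/
  | ite (c a b : RAMExp) : RAMExp
  /-- the sum of `b` over all values of `x` below `a` -/
  | sum (x : ℕ) (a b : RAMExp) : RAMExp

namespace RAMExp

/-- The value of an expression. -/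
def eval (μ : ℕ → ℕ) : RAMExp → (ℕ → ℕ) → ℕ
  | var x, ρ => ρ x
  | const c, _ => c
  | add a b, ρ => a.eval μ ρ + b.eval μ ρ
  | sub a b, ρ => a.eval μ ρ - b.eval μ ρ
  | mul a b, ρ => a.eval μ ρ * b.eval μ ρ
  | div a b, ρ => a.eval μ ρ / (b.eval μ ρ + 1)
  | read a, ρ => μ (a.eval μ ρ)
  | ite c a b, ρ => if c.eval μ ρ ≠ 0 then a.eval μ ρ else b.eval μ ρ
  | sum x a b, ρ => ∑ i ∈ Finset.range (a.eval μ ρ), b.eval μ (Function.update ρ x i)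

end RAMExp

/-- Special registers of compiled programs: `0` holds zero, `1` holds one, `2` the size of the
working memory, `3` the number of the current oracle run, `4` the number of bits reserved for it,
`5` the number of rounds of a big loop; `6` and `7` are scratch. -/
def specialReg (R k : ℕ) : ℕ := R + 3 * k

/-- The register of a variable. -/
def varReg (R x : ℕ) : ℕ := R + 3 * x + 1

/-- Registers for temporary values. -/
def tempReg (R d : ℕ) : ℕ := R + 3 * d + 2

section
variable {R k l : ℕ}
@[simp] theorem specialReg_inj : specialReg R k = specialReg R l ↔ k = l := by
  simp only [specialReg]; omega
@[simp] theorem varReg_inj : varReg R k = varReg R l ↔ k = l := by simp only [varReg]; omega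
@[simp] theorem tempReg_inj : tempReg R k = tempReg R l ↔ k = l := by simp only [tempReg]; omega
@[simp] theorem specialReg_ne_varReg : specialReg R k ≠ varReg R l := by
  simp only [specialReg, varReg]; omega
@[simp] theorem varReg_ne_specialReg : varReg R k ≠ specialReg R l := by
  simp only [specialReg, varReg]; omega
@[simp] theorem specialReg_ne_tempReg : specialReg R k ≠ tempReg R l := by
  simp only [specialReg, tempReg]; omega
@[simp] theorem tempReg_ne_specialReg : tempReg R k ≠ specialReg R l := by
  simp only [specialReg, tempReg]; omega
@[simp] theorem varReg_ne_tempReg : varReg R k ≠ tempReg R l := by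
  simp only [varReg, tempReg]; omega
@[simp] theorem tempReg_ne_varReg : tempReg R k ≠ varReg R l := by
  simp only [varReg, tempReg]; omega
end

/-- Programs run one after the other. -/
def RAMProg.seqs : List RAMProg → RAMProg
  | [] => .skip
  | [p] => p
  | p :: q :: l => .seq p (RAMProg.seqs (q :: l))

namespace RAMExp
open RAMProg

/-- Compilation of an expression; the value goes to the temporary register `d`. -/
def comp (R : ℕ) : RAMExp → ℕ → RAMProg
  | var x, d => .add (tempReg R d) (varReg R x) (specialReg R 0)
  | const c, d => .imm (tempReg R d) c
  | add a b, d => seqs [a.comp R d, b.comp R (d + 1),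
      .add (tempReg R d) (tempReg R d) (tempReg R (d + 1))]
  | sub a b, d => seqs [a.comp R d, b.comp R (d + 1),
      .sub (tempReg R d) (tempReg R d) (tempReg R (d + 1))]
  | mul a b, d => seqs [a.comp R (d + 1), b.comp R (d + 2), .imm (tempReg R d) 0,
      .loop (tempReg R (d + 1)) (seqs [
        .add (tempReg R d) (tempReg R d) (tempReg R (d + 2)),
        .sub (tempReg R (d + 1)) (tempReg R (d + 1)) (specialReg R 1)])]
  | div a b, d => seqs [a.comp R (d + 1), b.comp R (d + 2),
      .add (tempReg R (d + 2)) (tempReg R (d + 2)) (specialReg R 1), .imm (tempReg R d) 0,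
      .add (tempReg R (d + 3)) (tempReg R (d + 1)) (specialReg R 0),
      .loop (tempReg R (d + 3)) (seqs [
        .add (tempReg R (d + 4)) (tempReg R (d + 1)) (specialReg R 1),
        .sub (tempReg R (d + 4)) (tempReg R (d + 4)) (tempReg R (d + 2)),
        .sub (tempReg R (d + 3)) (tempReg R (d + 3)) (specialReg R 1),
        .branch (tempReg R (d + 4)) (seqs [
          .sub (tempReg R (d + 1)) (tempReg R (d + 1)) (tempReg R (d + 2)),
          .add (tempReg R d) (tempReg R d) (specialReg R 1)]) .skip])]
  | read a, d => seqs [a.comp R d,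
      .sub (tempReg R (d + 1)) (specialReg R 2) (tempReg R d),
      .branch (tempReg R (d + 1)) (.load (tempReg R d) (tempReg R d)) (.imm (tempReg R d) 0)]
  | ite c a b, d => seqs [c.comp R d, .branch (tempReg R d) (a.comp R d) (b.comp R d)]
  | sum x a b, d => seqs [a.comp R (d + 1),
      .add (tempReg R (d + 2)) (varReg R x) (specialReg R 0), .imm (tempReg R d) 0,
      .loop (tempReg R (d + 1)) (seqs [
        .sub (tempReg R (d + 1)) (tempReg R (d + 1)) (specialReg R 1),
        .add (varReg R x) (tempReg R (d + 1)) (specialReg R 0),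
        b.comp R (d + 3),
        .add (tempReg R d) (tempReg R d) (tempReg R (d + 3))]),
      .add (varReg R x) (tempReg R (d + 2)) (specialReg R 0)]

/-- Every construct maps polynomially bounded values to such values, with an exponent that depends
on the expression only. The base β + 2 is at least 2, so that constants and small factors can be
absorbed into the exponent. -/
theorem eval_le (e : RAMExp) : ∃ κ, ∀ (β : ℕ) (μ ρ : ℕ → ℕ), (∀ x, ρ x ≤ β) → (∀ a, μ a ≤ β) →
    e.eval μ ρ ≤ (β + 2) ^ κ := by
  induction e with
  | var x => exact ⟨1, fun β μ ρ h _ => by simp only [eval]; have := h x; rw [pow_one]; omega⟩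
  | const c =>
    refine ⟨c, fun β μ ρ _ _ => ?_⟩
    simp only [eval]
    exact c.lt_two_pow_self.le.trans (Nat.pow_le_pow_left (by omega) c)
  | read a => exact ⟨1, fun β μ ρ _ h => by
    simp only [eval]
    have := h (a.eval μ ρ)
    rw [pow_one]
    omega⟩
  | add a b iha ihb =>
    obtain ⟨k, hk⟩ := iha
    obtain ⟨l, hl⟩ := ihb
    refine ⟨k + l + 1, fun β μ ρ h h' => ?_⟩
    have h1 := hk β μ ρ h h'
    have h2 := hl β μ ρ h h'
    have h3 : (β + 2) ^ k ≤ (β + 2) ^ (k + l) := Nat.pow_le_pow_right (by omega) (by omega)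
    have h4 : (β + 2) ^ l ≤ (β + 2) ^ (k + l) := Nat.pow_le_pow_right (by omega) (by omega)
    simp only [eval, pow_succ (β + 2) (k + l)]
    nlinarith
  | sub a b iha ihb =>
    obtain ⟨k, hk⟩ := iha
    exact ⟨k, fun β μ ρ h h' => (Nat.sub_le _ _).trans (hk β μ ρ h h')⟩
  | div a b iha ihb =>
    obtain ⟨k, hk⟩ := iha
    exact ⟨k, fun β μ ρ h h' => (Nat.div_le_self _ _).trans (hk β μ ρ h h')⟩
  | mul a b iha ihb =>
    obtain ⟨k, hk⟩ := iha
    obtain ⟨l, hl⟩ := ihb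
    refine ⟨k + l, fun β μ ρ h h' => ?_⟩
    rw [eval, pow_add]
    exact Nat.mul_le_mul (hk β μ ρ h h') (hl β μ ρ h h')
  | ite c a b ihc iha ihb =>
    obtain ⟨k, hk⟩ := iha
    obtain ⟨l, hl⟩ := ihb
    refine ⟨k + l, fun β μ ρ h h' => ?_⟩
    rw [eval]
    split_ifs
    · exact (hk β μ ρ h h').trans (Nat.pow_le_pow_right (by omega) (by omega))
    · exact (hl β μ ρ h h').trans (Nat.pow_le_pow_right (by omega) (by omega))
  | sum x a b iha ihb =>
    obtain ⟨k, hk⟩ := iha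
    obtain ⟨l, hl⟩ := ihb
    -- The running index may be as large as the bound for `a`, so `b` is evaluated under the larger
    -- bound max β ((β+2)^k), whose shift by 2 is at most (β+2)^(k+2).
    refine ⟨k + (k + 2) * l, fun β μ ρ h h' => ?_⟩
    have h1 := hk β μ ρ h h'
    have h5 : 1 ≤ (β + 2) ^ k := Nat.one_le_pow _ _ (by omega)
    have h2 : ∀ i ∈ Finset.range (a.eval μ ρ), b.eval μ (Function.update ρ x i) ≤
        (max β ((β + 2) ^ k) + 2) ^ l := fun i hi => hl _ μ _ (fun y => by
          rw [Function.update_apply]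
          split_ifs
          · exact ((Finset.mem_range.1 hi).le.trans h1).trans (le_max_right _ _)
          · exact (h y).trans (le_max_left _ _)) (fun y => (h' y).trans (le_max_left _ _))
    have h7 : max β ((β + 2) ^ k) + 2 ≤ (β + 2) ^ (k + 2) := by
      rw [pow_add, ← max_add_add_right]
      have h8 : 4 ≤ (β + 2) ^ 2 := Nat.pow_le_pow_left (by omega : 2 ≤ β + 2) 2
      have h10 : β + 2 ≤ (β + 2) ^ 2 := Nat.le_self_pow two_ne_zero _
      have h9 := Nat.mul_le_mul_left ((β + 2) ^ k) h8
      exact max_le (h10.trans (Nat.le_mul_of_pos_left _ h5)) (by omega)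
    rw [eval]
    refine (Finset.sum_le_card_nsmul _ _ _ h2).trans ?_
    rw [Finset.card_range, smul_eq_mul, pow_add, pow_mul]
    exact Nat.mul_le_mul h1 (Nat.pow_le_pow_left h7 l)

end RAMExp

/-- The only differences between `σ` and `τ` are in temporary registers from `d` on. -/
def TempFrame (R d : ℕ) (σ τ : RAMState) : Prop :=
  τ.mem = σ.mem ∧ ∀ r, (∀ d' ≥ d, r ≠ tempReg R d') → τ.reg r = σ.reg r

namespace TempFrame
variable {R d d' k x : ℕ} {σ τ υ : RAMState}

theorem refl : TempFrame R d σ σ := ⟨rfl, fun _ _ => rfl⟩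

theorem trans (h : TempFrame R d σ τ) (h' : TempFrame R d τ υ) : TempFrame R d σ υ :=
  ⟨h'.1.trans h.1, fun r hr => (h'.2 r hr).trans (h.2 r hr)⟩

theorem weaken (h : TempFrame R d' σ τ) (hd : d ≤ d') : TempFrame R d σ τ :=
  ⟨h.1, fun r hr => h.2 r fun e he => hr e (hd.trans he)⟩

theorem set (h : TempFrame R d σ τ) (hd : d ≤ k) (v : ℕ) :
    TempFrame R d σ (τ.setReg (tempReg R k) v) :=
  ⟨h.1, fun r hr => by simpa [hr k hd] using h.2 r hr⟩

theorem special (h : TempFrame R d σ τ) (k : ℕ) :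
    τ.reg (specialReg R k) = σ.reg (specialReg R k) := h.2 _ (by simp)

theorem var (h : TempFrame R d σ τ) (x : ℕ) : τ.reg (varReg R x) = σ.reg (varReg R x) :=
  h.2 _ (by simp)

theorem temp (h : TempFrame R d σ τ) (hk : k < d) : τ.reg (tempReg R k) = σ.reg (tempReg R k) :=
  h.2 _ (by simp only [ne_eq, tempReg_inj]; omega)

end TempFrame

/-! ### Correctness and cost of compiled expressions. -/

namespace RAMExp
open RAMProg

/-- The machine state `σ` represents the variables `ρ` and the memory `μ`, with values at most
`β`. -/
structure Rep (R β : ℕ) (μ ρ : ℕ → ℕ) (σ : RAMState) : Prop where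
  zero : σ.reg (specialReg R 0) = 0
  one : σ.reg (specialReg R 1) = 1
  var : ∀ x, σ.reg (varReg R x) = ρ x
  mem : ∀ a < σ.reg (specialReg R 2), σ.mem a = μ a
  mem_zero : ∀ a, σ.reg (specialReg R 2) ≤ a → μ a = 0
  var_le : ∀ x, ρ x ≤ β
  mem_le : ∀ a, μ a ≤ β
  bound_le : σ.reg (specialReg R 2) ≤ β

theorem Rep.frame {R β d : ℕ} {μ ρ : ℕ → ℕ} {σ τ : RAMState} (h : Rep R β μ ρ σ)
    (hf : TempFrame R d σ τ) : Rep R β μ ρ τ where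
  zero := (hf.special 0).trans h.zero
  one := (hf.special 1).trans h.one
  var x := (hf.var x).trans (h.var x)
  mem a ha := by rw [hf.1]; exact h.mem a (by rwa [hf.special] at ha)
  mem_zero a ha := h.mem_zero a (by rwa [hf.special] at ha)
  var_le := h.var_le
  mem_le := h.mem_le
  bound_le := by rw [hf.special]; exact h.bound_le

theorem Rep.setVar {R β : ℕ} {μ ρ : ℕ → ℕ} {σ : RAMState} (h : Rep R β μ ρ σ) (x v : ℕ)
    (hv : v ≤ β) : Rep R β μ (Function.update ρ x v) (σ.setReg (varReg R x) v) where
  zero := by simpa using h.zero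
  one := by simpa using h.one
  var y := by simp [Function.update_apply, h.var y]
  mem a ha := h.mem a (by simpa using ha)
  mem_zero a ha := h.mem_zero a (by simpa using ha)
  var_le y := by rw [Function.update_apply]; split_ifs; exacts [hv, h.var_le y]
  mem_le := h.mem_le
  bound_le := by simpa using h.bound_le

theorem Rep.mono {R β β' : ℕ} {μ ρ : ℕ → ℕ} {σ : RAMState} (h : Rep R β μ ρ σ) (hβ : β ≤ β') :
    Rep R β' μ ρ σ :=
  { h with
    var_le := fun x => (h.var_le x).trans hβ
    mem_le := fun x => (h.mem_le x).trans hβ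
    bound_le := h.bound_le.trans hβ }

/-- The property that `comp` has to meet with cost `T`. -/
def CompRuns (e : RAMExp) (κ : ℕ) : Prop :=
  ∀ (R d β : ℕ) (μ ρ : ℕ → ℕ) (σ : RAMState), Rep R β μ ρ σ →
    (e.comp R d).Runs σ ((β + 2) ^ κ) fun τ =>
      TempFrame R d σ τ ∧ τ.reg (tempReg R d) = e.eval μ ρ

/-- Bookkeeping for costs: `P` dominates all subexpression costs and values, `C` dominates nested
products such as a loop of P rounds of cost P, and a factor up to 128 = 2^7 is paid for by seven
more powers of β + 2. With `P` and `C` as atoms the remaining inequalities are linear. -/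
theorem cube_bound (β K : ℕ) (hK : 1 ≤ K) : ∃ P C : ℕ, P = (β + 2) ^ K ∧ C = P * P * P ∧
    β + 2 ≤ P ∧ P * P ≤ C ∧ P ≤ C ∧ 128 * C = 128 * (P * P * P) ∧
    128 * C ≤ (β + 2) ^ (3 * K + 7) := by
  refine ⟨_, _, rfl, rfl, Nat.le_self_pow (by omega) _, ?_, ?_, rfl, ?_⟩
  · exact Nat.le_mul_of_pos_right _ (by positivity)
  · rw [mul_assoc]; exact Nat.le_mul_of_pos_right _ (by positivity)
  · have : 2 ^ 7 ≤ (β + 2) ^ 7 := Nat.pow_le_pow_left (by omega) 7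
    calc 128 * ((β + 2) ^ K * (β + 2) ^ K * (β + 2) ^ K)
        = 2 ^ 7 * (β + 2) ^ (3 * K) := by ring
      _ ≤ (β + 2) ^ 7 * (β + 2) ^ (3 * K) := Nat.mul_le_mul_right _ this
      _ = _ := by ring

theorem compRuns_binop {a b : RAMExp} {k l : ℕ} (ha : CompRuns a k) (hb : CompRuns b l)
    {e : RAMExp} {op : ℕ → ℕ → ℕ → RAMProg} {f : ℕ → ℕ → ℕ}
    (hop : ∀ r s t σ Q, Q (σ.setReg r (f (σ.reg s) (σ.reg t))) →
      (op r s t).Runs σ (1 + Nat.size (σ.reg s) + Nat.size (σ.reg t)) Q)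
    (hc : ∀ R d, e.comp R d = seqs [a.comp R d, b.comp R (d + 1),
      op (tempReg R d) (tempReg R d) (tempReg R (d + 1))])
    (he : ∀ μ ρ, e.eval μ ρ = f (a.eval μ ρ) (b.eval μ ρ)) : ∃ κ, CompRuns e κ := by
  obtain ⟨k', hk'⟩ := a.eval_le
  obtain ⟨l', hl'⟩ := b.eval_le
  refine ⟨3 * (k + l + k' + l' + 1) + 7, fun R d β μ ρ σ hσ => ?_⟩
  obtain ⟨P, C, hP, -, hβ, -, hPC, -, hT⟩ := cube_bound β (k + l + k' + l' + 1) (by omega)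
  have hpow : ∀ i, i ≤ k + l + k' + l' + 1 → (β + 2) ^ i ≤ P := fun i hi =>
    hP ▸ Nat.pow_le_pow_right (by omega) hi
  refine Runs.mono ?_ hT fun _ => id
  rw [hc, he]
  simp only [seqs]
  have hva := (hk' β μ ρ hσ.var_le hσ.mem_le).trans (hpow k' (by omega))
  have hvb := (hl' β μ ρ hσ.var_le hσ.mem_le).trans (hpow l' (by omega))
  have hka := hpow k (by omega)
  have hlb := hpow l (by omega)
  refine Runs.seq ((ha R d β μ ρ σ hσ).mono hka ?_) (by omega)
  rintro τ ⟨hτ, hτv⟩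
  refine Runs.seq ((hb R (d + 1) β μ ρ τ (hσ.frame hτ)).mono hlb ?_) (by omega)
  rintro υ ⟨hυ, hυv⟩
  have h0 := (hυ.temp (Nat.lt_succ_self d)).trans hτv
  refine (hop _ _ _ υ _ ?_).mono ?_ fun _ => id
  · refine ⟨(hτ.trans (hυ.weaken (Nat.le_succ d))).set le_rfl _, ?_⟩
    simp [h0, hυv]
  · rw [h0, hυv]
    have := Nat.size_le_self_nat (a.eval μ ρ)
    have := Nat.size_le_self_nat (b.eval μ ρ)
    omega

/-- Multiplication by repeated addition is affordable because the values, and not only their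
lengths, are polynomially bounded. -/
theorem compRuns_mul {a b : RAMExp} {k l : ℕ} (ha : CompRuns a k) (hb : CompRuns b l) :
    ∃ κ, CompRuns (mul a b) κ := by
  obtain ⟨k', hk'⟩ := a.eval_le
  obtain ⟨l', hl'⟩ := b.eval_le
  obtain ⟨m', hm'⟩ := (mul a b).eval_le
  refine ⟨3 * (k + l + k' + l' + m' + 1) + 7, fun R d β μ ρ σ hσ => ?_⟩
  obtain ⟨P, C, hP, -, hβ, hPPC, hPC, -, hT⟩ := cube_bound β (k + l + k' + l' + m' + 1) (by omega)
  have hpow : ∀ i, i ≤ k + l + k' + l' + m' + 1 → (β + 2) ^ i ≤ P := fun i hi =>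
    hP ▸ Nat.pow_le_pow_right (by omega) hi
  refine Runs.mono ?_ hT fun _ => id
  simp only [comp, seqs, eval]
  have hva := (hk' β μ ρ hσ.var_le hσ.mem_le).trans (hpow k' (by omega))
  have hvb := (hl' β μ ρ hσ.var_le hσ.mem_le).trans (hpow l' (by omega))
  have hvm := (hm' β μ ρ hσ.var_le hσ.mem_le).trans (hpow m' (by omega))
  have hka := hpow k (by omega)
  have hlb := hpow l (by omega)
  refine Runs.seq ((ha R (d + 1) β μ ρ σ hσ).mono hka ?_) (by omega)
  rintro τ ⟨hτ, hτv⟩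
  refine Runs.seq ((hb R (d + 2) β μ ρ τ (hσ.frame hτ)).mono hlb ?_) (by omega)
  rintro υ ⟨hυ, hυv⟩
  have h0 := (hυ.temp (Nat.lt_succ_self (d + 1))).trans hτv
  have hσυ := (hτ.weaken (Nat.le_succ d)).trans (hυ.weaken (by omega : d ≤ d + 2))
  rw [eval] at hvm
  generalize a.eval μ ρ = x at *
  generalize b.eval μ ρ = y at *
  refine Runs.seq (Runs.imm ?_) (by simp only [Nat.size_zero]; omega)
  have hsx := Nat.size_le_self_nat x
  have hsy := Nat.size_le_self_nat y
  have hs1 : Nat.size 1 = 1 := Nat.size_one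
  have hloop : x * (1 + P + 5 * P) + 1 ≤ 8 * C := by nlinarith
  refine (Runs.loop (I := fun i ζ => TempFrame R d σ ζ ∧ ζ.reg (tempReg R (d + 1)) = i ∧
      ζ.reg (tempReg R (d + 2)) = y ∧ i ≤ x ∧ ζ.reg (tempReg R d) + i * y = x * y)
    (K := x) (S := P) (T := 5 * P) (fun _ _ h => h.2.1) (by omega) ?_ ?_).mono ?_ ?_
  · rintro i hi ζ ⟨hf, h1, h2, h3, h4⟩
    have hs := Nat.size_le_self_nat (ζ.reg (tempReg R d))
    have hs' := Nat.size_le_self_nat (i + 1)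
    have hz : ζ.reg (tempReg R d) ≤ x * y := by omega
    refine Runs.seq (Runs.add ?_) (by rw [h2]; omega)
    refine (Runs.sub ?_).mono ?_ fun _ => id
    · refine ⟨(hf.set le_rfl _).set (Nat.le_succ d) _, ?_⟩
      have ho := (hσ.frame hf).one
      simp [h1, h2, ho]
      refine ⟨by omega, ?_⟩
      rw [← h4]; ring
    · have ho := (hσ.frame hf).one
      simp [h1, h2, ho]
      omega
  · refine ⟨hσυ.set le_rfl _, ?_⟩
    simp [h0, hυv]
  · simp only [Nat.size_zero]; omega
  · rintro ζ ⟨hf, h1, h2, h3, h4⟩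
    exact ⟨hf, by simpa using h4⟩

end RAMExp

namespace RAMExp
open RAMProg

theorem compRuns_div {a b : RAMExp} {k l : ℕ} (ha : CompRuns a k) (hb : CompRuns b l) :
    ∃ κ, CompRuns (div a b) κ := by
  obtain ⟨k', hk'⟩ := a.eval_le
  obtain ⟨l', hl'⟩ := b.eval_le
  refine ⟨3 * (k + l + k' + l' + 1) + 7, fun R d β μ ρ σ hσ => ?_⟩
  obtain ⟨P, C, hP, -, hβ, hPPC, hPC, -, hT⟩ := cube_bound β (k + l + k' + l' + 1) (by omega)
  have hpow : ∀ i, i ≤ k + l + k' + l' + 1 → (β + 2) ^ i ≤ P := fun i hi =>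
    hP ▸ Nat.pow_le_pow_right (by omega) hi
  refine Runs.mono ?_ hT fun _ => id
  simp only [comp, seqs, eval]
  have hva := (hk' β μ ρ hσ.var_le hσ.mem_le).trans (hpow k' (by omega))
  have hvb := (hl' β μ ρ hσ.var_le hσ.mem_le).trans (hpow l' (by omega))
  have hka := hpow k (by omega)
  have hlb := hpow l (by omega)
  refine Runs.seq ((ha R (d + 1) β μ ρ σ hσ).mono hka ?_) (by omega)
  rintro τ ⟨hτ, hτv⟩
  refine Runs.seq ((hb R (d + 2) β μ ρ τ (hσ.frame hτ)).mono hlb ?_) (by omega)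
  rintro υ ⟨hυ, hυv⟩
  have h0 := (hυ.temp (Nat.lt_succ_self (d + 1))).trans hτv
  have hσυ := (hτ.weaken (Nat.le_succ d)).trans (hυ.weaken (by omega : d ≤ d + 2))
  generalize a.eval μ ρ = x at *
  generalize b.eval μ ρ = y at *
  have hs1 : Nat.size 1 = 1 := Nat.size_one
  have hs0 : Nat.size 0 = 0 := Nat.size_zero
  have hsx := Nat.size_le_self_nat x
  have hsy := Nat.size_le_self_nat y
  have hz := (hσ.frame hσυ).zero
  have ho := (hσ.frame hσυ).one
  refine Runs.seq (Runs.add ?_) (by rw [hυv, ho]; omega)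
  refine Runs.seq (Runs.imm ?_) (by rw [hυv, ho]; omega)
  refine Runs.seq (Runs.add ?_) (by simp [h0, hz, hυv, ho]; omega)
  have hloop : x * (1 + P + 20 * P) + 1 ≤ 24 * C := by nlinarith
  -- Repeated subtraction of y + 1, for x rounds. The last clause says that the remainder is already
  -- final or at most the number of rounds left; after the last round it is final in either case.
  refine (Runs.loop (I := fun i ζ => TempFrame R d σ ζ ∧ ζ.reg (tempReg R (d + 3)) = i ∧
      ζ.reg (tempReg R (d + 2)) = y + 1 ∧
      ζ.reg (tempReg R (d + 1)) + ζ.reg (tempReg R d) * (y + 1) = x ∧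
      (ζ.reg (tempReg R (d + 1)) < y + 1 ∨ ζ.reg (tempReg R (d + 1)) ≤ i))
    (K := x) (S := P) (T := 20 * P) (fun _ _ h => h.2.1) (by omega) ?_ ?_).mono ?_ ?_
  · rintro i hi ζ ⟨hf, h1, h2, h3, h4⟩
    have ho := (hσ.frame hf).one
    have hq : ζ.reg (tempReg R d) ≤ x := by nlinarith
    have hr : ζ.reg (tempReg R (d + 1)) ≤ x := by omega
    have hsq := Nat.size_le_self_nat (ζ.reg (tempReg R d))
    have hsr := Nat.size_le_self_nat (ζ.reg (tempReg R (d + 1)))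
    have hsr' := Nat.size_le_self_nat (ζ.reg (tempReg R (d + 1)) + 1)
    have hsr'' := Nat.size_le_self_nat (ζ.reg (tempReg R (d + 1)) + 1 - (y + 1))
    have hsd := Nat.size_le_self_nat (ζ.reg (tempReg R (d + 1)) - y)
    have hsi := Nat.size_le_self_nat (i + 1)
    have hsy' := Nat.size_le_self_nat (y + 1)
    refine Runs.seq (Runs.add ?_) (by rw [ho]; omega)
    refine Runs.seq (Runs.sub ?_) (by simp [h2, ho]; omega)
    refine Runs.seq (Runs.sub ?_) (by simp [h1, h2, ho]; omega)
    refine (Runs.branch (T := 10 * P) (fun hne => ?_) (fun heq => ?_)).mono ?_ fun _ => id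
    · simp [ho, h2] at hne
      refine Runs.seq (Runs.sub ?_) (by simp [h2]; omega)
      refine (Runs.add ?_).mono ?_ fun _ => id
      · refine ⟨((((hf.set (by omega) _).set (by omega) _).set (by omega) _).set
          (by omega) _).set le_rfl _, ?_⟩
        simp [h1, h2, ho]
        refine ⟨?_, by omega⟩
        rw [add_mul, ← h3]
        omega
      · simp [ho, h1, h2]; omega
    · simp [ho, h2] at heq
      refine (Runs.skip ?_).mono (by omega) fun _ => id
      refine ⟨((hf.set (by omega) _).set (by omega) _).set (by omega) _, ?_⟩
      simp [h1, h2, ho, h3]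
      omega
    · simp [ho, h1, h2]; omega
  · refine ⟨((hσυ.set (by omega) _).set le_rfl _).set (by omega) _, ?_⟩
    simp [h0, hυv, hz, ho]
  · simp [h0, hz, hυv, ho]; omega
  · rintro ζ ⟨hf, h1, h2, h3, h4⟩
    refine ⟨hf, ?_⟩
    rw [← h3, Nat.add_mul_div_right _ _ (by omega), Nat.div_eq_of_lt (by omega), zero_add]

/-- An address outside the working memory yields 0 without a load, because the physical cells there
belong to oracle runs. -/
theorem compRuns_read {a : RAMExp} {k : ℕ} (ha : CompRuns a k) : ∃ κ, CompRuns (read a) κ := by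
  obtain ⟨k', hk'⟩ := a.eval_le
  refine ⟨3 * (k + k' + 1) + 7, fun R d β μ ρ σ hσ => ?_⟩
  obtain ⟨P, C, hP, -, hβ, hPPC, hPC, -, hT⟩ := cube_bound β (k + k' + 1) (by omega)
  have hpow : ∀ i, i ≤ k + k' + 1 → (β + 2) ^ i ≤ P := fun i hi =>
    hP ▸ Nat.pow_le_pow_right (by omega) hi
  refine Runs.mono ?_ hT fun _ => id
  simp only [comp, seqs, eval]
  have hva := (hk' β μ ρ hσ.var_le hσ.mem_le).trans (hpow k' (by omega))
  have hka := hpow k (by omega)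
  refine Runs.seq ((ha R d β μ ρ σ hσ).mono hka ?_) (by omega)
  rintro τ ⟨hτ, hτv⟩
  have hτr := hσ.frame hτ
  generalize a.eval μ ρ = x at *
  have hs0 : Nat.size 0 = 0 := Nat.size_zero
  have hsx := Nat.size_le_self_nat x
  have hsb := Nat.size_le_self_nat (τ.reg (specialReg R 2))
  have hsd := Nat.size_le_self_nat (τ.reg (specialReg R 2) - x)
  have hsm := Nat.size_le_self_nat (μ x)
  have hb := hτr.bound_le
  have hm := hσ.mem_le x
  refine Runs.seq (Runs.sub ?_) (by rw [hτv]; omega)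
  refine (Runs.branch (T := 10 * P) (fun hne => ?_) (fun heq => ?_)).mono ?_ fun _ => id
  · simp [hτv] at hne
    have hx := hτr.mem x (by omega)
    refine (Runs.load ?_).mono ?_ fun _ => id
    · exact ⟨(hτ.set (by omega) _).set le_rfl _, by simp [hτv, hx]⟩
    · simp [hτv, hx]; omega
  · simp [hτv] at heq
    have hx := hτr.mem_zero x (by omega)
    refine (Runs.imm ?_).mono ?_ fun _ => id
    · exact ⟨(hτ.set (by omega) _).set le_rfl _, by simp [hx]⟩
    · omega
  · simp [hτv]; omega

theorem compRuns_ite {c a b : RAMExp} {j k l : ℕ} (hc : CompRuns c j) (ha : CompRuns a k)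
    (hb : CompRuns b l) : ∃ κ, CompRuns (ite c a b) κ := by
  obtain ⟨j', hj'⟩ := c.eval_le
  refine ⟨3 * (j + j' + k + l + 1) + 7, fun R d β μ ρ σ hσ => ?_⟩
  obtain ⟨P, C, hP, -, hβ, hPPC, hPC, -, hT⟩ := cube_bound β (j + j' + k + l + 1) (by omega)
  have hpow : ∀ i, i ≤ j + j' + k + l + 1 → (β + 2) ^ i ≤ P := fun i hi =>
    hP ▸ Nat.pow_le_pow_right (by omega) hi
  refine Runs.mono ?_ hT fun _ => id
  simp only [comp, seqs, eval]
  have hvc := (hj' β μ ρ hσ.var_le hσ.mem_le).trans (hpow j' (by omega))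
  have hjc := hpow j (by omega)
  have hka := hpow k (by omega)
  have hlb := hpow l (by omega)
  refine Runs.seq ((hc R d β μ ρ σ hσ).mono hjc ?_) (by omega)
  rintro τ ⟨hτ, hτv⟩
  have hs := Nat.size_le_self_nat (c.eval μ ρ)
  refine (Runs.branch (T := P) (fun hne => ?_) (fun heq => ?_)).mono (by rw [hτv]; omega)
    fun _ => id
  · rw [if_pos (by rwa [hτv] at hne)]
    exact (ha R d β μ ρ τ (hσ.frame hτ)).mono hka fun υ hυ => ⟨hτ.trans hυ.1, hυ.2⟩
  · rw [if_neg (by rw [hτv] at heq; simpa using heq)]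
    exact (hb R d β μ ρ τ (hσ.frame hτ)).mono hlb fun υ hυ => ⟨hτ.trans hυ.1, hυ.2⟩

/-- The index runs downwards, since its loop register counts down; the old content of the variable
is saved in a temporary register and restored at the end. -/
theorem compRuns_sum {x : ℕ} {a b : RAMExp} {k l : ℕ} (ha : CompRuns a k) (hb : CompRuns b l) :
    ∃ κ, CompRuns (sum x a b) κ := by
  obtain ⟨k', hk'⟩ := a.eval_le
  obtain ⟨m', hm'⟩ := (sum x a b).eval_le
  obtain ⟨l', hl'⟩ := b.eval_le
  refine ⟨3 * (k + (k' + 2) * (l + l') + k' + m' + 1) + 7, fun R d β μ ρ σ hσ => ?_⟩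
  obtain ⟨P, C, hP, -, hβ, hPPC, hPC, -, hT⟩ :=
    cube_bound β (k + (k' + 2) * (l + l') + k' + m' + 1) (by omega)
  have hpow : ∀ i, i ≤ k + (k' + 2) * (l + l') + k' + m' + 1 → (β + 2) ^ i ≤ P := fun i hi =>
    hP ▸ Nat.pow_le_pow_right (by omega) hi
  refine Runs.mono ?_ hT fun _ => id
  simp only [comp, seqs]
  have hva' := hk' β μ ρ hσ.var_le hσ.mem_le
  have hva := hva'.trans (hpow k' (by omega))
  have hvm := (hm' β μ ρ hσ.var_le hσ.mem_le).trans (hpow m' (by omega))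
  have hka := hpow k (by omega)
  have hβ' : β ≤ β + a.eval μ ρ := by omega
  have hβ'' : β + a.eval μ ρ + 2 ≤ (β + 2) ^ (k' + 2) := by
    have : 1 ≤ (β + 2) ^ k' := Nat.one_le_pow _ _ (by omega)
    have h4 : 4 ≤ (β + 2) ^ 2 := Nat.pow_le_pow_left (by omega : 2 ≤ β + 2) 2
    rw [pow_add]
    nlinarith
  have hlb : (β + a.eval μ ρ + 2) ^ l ≤ P := (Nat.pow_le_pow_left hβ'' l).trans (by
    rw [← pow_mul]; exact hpow _ (by nlinarith))
  have hlb' : (β + a.eval μ ρ + 2) ^ l' ≤ P := (Nat.pow_le_pow_left hβ'' l').trans (by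
    rw [← pow_mul]; exact hpow _ (by nlinarith))
  refine Runs.seq ((ha R (d + 1) β μ ρ σ hσ).mono hka ?_) (by omega)
  rintro τ ⟨hτ, hτv⟩
  have hτr := hσ.frame hτ
  have hs1 : Nat.size 1 = 1 := Nat.size_one
  have hs0 : Nat.size 0 = 0 := Nat.size_zero
  have hρx := hσ.var_le x
  have hsρ := Nat.size_le_self_nat (ρ x)
  rw [eval] at hvm ⊢
  generalize a.eval μ ρ = n at *
  have hsn := Nat.size_le_self_nat n
  refine Runs.seq (Runs.add ?_) (by rw [hτr.var, hτr.zero]; omega)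
  refine Runs.seq (Runs.imm ?_) (by rw [hτr.var, hτr.zero]; omega)
  set S : ℕ → ℕ := fun i => ∑ i ∈ Finset.range i, b.eval μ (Function.update ρ x i) with hS
  have hSle : ∀ i ≤ n, S i ≤ S n := fun i hi =>
    Finset.sum_le_sum_of_subset (Finset.range_mono hi)
  change S n ≤ P at hvm
  have hloop : n * (1 + P + 20 * P) + 1 ≤ 24 * C := by nlinarith
  -- During the loop only the variable `x` and temporary registers differ from σ. The index may
  -- exceed β, hence the weaker bound β + n for the represented values. The partial sum held so far
  -- is completed by the terms below `i`.
  refine Runs.seq ((Runs.loop (I := fun i ζ => (∃ v, TempFrame R d (σ.setReg (varReg R x) v) ζ ∧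
      v ≤ β + n) ∧ ζ.reg (tempReg R (d + 1)) = i ∧ ζ.reg (tempReg R (d + 2)) = ρ x ∧ i ≤ n ∧
      ζ.reg (tempReg R d) + S i = S n)
    (K := n) (S := P) (T := 20 * P) (fun _ _ h => h.2.1) (by omega) ?_ ?_).mono le_rfl ?_) ?_
  · rintro i hi ζ ⟨⟨v, hf, hv⟩, h1, h2, h3, h4⟩
    have hζ := ((hσ.mono hβ').setVar x v hv).frame hf
    have hsi := Nat.size_le_self_nat (i + 1)
    have hsi' := Nat.size_le_self_nat i
    refine Runs.seq (Runs.sub ?_) (by rw [h1, hζ.one]; omega)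
    refine Runs.seq (Runs.add ?_) (by simp [h1, hζ.one, hζ.zero]; omega)
    have hf' : TempFrame R d (σ.setReg (varReg R x) i)
        ((ζ.setReg (tempReg R (d + 1)) i).setReg (varReg R x) i) := by
      refine ⟨hf.1, fun r hr => ?_⟩
      have := hf.2 r hr
      by_cases hx : r = varReg R x
      · simp [hx]
      · simpa [hx, hr (d + 1) (by omega)] using this
    have hi' : i ≤ β + n := by omega
    simp only [RAMState.reg_setReg, h1, hζ.one, hζ.zero, if_true, Nat.add_sub_cancel,
      specialReg_ne_tempReg, if_false, Nat.add_zero]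
    have hbv := (hl' (β + n) μ _ ((((hσ.mono hβ').setVar x i hi').frame hf').var_le)
      ((hσ.mono hβ').mem_le)).trans hlb'
    refine Runs.seq ((hb R (d + 3) _ μ _ _ (((hσ.mono hβ').setVar x i hi').frame hf')).mono
      hlb ?_) (by omega)
    rintro ξ ⟨hξ, hξv⟩
    have e0 := hξ.temp (show d < d + 3 by omega)
    have e1 := hξ.temp (show d + 1 < d + 3 by omega)
    have e2 := hξ.temp (show d + 2 < d + 3 by omega)
    simp at e0 e1 e2
    have hSi : S (i + 1) = S i + b.eval μ (Function.update ρ x i) := by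
      simp only [hS, Finset.sum_range_succ]
    have hsa := Nat.size_le_self_nat (ζ.reg (tempReg R d))
    have hsb := Nat.size_le_self_nat (b.eval μ (Function.update ρ x i))
    refine (Runs.add ?_).mono ?_ fun _ => id
    · refine ⟨⟨i, (hf'.trans (hξ.weaken (by omega))).set le_rfl _, hi'⟩, ?_⟩
      simp [e0, e1, e2, h2, hξv]
      omega
    · rw [e0, hξv]; omega
  · refine ⟨⟨ρ x, ?_, by omega⟩, ?_⟩
    · have hf : TempFrame R d (σ.setReg (varReg R x) (ρ x)) τ := by
        refine ⟨hτ.1, fun r hr => ?_⟩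
        by_cases hx : r = varReg R x
        · simp [hx, hτr.var]
        · simpa [hx] using (hτ.weaken (Nat.le_succ d)).2 r hr
      exact (hf.set (by omega) _).set le_rfl _
    · simp [hτv, hτr.var, hτr.zero]
  · rintro ζ ⟨⟨v, hf, hv⟩, h1, h2, h3, h4⟩
    have hζ := ((hσ.mono hβ').setVar x v hv).frame hf
    refine (Runs.add ?_).mono ?_ fun _ => id
    · refine ⟨⟨hf.1, fun r hr => ?_⟩, ?_⟩
      · by_cases hx : r = varReg R x
        · simp [hx, h2, hζ.zero, hσ.var]
        · simpa [hx] using hf.2 r hr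
      · simpa [hS] using h4
    · rw [h2, hζ.zero]; simp only [hτr.var, hτr.zero, hs0]; omega
  · simp [hτr.var, hτr.zero]; omega

theorem exists_compRuns (e : RAMExp) : ∃ κ, CompRuns e κ := by
  induction e with
  | var x =>
    refine ⟨1, fun R d β μ ρ σ hσ => ?_⟩
    have := Nat.size_le_self_nat (ρ x)
    have := hσ.var_le x
    refine (Runs.add ?_).mono ?_ fun _ => id
    · exact ⟨TempFrame.refl.set le_rfl _, by simp [hσ.var, hσ.zero, eval]⟩
    · simp [hσ.var, hσ.zero]; omega
  | const c =>
    refine ⟨c + 1, fun R d β μ ρ σ hσ => ?_⟩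
    refine (Runs.imm ?_).mono ?_ fun _ => id
    · exact ⟨TempFrame.refl.set le_rfl _, by simp [eval]⟩
    · have := Nat.size_le_self_nat c
      exact (by omega : 1 + c.size ≤ c + 1).trans (((c + 1).lt_two_pow_self.le).trans
        (Nat.pow_le_pow_left (by omega) _))
  | add a b iha ihb =>
    obtain ⟨k, hk⟩ := iha
    obtain ⟨l, hl⟩ := ihb
    exact compRuns_binop hk hl (fun r s t σ Q h => Runs.add h) (fun _ _ => rfl) fun _ _ => rfl
  | sub a b iha ihb =>
    obtain ⟨k, hk⟩ := iha
    obtain ⟨l, hl⟩ := ihb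
    exact compRuns_binop hk hl (fun r s t σ Q h => Runs.sub h) (fun _ _ => rfl) fun _ _ => rfl
  | mul a b iha ihb =>
    obtain ⟨k, hk⟩ := iha
    obtain ⟨l, hl⟩ := ihb
    exact compRuns_mul hk hl
  | div a b iha ihb =>
    obtain ⟨k, hk⟩ := iha
    obtain ⟨l, hl⟩ := ihb
    exact compRuns_div hk hl
  | read a iha =>
    obtain ⟨k, hk⟩ := iha
    exact compRuns_read hk
  | ite c a b ihc iha ihb =>
    obtain ⟨j, hj⟩ := ihc
    obtain ⟨k, hk⟩ := iha
    obtain ⟨l, hl⟩ := ihb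
    exact compRuns_ite hj hk hl
  | sum x a b iha ihb =>
    obtain ⟨k, hk⟩ := iha
    obtain ⟨l, hl⟩ := ihb
    exact compRuns_sum hk hl

end RAMExp

/-! ### Running the oracle program inside its own copy of the memory. -/

namespace RAMProg

/-- A bound above all the registers that a program names. -/
def regBound : RAMProg → ℕ
  | skip => 0
  | imm r _ => r + 1
  | add r a b => r + a + b + 1
  | sub r a b => r + a + b + 1
  | load r a => r + a + 1
  | store a b => a + b + 1
  | seq p q => p.regBound + q.regBound
  | branch a p q => a + 1 + p.regBound + q.regBound
  | loop a p => a + 1 + p.regBound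

/-- The memory cell that represents the cell `a` in the oracle run with number `j`. -/
def oracleCell (B b j a : ℕ) : ℕ := B + a * 2 ^ b + j

/-- Compute the address that represents the address in register `a`. -/
def oracleAddr (R a : ℕ) : RAMProg := seqs [
  .add (specialReg R 6) a (specialReg R 0),
  .add (specialReg R 7) (specialReg R 4) (specialReg R 0),
  .loop (specialReg R 7) (seqs [
    .add (specialReg R 6) (specialReg R 6) (specialReg R 6),
    .sub (specialReg R 7) (specialReg R 7) (specialReg R 1)]),
  .add (specialReg R 6) (specialReg R 6) (specialReg R 2),
  .add (specialReg R 6) (specialReg R 6) (specialReg R 3)]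

/-- Run a program within the memory cells of the current oracle run. -/
def simulate (R : ℕ) : RAMProg → RAMProg
  | load r a => .seq (oracleAddr R a) (.load r (specialReg R 6))
  | store a b => .seq (oracleAddr R a) (.store (specialReg R 6) b)
  | seq p q => .seq (p.simulate R) (q.simulate R)
  | branch a p q => .branch a (p.simulate R) (q.simulate R)
  | loop a p => .loop a (p.simulate R)
  | p => p

/-- The special registers that oracle runs rely on have their intended contents. -/
structure OracleRegs (R B b j : ℕ) (σ : RAMState) : Prop where
  zero : σ.reg (specialReg R 0) = 0
  one : σ.reg (specialReg R 1) = 1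
  bound : σ.reg (specialReg R 2) = B
  run : σ.reg (specialReg R 3) = j
  bits : σ.reg (specialReg R 4) = b

end RAMProg

theorem Nat.size_add_le (x y : ℕ) : Nat.size (x + y) ≤ Nat.size x + Nat.size y + 1 := by
  rw [Nat.size_le]
  have hx := Nat.lt_size_self x
  have hy := Nat.lt_size_self y
  have h1 : 2 ^ x.size ≤ 2 ^ (x.size + y.size) := Nat.pow_le_pow_right (by omega) (by omega)
  have h2 : 2 ^ y.size ≤ 2 ^ (x.size + y.size) := Nat.pow_le_pow_right (by omega) (by omega)
  rw [pow_succ]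
  omega

theorem Nat.size_mul_two_pow_le (x k : ℕ) : Nat.size (x * 2 ^ k) ≤ Nat.size x + k := by
  rw [Nat.size_le, pow_add]
  exact Nat.mul_lt_mul_of_pos_right (Nat.lt_size_self x) (by positivity)

namespace RAMProg
open RAMProg

theorem OracleRegs.of_reg_eq {R B b j : ℕ} {σ τ : RAMState} (h : OracleRegs R B b j σ)
    (hr : ∀ r ≥ R, r ≠ specialReg R 6 → r ≠ specialReg R 7 → τ.reg r = σ.reg r) :
    OracleRegs R B b j τ := by
  have hle : ∀ k, R ≤ specialReg R k := fun k => by simp only [specialReg]; omega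
  have h' : ∀ k < 6, τ.reg (specialReg R k) = σ.reg (specialReg R k) := fun k hk =>
    hr _ (hle k) (by simp; omega) (by simp; omega)
  exact ⟨(h' 0 (by omega)).trans h.1, (h' 1 (by omega)).trans h.2, (h' 2 (by omega)).trans h.3,
    (h' 3 (by omega)).trans h.4, (h' 4 (by omega)).trans h.5⟩

/-- The shift by `b` bits is done by `b` doublings. The resulting address is longer than the
original one by at most B + 2b + 2 bits, so under logarithmic cost the detour is a factor polynomial
in B + b. -/
theorem oracleAddr_runs {R B b j a : ℕ} {σ : RAMState} (h : OracleRegs R B b j σ)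
    (hj : j < 2 ^ b) :
    (oracleAddr R a).Runs σ (40 * (B + b + 2) ^ 2 * (1 + Nat.size (σ.reg a))) fun τ =>
      τ.mem = σ.mem ∧ τ.reg (specialReg R 6) = oracleCell B b j (σ.reg a) ∧
      Nat.size (τ.reg (specialReg R 6)) ≤ 2 + Nat.size (σ.reg a) + B + 2 * b ∧
      ∀ r, r ≠ specialReg R 6 → r ≠ specialReg R 7 → τ.reg r = σ.reg r := by
  have hsj : Nat.size j ≤ b := Nat.size_le.2 hj
  have hsB := Nat.size_le_self_nat B
  have hsb := Nat.size_le_self_nat b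
  set x := σ.reg a with hx
  set s := Nat.size x with hs
  set w := B + b + 2 with hw
  obtain ⟨C, hC⟩ : ∃ C, C = w ^ 2 * (1 + s) := ⟨_, rfl⟩
  have hT : 40 * w ^ 2 * (1 + s) = 40 * C := by rw [hC]; ring
  have hw2 : 2 * w ≤ w ^ 2 := by nlinarith
  have hC1 : 2 * w * (1 + s) ≤ C := hC ▸ Nat.mul_le_mul_right _ hw2
  have hC2 : w + s ≤ C := by nlinarith
  have hC3 : b * (1 + w + (10 * w + 2 * s)) ≤ 13 * C := by
    rw [hC, sq]
    have : 1 + w + (10 * w + 2 * s) ≤ 13 * w * (1 + s) := by nlinarith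
    calc _ ≤ w * (13 * w * (1 + s)) := Nat.mul_le_mul (by omega) this
      _ = _ := by ring
  rw [hT]
  have hs0 : Nat.size 0 = 0 := Nat.size_zero
  have hs1 : Nat.size 1 = 1 := Nat.size_one
  simp only [oracleAddr, seqs]
  refine Runs.seq (Runs.add ?_) (by rw [h.zero, ← hx]; omega)
  refine Runs.seq (Runs.add ?_) (by simp [h.zero, h.bits, ← hx]; omega)
  refine Runs.seq ((Runs.loop (I := fun i ζ => ζ.mem = σ.mem ∧ ζ.reg (specialReg R 7) = i ∧
      i ≤ b ∧ ζ.reg (specialReg R 6) = x * 2 ^ (b - i) ∧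
      ∀ r, r ≠ specialReg R 6 → r ≠ specialReg R 7 → ζ.reg r = σ.reg r)
    (K := b) (S := w) (T := 10 * w + 2 * s) (fun _ _ h => h.2.1) (by omega) ?_ ?_).mono
      le_rfl ?_) ?_
  · rintro i hi ζ ⟨h1, h2, h3, h4, h5⟩
    have ho := (h.of_reg_eq fun r _ h6 h7 => h5 r h6 h7).one
    have hsx : Nat.size (x * 2 ^ (b - (i + 1))) ≤ s + b :=
      (Nat.size_mul_two_pow_le _ _).trans (by omega)
    have hsi := Nat.size_le_self_nat (i + 1)
    refine Runs.seq (Runs.add ?_) (by rw [h4]; omega)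
    refine (Runs.sub ?_).mono ?_ fun _ => id
    · refine ⟨h1, by simp [h2, ho], by omega, ?_, fun r h6 h7 => by simp [h6, h7, h5]⟩
      simp [h4]
      rw [show b - i = b - (i + 1) + 1 by omega, pow_succ]
      ring
    · simp [h2, ho, h4]; omega
  · refine ⟨rfl, ?_, le_rfl, ?_, fun r h6 h7 => by simp [h6, h7]⟩
    · simp [h.zero, h.bits]
    · simp [h.zero]
      exact hx.symm
  · rintro ζ ⟨h1, h2, h3, h4, h5⟩
    have ho := h.of_reg_eq fun r _ h6 h7 => h5 r h6 h7
    have e1 : Nat.size (x * 2 ^ b) ≤ s + b := Nat.size_mul_two_pow_le _ _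
    have e2 := Nat.size_add_le (x * 2 ^ b) B
    have e3 := Nat.size_add_le (x * 2 ^ b + B) j
    rw [Nat.sub_zero] at h4
    simp only [h.zero, h.bits, RAMState.reg_setReg, specialReg_inj, ← hx]
    norm_num
    refine Runs.seq (Runs.add ?_) (by rw [h4, ho.bound]; omega)
    refine (Runs.add ?_).mono ?_ fun _ => id
    · refine ⟨h1, ?_, ?_, fun r h6 h7 => by simp [h6, h5 r h6 h7]⟩
      · simp [h4, ho.bound, ho.run, oracleCell, add_comm]
      · simp [h4, ho.bound, ho.run]; omega
    · simp [h4, ho.bound, ho.run]; omega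
  · simp [h.zero, h.bits, ← hx]; omega

/-- The state `σ` represents the state `σ₀` of a machine in oracle run `j`. -/
structure OracleRep (R B b j : ℕ) (σ₀ σ : RAMState) : Prop where
  regs : OracleRegs R B b j σ
  reg : ∀ r < R, σ.reg r = σ₀.reg r
  mem : ∀ a, σ.mem (oracleCell B b j a) = σ₀.mem a

/-- What an oracle run may change. -/
def OracleFrame (R B b j : ℕ) (σ τ : RAMState) : Prop :=
  (∀ r ≥ R, r ≠ specialReg R 6 → r ≠ specialReg R 7 → τ.reg r = σ.reg r) ∧
  ∀ c, (∀ a, c ≠ oracleCell B b j a) → τ.mem c = σ.mem c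

theorem OracleFrame.trans {R B b j : ℕ} {σ τ υ : RAMState} (h : OracleFrame R B b j σ τ)
    (h' : OracleFrame R B b j τ υ) : OracleFrame R B b j σ υ :=
  ⟨fun r h1 h2 h3 => (h'.1 r h1 h2 h3).trans (h.1 r h1 h2 h3),
    fun c hc => (h'.2 c hc).trans (h.2 c hc)⟩

theorem OracleRep.setReg {R B b j r : ℕ} {σ₀ σ : RAMState} (h : OracleRep R B b j σ₀ σ)
    (hr : r < R) (v : ℕ) : OracleRep R B b j (σ₀.setReg r v) (σ.setReg r v) ∧
      OracleFrame R B b j σ (σ.setReg r v) := by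
  have hR : ∀ k ≥ R, k ≠ r := fun k hk => by omega
  refine ⟨⟨h.regs.of_reg_eq fun k hk _ _ => by simp [hR k hk], fun k hk => ?_, h.mem⟩,
    fun k hk _ _ => by simp [hR k hk], fun _ _ => rfl⟩
  simp [h.reg k hk]

theorem oracleCell_inj {B b j a a' : ℕ} : oracleCell B b j a = oracleCell B b j a' ↔ a = a' := by
  simp [oracleCell]

/-- Induction on the run. Only `load` and `store` are changed, and their original cost already
contains 1 plus the length of the address, which pays for the translated address up to the fixed
factor. -/
theorem simulate_runs {R B b j : ℕ} (hj : j < 2 ^ b) {p : RAMProg} {σ₀ τ₀ : RAMState} {t : ℕ}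
    (h : RAMExec p σ₀ t τ₀) (hp : p.regBound ≤ R) {σ : RAMState} (hσ : OracleRep R B b j σ₀ σ) :
    (p.simulate R).Runs σ (100 * (B + b + 2) ^ 2 * t) fun τ =>
      OracleRep R B b j τ₀ τ ∧ OracleFrame R B b j σ τ := by
  have hR : ∀ k r, r < R → r ≠ specialReg R k := fun k r hr => by simp only [specialReg]; omega
  set F := 100 * (B + b + 2) ^ 2 with hF
  have hF1 : 1 ≤ F := Nat.succ_le_of_lt (by positivity)
  have hle : ∀ c : ℕ, c ≤ F * c := fun c => Nat.le_mul_of_pos_left c hF1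
  induction h generalizing σ with
  | skip σ₀ =>
    exact (Runs.skip ⟨hσ, fun _ _ _ _ => rfl, fun _ _ => rfl⟩).mono (hle 1) fun _ => id
  | imm σ₀ r v =>
    simp only [regBound] at hp
    exact (Runs.imm (hσ.setReg (by omega) v)).mono (hle _) fun _ => id
  | add σ₀ r x y =>
    simp only [regBound] at hp
    refine (Runs.add ?_).mono (?_ : _ ≤ _) fun _ => id
    · rw [hσ.reg x (by omega), hσ.reg y (by omega)]
      exact hσ.setReg (by omega) _
    · rw [hσ.reg x (by omega), hσ.reg y (by omega)]
      exact hle _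
  | sub σ₀ r x y =>
    simp only [regBound] at hp
    refine (Runs.sub ?_).mono (?_ : _ ≤ _) fun _ => id
    · rw [hσ.reg x (by omega), hσ.reg y (by omega)]
      exact hσ.setReg (by omega) _
    · rw [hσ.reg x (by omega), hσ.reg y (by omega)]
      exact hle _
  | load σ₀ r a =>
    simp only [regBound] at hp
    have h1 := hσ.reg a (by omega)
    have hA := oracleAddr_runs (a := a) hσ.regs hj
    rw [h1] at hA
    have hb : 40 * (B + b + 2) ^ 2 * (1 + Nat.size (σ₀.reg a)) +
        (1 + (2 + Nat.size (σ₀.reg a) + B + 2 * b) + Nat.size (σ₀.mem (σ₀.reg a))) ≤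
        F * (1 + Nat.size (σ₀.reg a) + Nat.size (σ₀.mem (σ₀.reg a))) := by
      have : B + b + 2 ≤ (B + b + 2) ^ 2 := Nat.le_self_pow two_ne_zero _
      rw [hF]
      nlinarith [Nat.zero_le (Nat.size (σ₀.reg a)), Nat.zero_le (Nat.size (σ₀.mem (σ₀.reg a)))]
    refine Runs.seq (hA.mono le_rfl ?_) (by omega)
    rintro τ ⟨m1, m2, m3, m4⟩
    have hrep : OracleRep R B b j σ₀ τ := ⟨hσ.regs.of_reg_eq fun r _ => m4 r,
      fun r hr => (m4 r (hR 6 r hr) (hR 7 r hr)).trans (hσ.reg r hr), fun c => by rw [m1, hσ.mem]⟩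
    have hfr : OracleFrame R B b j σ τ := ⟨fun r _ => m4 r, fun c _ => by rw [m1]⟩
    refine (Runs.load ?_).mono ?_ fun _ => id
    · rw [m2, hrep.mem]
      obtain ⟨g1, g2⟩ := hrep.setReg (r := r) (by omega) (σ₀.mem (σ₀.reg a))
      exact ⟨g1, hfr.trans g2⟩
    · rw [m2, hrep.mem, ← m2]; omega
  | store σ₀ a c =>
    simp only [regBound] at hp
    have h1 := hσ.reg a (by omega)
    have hA := oracleAddr_runs (a := a) hσ.regs hj
    rw [h1] at hA
    have hb : 40 * (B + b + 2) ^ 2 * (1 + Nat.size (σ₀.reg a)) +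
        (1 + (2 + Nat.size (σ₀.reg a) + B + 2 * b) + Nat.size (σ₀.reg c)) ≤
        F * (1 + Nat.size (σ₀.reg a) + Nat.size (σ₀.reg c)) := by
      have : B + b + 2 ≤ (B + b + 2) ^ 2 := Nat.le_self_pow two_ne_zero _
      rw [hF]
      nlinarith [Nat.zero_le (Nat.size (σ₀.reg a)), Nat.zero_le (Nat.size (σ₀.reg c))]
    refine Runs.seq (hA.mono le_rfl ?_) (by omega)
    rintro τ ⟨m1, m2, m3, m4⟩
    have hrep : OracleRep R B b j σ₀ τ := ⟨hσ.regs.of_reg_eq fun r _ => m4 r,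
      fun r hr => (m4 r (hR 6 r hr) (hR 7 r hr)).trans (hσ.reg r hr), fun c => by rw [m1, hσ.mem]⟩
    have h2 := hrep.reg c (by omega)
    refine (Runs.store ?_).mono ?_ fun _ => id
    · refine ⟨⟨hrep.regs.of_reg_eq fun _ _ _ _ => rfl, fun r hr => hrep.reg r hr, fun x => ?_⟩,
        fun r _ => m4 r, fun x hx => ?_⟩
      · simp [m2, oracleCell_inj, h2, hrep.mem]
      · simp [m2, hx, m1]
    · rw [h2]; omega
  | seq h₁ h₂ ih₁ ih₂ =>
    simp only [regBound] at hp
    rw [mul_add]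
    refine Runs.seq ((ih₁ (by omega) hσ).mono le_rfl ?_) (Nat.le_add_right _ _)
    rintro τ ⟨hτ, hf⟩
    refine (ih₂ (by omega) hτ).mono (by omega) fun υ hυ => ⟨hυ.1, hf.trans hυ.2⟩
  | branch_true ha h₁ ih =>
    rename_i a p q _ _ _
    simp only [regBound] at hp
    have h1 := hσ.reg a (by omega)
    rw [mul_add]
    refine (Runs.branch (fun _ => ih (by omega) hσ) (fun h => absurd h (h1 ▸ ha))).mono ?_
      fun _ => id
    rw [h1]
    exact Nat.add_le_add_right (hle _) _
  | branch_false ha h₁ ih =>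
    rename_i a p q _ _ _
    simp only [regBound] at hp
    have h1 := hσ.reg a (by omega)
    rw [mul_add]
    refine (Runs.branch (fun h => absurd (h1.trans ha) h) (fun _ => ih (by omega) hσ)).mono ?_
      fun _ => id
    rw [h1, ha]
    exact Nat.add_le_add_right (hle _) _
  | loop_true ha h₁ h₂ ih₁ ih₂ =>
    rename_i a p _ _ _ t₁ t₂
    have hp' := hp
    simp only [regBound] at hp
    have h1 := hσ.reg a (by omega)
    obtain ⟨t, τ, e1, e2, hτ, hf⟩ := ih₁ (by omega) hσ
    obtain ⟨t', τ', e1', e2', hτ', hf'⟩ := ih₂ hp' hτ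
    refine ⟨_, _, .loop_true (h1 ▸ ha) e1 e1', ?_, hτ', hf.trans hf'⟩
    rw [h1, mul_add, mul_add]
    exact Nat.add_le_add (Nat.add_le_add (hle _) e2) e2'
  | loop_false ha =>
    simp only [regBound] at hp
    refine ⟨_, _, .loop_false ?_, hle 1, hσ, fun _ _ _ _ => rfl, fun _ _ => rfl⟩
    rw [hσ.reg _ (by omega), ha]

end RAMProg

/-! ### A small imperative language with oracle calls -/

/-- Commands over variables, a working memory, and a memory in which oracle queries are
written. -/
inductive RAMCmd : Type
  | skip : RAMCmd
  | assign (x : ℕ) (e : RAMExp) : RAMCmd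
  | store (a e : RAMExp) : RAMCmd
  /-- write into the memory of the next oracle run -/
  | ostore (a e : RAMExp) : RAMCmd
  /-- run the oracle, and put its answer into the variable `x` -/
  | ask (x : ℕ) : RAMCmd
  | seq (c c' : RAMCmd) : RAMCmd
  | ite (e : RAMExp) (c c' : RAMCmd) : RAMCmd
  /-- run `c` for all values of `x` below `e` -/
  | forLt (x : ℕ) (e : RAMExp) (c : RAMCmd) : RAMCmd
  /-- run `c` as often as a fixed large number says -/
  | big (c : RAMCmd) : RAMCmd

/-- States of the imperative language. -/
structure CmdState where
  var : ℕ → ℕ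
  mem : ℕ → ℕ
  orc : ℕ → ℕ

/-! ### Semantics, cost measures and compilation of commands. -/

namespace RAMCmd
open RAMProg

/-- A precondition under which a command establishes the postcondition `Q`. All values in
variables and in the working memory stay at most `B`; `E` is the number of rounds of big loops;
`O q v` says that `v` is a possible answer of the oracle to the query `q`. -/
def wp (B E : ℕ) (O : (ℕ → ℕ) → ℕ → Prop) : RAMCmd → (CmdState → Prop) → CmdState → Prop
  | skip, Q, s => Q s
  | assign x e, Q, s => e.eval s.mem s.var ≤ B ∧
      Q { s with var := Function.update s.var x (e.eval s.mem s.var) }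
  | store a e, Q, s => a.eval s.mem s.var < B ∧ e.eval s.mem s.var ≤ B ∧
      Q { s with mem := Function.update s.mem (a.eval s.mem s.var) (e.eval s.mem s.var) }
  | ostore a e, Q, s =>
      Q { s with orc := Function.update s.orc (a.eval s.mem s.var) (e.eval s.mem s.var) }
  | ask x, Q, s => ∃ v ≤ B, O s.orc v ∧
      Q { s with var := Function.update s.var x v, orc := fun _ => 0 }
  | seq c c', Q, s => c.wp B E O (c'.wp B E O Q) s
  | ite e c c', Q, s => (e.eval s.mem s.var ≠ 0 → c.wp B E O Q s) ∧
      (e.eval s.mem s.var = 0 → c'.wp B E O Q s)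
  | forLt x e c, Q, s => e.eval s.mem s.var ≤ B ∧ ∃ I : ℕ → CmdState → Prop, I 0 s ∧
      (∀ i < e.eval s.mem s.var, ∀ s', I i s' →
        c.wp B E O (I (i + 1)) { s' with var := Function.update s'.var x i }) ∧
      ∀ s', I (e.eval s.mem s.var) s' → Q s'
  | big c, Q, s => ∃ I : ℕ → CmdState → Prop, I 0 s ∧
      (∀ i < E, ∀ s', I i s' → c.wp B E O (I (i + 1)) s') ∧ ∀ s', I E s' → Q s'

/-- A bound for the number of oracle calls. -/
def calls (B E : ℕ) : RAMCmd → ℕ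
  | ask _ => 1
  | seq c c' => c.calls B E + c'.calls B E
  | ite _ c c' => c.calls B E + c'.calls B E
  | forLt _ _ c => B * c.calls B E
  | big c => E * c.calls B E
  | _ => 0

/-- The depth to which big loops are nested. -/
def nest : RAMCmd → ℕ
  | seq c c' => max c.nest c'.nest
  | ite _ c c' => max c.nest c'.nest
  | forLt _ _ c => c.nest
  | big c => c.nest + 1
  | _ => 0

/-- Set the registers below `k` to zero. -/
def clearRegs : ℕ → RAMProg
  | 0 => .skip
  | k + 1 => .seq (clearRegs k) (.imm k 0)

/-- Compilation of commands, for an oracle program `p` that uses only registers below `R`. -/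
def comp (R : ℕ) (p : RAMProg) : RAMCmd → ℕ → RAMProg
  | skip, _ => .skip
  | assign x e, d => seqs [e.comp R d, .add (varReg R x) (tempReg R d) (specialReg R 0)]
  | store a e, d => seqs [a.comp R d, e.comp R (d + 1), .store (tempReg R d) (tempReg R (d + 1))]
  | ostore a e, d => seqs [a.comp R d, e.comp R (d + 1), oracleAddr R (tempReg R d),
      .store (specialReg R 6) (tempReg R (d + 1))]
  | ask x, _ => seqs [clearRegs R, p.simulate R, .add (varReg R x) 0 (specialReg R 0),
      .add (specialReg R 3) (specialReg R 3) (specialReg R 1)]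
  | seq c c', d => .seq (c.comp R p d) (c'.comp R p d)
  | ite e c c', d => seqs [e.comp R d, .branch (tempReg R d) (c.comp R p d) (c'.comp R p d)]
  | forLt x e c, d => seqs [e.comp R d,
      .add (tempReg R (d + 1)) (tempReg R d) (specialReg R 0),
      .loop (tempReg R (d + 1)) (seqs [
        .sub (varReg R x) (tempReg R d) (tempReg R (d + 1)),
        c.comp R p (d + 2),
        .sub (tempReg R (d + 1)) (tempReg R (d + 1)) (specialReg R 1)])]
  | big c, d => seqs [.add (tempReg R d) (specialReg R 5) (specialReg R 0),
      .loop (tempReg R d) (seqs [c.comp R p (d + 1),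
        .sub (tempReg R d) (tempReg R d) (specialReg R 1)])]

/-- The program `p`, started on the memory `q`, answers `v` within time `T`. -/
def OracleRuns (p : RAMProg) (T : ℕ) (q : ℕ → ℕ) (v : ℕ) : Prop :=
  p.Runs ⟨fun _ => 0, q⟩ T fun τ => τ.reg 0 = v

/-- The machine state `σ` represents `s`, and `j` oracle runs have taken place. -/
structure Rep (R B b E j : ℕ) (s : CmdState) (σ : RAMState) : Prop where
  regs : OracleRegs R B b j σ
  big : σ.reg (specialReg R 5) = E
  var : ∀ x, σ.reg (varReg R x) = s.var x
  mem : ∀ a < B, σ.mem a = s.mem a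
  mem_zero : ∀ a, B ≤ a → s.mem a = 0
  orc : ∀ a, σ.mem (oracleCell B b j a) = s.orc a
  fresh : ∀ j', j < j' → j' < 2 ^ b → ∀ a, σ.mem (oracleCell B b j' a) = 0
  var_le : ∀ x, s.var x ≤ B
  mem_le : ∀ a, s.mem a ≤ B

namespace Rep
variable {R B b E j d : ℕ} {s : CmdState} {σ τ : RAMState}

theorem exp (h : Rep R B b E j s σ) : RAMExp.Rep R B s.mem s.var σ where
  zero := h.regs.zero
  one := h.regs.one
  var := h.var
  mem a ha := h.mem a (by rwa [h.regs.bound] at ha)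
  mem_zero a ha := h.mem_zero a (by rwa [h.regs.bound] at ha)
  var_le := h.var_le
  mem_le := h.mem_le
  bound_le := h.regs.bound.le

theorem congr (h : Rep R B b E j s σ) (hm : τ.mem = σ.mem)
    (hs : ∀ k < 6, τ.reg (specialReg R k) = σ.reg (specialReg R k))
    (hv : ∀ x, τ.reg (varReg R x) = σ.reg (varReg R x)) : Rep R B b E j s τ where
  regs := ⟨(hs 0 (by omega)).trans h.regs.1, (hs 1 (by omega)).trans h.regs.2,
    (hs 2 (by omega)).trans h.regs.3, (hs 3 (by omega)).trans h.regs.4,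
    (hs 4 (by omega)).trans h.regs.5⟩
  big := (hs 5 (by omega)).trans h.big
  var x := (hv x).trans (h.var x)
  mem := by rw [hm]; exact h.mem
  mem_zero := h.mem_zero
  orc := by rw [hm]; exact h.orc
  fresh := by rw [hm]; exact h.fresh
  var_le := h.var_le
  mem_le := h.mem_le

theorem frame (h : Rep R B b E j s σ) (hf : TempFrame R d σ τ) : Rep R B b E j s τ :=
  h.congr hf.1 (fun k _ => hf.special k) hf.var

theorem setTemp (h : Rep R B b E j s σ) (k v : ℕ) :
    Rep R B b E j s (σ.setReg (tempReg R k) v) := h.frame (TempFrame.refl.set (Nat.zero_le k) v)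

theorem setVar (h : Rep R B b E j s σ) (x v : ℕ) (hv : v ≤ B) :
    Rep R B b E j { s with var := Function.update s.var x v } (σ.setReg (varReg R x) v) where
  regs := by
    refine ⟨?_, ?_, ?_, ?_, ?_⟩ <;>
      simp [h.regs.zero, h.regs.one, h.regs.bound, h.regs.run, h.regs.bits]
  big := by simp [h.big]
  var y := by simp [Function.update_apply, h.var y]
  mem := h.mem
  mem_zero := h.mem_zero
  orc := h.orc
  fresh := h.fresh
  var_le y := by
    simp only [Function.update_apply]
    split_ifs
    exacts [hv, h.var_le y]
  mem_le := h.mem_le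

theorem setMem (h : Rep R B b E j s σ) (a v : ℕ) (ha : a < B) (hv : v ≤ B) :
    Rep R B b E j { s with mem := Function.update s.mem a v } (σ.setMem a v) where
  regs := ⟨h.regs.1, h.regs.2, h.regs.3, h.regs.4, h.regs.5⟩
  big := h.big
  var := h.var
  mem c hc := by simp [Function.update_apply, h.mem c hc]
  mem_zero c hc := by simp [Function.update_apply, h.mem_zero c hc]; omega
  orc c := by
    rw [RAMState.mem_setMem, if_neg (by rw [oracleCell]; omega)]
    exact h.orc c
  fresh j' h1 h2 c := by
    rw [RAMState.mem_setMem, if_neg (by rw [oracleCell]; omega)]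
    exact h.fresh j' h1 h2 c
  var_le := h.var_le
  mem_le c := by
    simp only [Function.update_apply]
    split_ifs
    exacts [hv, h.mem_le c]

/-- The number of the run is the residue modulo 2^b of the address minus `B`, so different runs
never share a cell. -/
theorem _root_.RAMProg.oracleCell_ne {B b j j' a a' : ℕ} (hj : j < 2 ^ b) (hj' : j' < 2 ^ b)
    (h : j ≠ j') : oracleCell B b j a ≠ oracleCell B b j' a' := by
  intro he
  simp only [oracleCell] at he
  have : (j + a * 2 ^ b) % 2 ^ b = (j' + a' * 2 ^ b) % 2 ^ b := by congr 1; omega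
  rw [Nat.add_mul_mod_self_right, Nat.add_mul_mod_self_right, Nat.mod_eq_of_lt hj,
    Nat.mod_eq_of_lt hj'] at this
  exact h this

theorem setOrc (h : Rep R B b E j s σ) (hj : j < 2 ^ b) (a v : ℕ) :
    Rep R B b E j { s with orc := Function.update s.orc a v }
      (σ.setMem (oracleCell B b j a) v) where
  regs := ⟨h.regs.1, h.regs.2, h.regs.3, h.regs.4, h.regs.5⟩
  big := h.big
  var := h.var
  mem c hc := by
    rw [RAMState.mem_setMem, if_neg (by rw [oracleCell]; omega)]
    exact h.mem c hc
  mem_zero := h.mem_zero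
  orc c := by simp [oracleCell_inj, Function.update_apply, h.orc c]
  fresh j' h1 h2 c := by
    rw [RAMState.mem_setMem, if_neg (oracleCell_ne h2 hj h1.ne')]
    exact h.fresh j' h1 h2 c
  var_le := h.var_le
  mem_le := h.mem_le

end Rep

/-- What compilation of a command has to achieve. -/
def CompRuns (R : ℕ) (p : RAMProg) (c : RAMCmd) (κ : ℕ) : Prop :=
  ∀ (B b E j d T : ℕ) (Q : CmdState → Prop) (s : CmdState) (σ : RAMState),
    Rep R B b E j s σ → 1 ≤ E → Nat.size E ≤ B + 1 → 1 ≤ T → j + c.calls B E < 2 ^ b →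
    c.wp B E (OracleRuns p T) Q s →
    (c.comp R p d).Runs σ ((B + b + 2) ^ κ * (E ^ c.nest * T)) fun τ => ∃ s' j', Q s' ∧
      Rep R B b E j' s' τ ∧ j' ≤ j + c.calls B E ∧
      ∀ d' < d, τ.reg (tempReg R d') = σ.reg (tempReg R d')

theorem clearRegs_runs (k : ℕ) (σ : RAMState) : (clearRegs k).Runs σ (k + 1) fun τ =>
    τ.mem = σ.mem ∧ ∀ r, τ.reg r = if r < k then 0 else σ.reg r := by
  induction k with
  | zero => exact Runs.skip ⟨rfl, fun r => by simp⟩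
  | succ k ih =>
    refine Runs.seq (ih.mono le_rfl ?_) (by omega)
    rintro τ ⟨h1, h2⟩
    refine (Runs.imm ?_).mono ?_ fun _ => id
    · refine ⟨h1, fun r => ?_⟩
      rw [RAMState.reg_setReg, h2]
      split_ifs <;> first | rfl | omega
    · simp

/-- Bookkeeping for the cost bounds below. -/
theorem cost_bound (w K G : ℕ) (hw : 2 ≤ w) (hK : 1 ≤ K) (hG : 1 ≤ G) :
    ∃ P C : ℕ, P = w ^ K ∧ w ≤ P ∧ P ≤ P * P ∧ P * P ≤ C ∧ P * G ≤ C ∧ P * (P * G) = C ∧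
      128 * C ≤ w ^ (2 * K + 7) * G := by
  have hP : 1 ≤ w ^ K := Nat.one_le_pow _ _ (by omega)
  refine ⟨_, _, rfl, Nat.le_self_pow (by omega) _, Nat.le_mul_of_pos_left _ hP, ?_, ?_, rfl, ?_⟩
  · exact Nat.mul_le_mul_left _ (Nat.le_mul_of_pos_right _ hG)
  · exact Nat.le_mul_of_pos_left _ hP
  · have : 2 ^ 7 ≤ w ^ 7 := Nat.pow_le_pow_left (by omega) 7
    calc 128 * (w ^ K * (w ^ K * G)) = 2 ^ 7 * (w ^ (2 * K) * G) := by ring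
      _ ≤ w ^ 7 * (w ^ (2 * K) * G) := Nat.mul_le_mul_right _ this
      _ = _ := by ring

theorem calls_add_le {x y w E k l m n : ℕ} (hx : x ≤ (w + 2) ^ k * E ^ m)
    (hy : y ≤ (w + 2) ^ l * E ^ n) (hE : 1 ≤ E) :
    x + y ≤ (w + 2) ^ (k + l + 1) * E ^ max m n := by
  have h1 : (w + 2) ^ k * E ^ m ≤ (w + 2) ^ (k + l) * E ^ max m n := Nat.mul_le_mul
    (Nat.pow_le_pow_right (by omega) (by omega)) (Nat.pow_le_pow_right hE (le_max_left _ _))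
  have h2 : (w + 2) ^ l * E ^ n ≤ (w + 2) ^ (k + l) * E ^ max m n := Nat.mul_le_mul
    (Nat.pow_le_pow_right (by omega) (by omega)) (Nat.pow_le_pow_right hE (le_max_right _ _))
  rw [pow_succ, mul_right_comm]
  nlinarith

/-! ### Each command compiles with polynomial overhead. -/

section
variable (R : ℕ) (p : RAMProg)

theorem compRuns_skip : ∃ κ, CompRuns R p skip κ := by
  refine ⟨0, fun B b E j d T Q s σ hσ hE hE' hT hj hwp => ?_⟩
  refine (Runs.skip ⟨s, j, hwp, hσ, by omega, fun _ _ => rfl⟩).mono ?_ fun _ => id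
  simpa [nest] using hT

theorem compRuns_assign (x : ℕ) (e : RAMExp) : ∃ κ, CompRuns R p (assign x e) κ := by
  obtain ⟨k, hk⟩ := e.exists_compRuns
  refine ⟨2 * (k + 1) + 7, fun B b E j d T Q s σ hσ hE hE' hT hj hwp => ?_⟩
  have hG : 1 ≤ E ^ (assign x e).nest * T := Nat.mul_pos (Nat.one_le_pow _ _ hE) hT
  obtain ⟨P, C, hP, hw, h1, h2, h3, -, h4⟩ :=
    cost_bound (B + b + 2) (k + 1) _ (by omega) (by omega) hG
  refine Runs.mono ?_ h4 fun _ => id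
  have hk' : (B + 2) ^ k ≤ P := hP ▸ (Nat.pow_le_pow_left (by omega) k).trans
    (Nat.pow_le_pow_right (by omega) (by omega))
  obtain ⟨hv, hQ⟩ := hwp
  have hs := Nat.size_le_self_nat (e.eval s.mem s.var)
  simp only [comp, seqs]
  refine Runs.seq ((hk R d B _ _ σ hσ.exp).mono hk' ?_) (by omega)
  rintro τ ⟨hτ, hτv⟩
  have hr := hσ.frame hτ
  refine (Runs.add ?_).mono ?_ fun _ => id
  · rw [hτv, hr.regs.zero, Nat.add_zero]
    exact ⟨_, j, hQ, hr.setVar x _ hv, by omega, fun d' hd => by simpa using hτ.temp hd⟩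
  · rw [hτv, hr.regs.zero, Nat.size_zero]; omega

theorem compRuns_store (a e : RAMExp) : ∃ κ, CompRuns R p (store a e) κ := by
  obtain ⟨k, hk⟩ := a.exists_compRuns
  obtain ⟨l, hl⟩ := e.exists_compRuns
  refine ⟨2 * (k + l + 1) + 7, fun B b E j d T Q s σ hσ hE hE' hT hj hwp => ?_⟩
  have hG : 1 ≤ E ^ (store a e).nest * T := Nat.mul_pos (Nat.one_le_pow _ _ hE) hT
  obtain ⟨P, C, hP, hw, h1, h2, h3, -, h4⟩ :=
    cost_bound (B + b + 2) (k + l + 1) _ (by omega) (by omega) hG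
  refine Runs.mono ?_ h4 fun _ => id
  have hk' : (B + 2) ^ k ≤ P := hP ▸ (Nat.pow_le_pow_left (by omega) k).trans
    (Nat.pow_le_pow_right (by omega) (by omega))
  have hl' : (B + 2) ^ l ≤ P := hP ▸ (Nat.pow_le_pow_left (by omega) l).trans
    (Nat.pow_le_pow_right (by omega) (by omega))
  obtain ⟨ha, hv, hQ⟩ := hwp
  have hs := Nat.size_le_self_nat (e.eval s.mem s.var)
  have hs' := Nat.size_le_self_nat (a.eval s.mem s.var)
  simp only [comp, seqs]
  refine Runs.seq ((hk R d B _ _ σ hσ.exp).mono hk' ?_) (by omega)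
  rintro τ ⟨hτ, hτv⟩
  have hr := hσ.frame hτ
  refine Runs.seq ((hl R (d + 1) B _ _ τ hr.exp).mono hl' ?_) (by omega)
  rintro υ ⟨hυ, hυv⟩
  have hr' := hr.frame hυ
  have h0 := (hυ.temp (Nat.lt_succ_self d)).trans hτv
  refine (Runs.store ?_).mono ?_ fun _ => id
  · rw [h0, hυv]
    exact ⟨_, j, hQ, hr'.setMem _ _ ha hv, by omega, fun d' hd =>
      (hυ.temp (by omega : d' < d + 1)).trans (hτ.temp hd)⟩
  · rw [h0, hυv]; omega

theorem compRuns_ostore (a e : RAMExp) : ∃ κ, CompRuns R p (ostore a e) κ := by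
  obtain ⟨k, hk⟩ := a.exists_compRuns
  obtain ⟨l, hl⟩ := e.exists_compRuns
  obtain ⟨k', hk'⟩ := a.eval_le
  obtain ⟨l', hl'⟩ := e.eval_le
  refine ⟨2 * (k + l + k' + l' + 2) + 7, fun B b E j d T Q s σ hσ hE hE' hT hj hwp => ?_⟩
  have hG : 1 ≤ E ^ (ostore a e).nest * T := Nat.mul_pos (Nat.one_le_pow _ _ hE) hT
  obtain ⟨P, C, hP, hw, h1, h2, h3, -, h4⟩ :=
    cost_bound (B + b + 2) (k + l + k' + l' + 2) _ (by omega) (by omega) hG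
  refine Runs.mono ?_ h4 fun _ => id
  have hpow : ∀ i ≤ k + l + k' + l' + 2, (B + 2) ^ i ≤ P := fun i hi =>
    hP ▸ (Nat.pow_le_pow_left (by omega) i).trans (Nat.pow_le_pow_right (by omega) (by omega))
  have hw2 : (B + b + 2) ^ 2 ≤ P := hP ▸ Nat.pow_le_pow_right (by omega) (by omega)
  have e1 := hpow k (by omega)
  have e2 := hpow l (by omega)
  have e3 := (hk' B _ _ hσ.var_le hσ.mem_le).trans (hpow k' (by omega))
  have e4 := (hl' B _ _ hσ.var_le hσ.mem_le).trans (hpow l' (by omega))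
  have hs := Nat.size_le_self_nat (e.eval s.mem s.var)
  have hs' := Nat.size_le_self_nat (a.eval s.mem s.var)
  have hA : 40 * (B + b + 2) ^ 2 * (1 + Nat.size (a.eval s.mem s.var)) ≤ 80 * P := by
    have h5 := hk' B _ _ hσ.var_le hσ.mem_le
    have h6 : (B + 2) ^ k' ≤ (B + b + 2) ^ k' := Nat.pow_le_pow_left (by omega) k'
    have h7 : 1 ≤ (B + b + 2) ^ k' := Nat.one_le_pow _ _ (by omega)
    calc _ ≤ 40 * (B + b + 2) ^ 2 * (2 * (B + b + 2) ^ k') := Nat.mul_le_mul_left _ (by omega)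
      _ = 80 * (B + b + 2) ^ (2 + k') := by ring
      _ ≤ 80 * P := Nat.mul_le_mul_left _ (hP ▸ Nat.pow_le_pow_right (by omega) (by omega))
  simp only [comp, seqs]
  refine Runs.seq ((hk R d B _ _ σ hσ.exp).mono e1 ?_) (by omega)
  rintro τ ⟨hτ, hτv⟩
  have hr := hσ.frame hτ
  refine Runs.seq ((hl R (d + 1) B _ _ τ hr.exp).mono e2 ?_) (by omega)
  rintro υ ⟨hυ, hυv⟩
  have hr' := hr.frame hυ
  have h0 := (hυ.temp (Nat.lt_succ_self d)).trans hτv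
  have hj' : j < 2 ^ b := lt_of_le_of_lt (Nat.le_add_right _ _) hj
  have hrun := oracleAddr_runs (a := tempReg R d) hr'.regs hj'
  rw [h0] at hrun
  refine Runs.seq (hrun.mono hA ?_) (by omega)
  rintro ξ ⟨m1, m2, m3, m4⟩
  have hr'' : Rep R B b E j s ξ := hr'.congr m1
    (fun k hk => m4 _ (by simp; omega) (by simp; omega)) (fun x => m4 _ (by simp) (by simp))
  have h5 := (m4 (tempReg R (d + 1)) (by simp) (by simp)).trans hυv
  refine (Runs.store ?_).mono ?_ fun _ => id
  · rw [m2, h5]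
    exact ⟨_, j, hwp, hr''.setOrc hj' _ _, by omega, fun d' hd => (m4 _ (by simp) (by simp)).trans
      ((hυ.temp (by omega : d' < d + 1)).trans (hτ.temp hd))⟩
  · rw [h5]; omega

theorem compRuns_seq {c c' : RAMCmd} {k l : ℕ} (hc : CompRuns R p c k) (hc' : CompRuns R p c' l) :
    ∃ κ, CompRuns R p (seq c c') κ := by
  refine ⟨2 * (k + l + 1) + 7, fun B b E j d T Q s σ hσ hE hE' hT hj hwp => ?_⟩
  have hG : 1 ≤ E ^ (seq c c').nest * T := Nat.mul_pos (Nat.one_le_pow _ _ hE) hT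
  obtain ⟨P, C, hP, hw, h1, h2, h3, -, h4⟩ :=
    cost_bound (B + b + 2) (k + l + 1) _ (by omega) (by omega) hG
  refine Runs.mono ?_ h4 fun _ => id
  have e1 : (B + b + 2) ^ k * (E ^ c.nest * T) ≤ P * (E ^ (seq c c').nest * T) :=
    Nat.mul_le_mul (hP ▸ Nat.pow_le_pow_right (by omega) (by omega))
      (Nat.mul_le_mul_right _ (Nat.pow_le_pow_right hE (le_max_left _ _)))
  have e2 : (B + b + 2) ^ l * (E ^ c'.nest * T) ≤ P * (E ^ (seq c c').nest * T) :=
    Nat.mul_le_mul (hP ▸ Nat.pow_le_pow_right (by omega) (by omega))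
      (Nat.mul_le_mul_right _ (Nat.pow_le_pow_right hE (le_max_right _ _)))
  simp only [calls] at hj ⊢
  refine Runs.seq ((hc B b E j d T _ s σ hσ hE hE' hT (by omega) hwp).mono e1 ?_) (by omega)
  rintro τ ⟨s', j', hwp', hr, hj', hd⟩
  refine (hc' B b E j' d T Q s' τ hr hE hE' hT (by omega) hwp').mono (by omega) ?_
  rintro υ ⟨s'', j'', hQ, hr', hj'', hd'⟩
  exact ⟨s'', j'', hQ, hr', by omega, fun d' h => (hd' d' h).trans (hd d' h)⟩

theorem compRuns_ite (e : RAMExp) {c c' : RAMCmd} {k l : ℕ} (hc : CompRuns R p c k)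
    (hc' : CompRuns R p c' l) : ∃ κ, CompRuns R p (ite e c c') κ := by
  obtain ⟨i, hi⟩ := e.exists_compRuns
  obtain ⟨i', hi'⟩ := e.eval_le
  refine ⟨2 * (k + l + i + i' + 1) + 7, fun B b E j d T Q s σ hσ hE hE' hT hj hwp => ?_⟩
  have hG : 1 ≤ E ^ (ite e c c').nest * T := Nat.mul_pos (Nat.one_le_pow _ _ hE) hT
  obtain ⟨P, C, hP, hw, h1, h2, h3, -, h4⟩ :=
    cost_bound (B + b + 2) (k + l + i + i' + 1) _ (by omega) (by omega) hG
  refine Runs.mono ?_ h4 fun _ => id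
  have e1 : (B + b + 2) ^ k * (E ^ c.nest * T) ≤ P * (E ^ (ite e c c').nest * T) :=
    Nat.mul_le_mul (hP ▸ Nat.pow_le_pow_right (by omega) (by omega))
      (Nat.mul_le_mul_right _ (Nat.pow_le_pow_right hE (le_max_left _ _)))
  have e2 : (B + b + 2) ^ l * (E ^ c'.nest * T) ≤ P * (E ^ (ite e c c').nest * T) :=
    Nat.mul_le_mul (hP ▸ Nat.pow_le_pow_right (by omega) (by omega))
      (Nat.mul_le_mul_right _ (Nat.pow_le_pow_right hE (le_max_right _ _)))
  have hpow : ∀ a ≤ k + l + i + i' + 1, (B + 2) ^ a ≤ P := fun a ha =>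
    hP ▸ (Nat.pow_le_pow_left (by omega) a).trans (Nat.pow_le_pow_right (by omega) (by omega))
  have e3 := hpow i (by omega)
  have e4 := (hi' B _ _ hσ.var_le hσ.mem_le).trans (hpow i' (by omega))
  have hs := Nat.size_le_self_nat (e.eval s.mem s.var)
  simp only [calls] at hj ⊢
  simp only [comp, seqs]
  refine Runs.seq ((hi R d B _ _ σ hσ.exp).mono e3 ?_) (by omega)
  rintro τ ⟨hτ, hτv⟩
  have hr := hσ.frame hτ
  refine (Runs.branch (T := C) (fun hne => ?_) (fun heq => ?_)).mono (by rw [hτv]; omega)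
    fun _ => id
  · refine (hc B b E j d T Q s τ hr hE hE' hT (by omega) (hwp.1 (by rwa [hτv] at hne))).mono
      (by omega) ?_
    rintro υ ⟨s'', j'', hQ, hr', hj'', hd'⟩
    exact ⟨s'', j'', hQ, hr', by omega, fun d' h => (hd' d' h).trans (hτ.temp h)⟩
  · refine (hc' B b E j d T Q s τ hr hE hE' hT (by omega) (hwp.2 (by rwa [hτv] at heq))).mono
      (by omega) ?_
    rintro υ ⟨s'', j'', hQ, hr', hj'', hd'⟩
    exact ⟨s'', j'', hQ, hr', by omega, fun d' h => (hd' d' h).trans (hτ.temp h)⟩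

/-- Clearing the registers below `R` and having the query in the cells of run `j` puts the oracle
program exactly into its start state. Afterwards only the run counter is advanced. -/
theorem compRuns_ask (x : ℕ) (hp : p.regBound ≤ R) (hR : 0 < R) : ∃ κ, CompRuns R p (ask x) κ := by
  refine ⟨2 * (R + 2 + 1) + 7, fun B b E j d T Q s σ hσ hE hE' hT hj hwp => ?_⟩
  have hG : 1 ≤ E ^ (ask x).nest * T := Nat.mul_pos (Nat.one_le_pow _ _ hE) hT
  obtain ⟨P, C, hP, hw, h1, h2, h3, -, h4⟩ :=
    cost_bound (B + b + 2) (R + 2 + 1) _ (by omega) (by omega) hG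
  refine Runs.mono ?_ h4 fun _ => id
  have hRP : R + 1 ≤ P := by
    rw [hP]
    exact (Nat.lt_two_pow_self (n := R)).trans_le
      ((Nat.pow_le_pow_left (by omega : 2 ≤ B + b + 2) R).trans
        (Nat.pow_le_pow_right (by omega) (by omega)))
  have hsim : 100 * (B + b + 2) ^ 2 * T ≤ 100 * C := by
    have : (B + b + 2) ^ 2 ≤ P := hP ▸ Nat.pow_le_pow_right (by omega) (by omega)
    simp only [nest, pow_zero, one_mul] at h3
    calc _ = 100 * ((B + b + 2) ^ 2 * T) := by ring
      _ ≤ 100 * (P * T) := Nat.mul_le_mul_left _ (Nat.mul_le_mul_right _ this)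
      _ ≤ _ := Nat.mul_le_mul_left _ h3
  obtain ⟨v, hv, ⟨t, τ₀, hex, htT, hans⟩, hQ⟩ := hwp
  simp only [calls] at hj ⊢
  have hle : ∀ k, R ≤ specialReg R k := fun k => by simp only [specialReg]; omega
  have hle' : ∀ k, R ≤ varReg R k := fun k => by simp only [varReg]; omega
  have hle'' : ∀ k, R ≤ tempReg R k := fun k => by simp only [tempReg]; omega
  have hjb : j < 2 ^ b := by omega
  simp only [comp, seqs]
  refine Runs.seq ((clearRegs_runs R σ).mono hRP ?_) (by omega)
  rintro τ ⟨hτm, hτr⟩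
  have hge : ∀ r, R ≤ r → τ.reg r = σ.reg r := fun r hr => by rw [hτr, if_neg (by omega)]
  have horep : OracleRep R B b j ⟨fun _ => 0, s.orc⟩ τ :=
    ⟨hσ.regs.of_reg_eq fun r hr _ _ => hge r hr, fun r hr => by rw [hτr, if_pos hr],
      fun a => by rw [hτm, hσ.orc]⟩
  refine Runs.seq ((simulate_runs hjb hex hp horep).mono
    ((Nat.mul_le_mul_left _ htT).trans hsim) ?_) (by omega)
  rintro υ ⟨hυ, hf⟩
  have h0 : υ.reg 0 = v := (hυ.reg 0 hR).trans hans
  have hs : ∀ k < 6, υ.reg (specialReg R k) = σ.reg (specialReg R k) := fun k hk =>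
    (hf.1 _ (hle k) (by simp; omega) (by simp; omega)).trans (hge _ (hle k))
  have hvar : ∀ k, υ.reg (varReg R k) = σ.reg (varReg R k) := fun k =>
    (hf.1 _ (hle' k) (by simp) (by simp)).trans (hge _ (hle' k))
  have htmp : ∀ k, υ.reg (tempReg R k) = σ.reg (tempReg R k) := fun k =>
    (hf.1 _ (hle'' k) (by simp) (by simp)).trans (hge _ (hle'' k))
  have hs0 : Nat.size 0 = 0 := Nat.size_zero
  have hs1 : Nat.size 1 = 1 := Nat.size_one
  have hsv := Nat.size_le_self_nat v
  have hsj : Nat.size j ≤ b := Nat.size_le.2 hjb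
  have hz := (hs 0 (by omega)).trans hσ.regs.zero
  have hrun := (hs 3 (by omega)).trans hσ.regs.run
  have hone := (hs 1 (by omega)).trans hσ.regs.one
  refine Runs.seq (Runs.add ?_) (by rw [h0, hz]; omega)
  refine (Runs.add ?_).mono ?_ fun _ => id
  · rw [h0, hz, Nat.add_zero]
    simp only [RAMState.reg_setReg, specialReg_ne_varReg, if_false, hrun, hone]
    refine ⟨_, j + 1, hQ, ?_, le_rfl, fun d' hd => by simp [htmp]⟩
    have hout : ∀ c, (∀ a, c ≠ oracleCell B b j a) → υ.mem c = σ.mem c := fun c hc =>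
      (hf.2 c hc).trans (by rw [hτm])
    refine ⟨⟨?_, ?_, ?_, ?_, ?_⟩, ?_, fun y => ?_, fun a ha => ?_, hσ.mem_zero, fun a => ?_,
      fun j' hj' hj'' a => ?_, fun y => ?_, hσ.mem_le⟩
    · simp [hz]
    · simp [hone]
    · simp [(hs 2 (by omega)).trans hσ.regs.bound]
    · simp
    · simp [(hs 4 (by omega)).trans hσ.regs.bits]
    · simp [(hs 5 (by omega)).trans hσ.big]
    · simp [Function.update_apply, hvar, hσ.var]
    · exact (hout a fun c => by rw [oracleCell]; omega).trans (hσ.mem a ha)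
    -- The next run finds its memory blank because no cell of run j + 1 has been touched; nothing is
    -- erased. That j + 1 is still below 2^b comes from the bound on the number of calls.
    · exact (hout _ fun c => oracleCell_ne (by omega) hjb (by omega)).trans
        (hσ.fresh (j + 1) (by omega) (by omega) a)
    · exact (hout _ fun c => oracleCell_ne hj'' hjb (by omega)).trans
        (hσ.fresh j' (by omega) hj'' a)
    · simp only [Function.update_apply]
      split_ifs
      exacts [hv, hσ.var_le y]
  · simp [hrun, hone, h0, hz]; omega

theorem compRuns_for (x : ℕ) (e : RAMExp) {c : RAMCmd} {k : ℕ} (hc : CompRuns R p c k) :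
    ∃ κ, CompRuns R p (forLt x e c) κ := by
  obtain ⟨i, hi⟩ := e.exists_compRuns
  refine ⟨2 * (k + i + 1) + 7, fun B b E j d T Q s σ hσ hE hE' hT hj hwp => ?_⟩
  have hG : 1 ≤ E ^ (forLt x e c).nest * T := Nat.mul_pos (Nat.one_le_pow _ _ hE) hT
  obtain ⟨P, C, hP, hw, h1, h2, h3, h3', h4⟩ :=
    cost_bound (B + b + 2) (k + i + 1) _ (by omega) (by omega) hG
  refine Runs.mono ?_ h4 fun _ => id
  have e1 : (B + b + 2) ^ k * (E ^ c.nest * T) ≤ P * (E ^ (forLt x e c).nest * T) :=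
    Nat.mul_le_mul (hP ▸ Nat.pow_le_pow_right (by omega) (by omega)) le_rfl
  have e3 : (B + 2) ^ i ≤ P := hP ▸ (Nat.pow_le_pow_left (by omega) i).trans
    (Nat.pow_le_pow_right (by omega) (by omega))
  generalize P * (E ^ (forLt x e c).nest * T) = X at *
  obtain ⟨hK, I, hI0, hI, hIQ⟩ := hwp
  have hs1 : Nat.size 1 = 1 := Nat.size_one
  have hs0 : Nat.size 0 = 0 := Nat.size_zero
  simp only [calls] at hj ⊢
  simp only [comp, seqs]
  refine Runs.seq ((hi R d B _ _ σ hσ.exp).mono e3 ?_) (by omega)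
  rintro τ ⟨hτ, hτv⟩
  have hr := hσ.frame hτ
  generalize e.eval s.mem s.var = K at *
  have hsK := Nat.size_le_self_nat K
  refine Runs.seq (Runs.add ?_) (by rw [hτv, hr.regs.zero]; omega)
  have hloop : K * (1 + B + (X + 10 * (B + b + 2))) + 1 ≤ 14 * C := by
    calc _ ≤ P * (X + 12 * P) + 1 := by
          refine Nat.add_le_add_right (Nat.mul_le_mul (by omega) (by omega)) 1
      _ = P * X + 12 * (P * P) + 1 := by ring
      _ ≤ _ := by omega
  have hcalls : ∀ a ≤ B, a * c.calls B E ≤ B * c.calls B E := fun a ha =>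
    Nat.mul_le_mul_right _ ha
  refine (Runs.loop (I := fun a ζ => (∃ s' j', I (K - a) s' ∧ Rep R B b E j' s' ζ ∧
      j' ≤ j + (K - a) * c.calls B E) ∧ ζ.reg (tempReg R (d + 1)) = a ∧
      ζ.reg (tempReg R d) = K ∧ a ≤ K ∧ ∀ d' < d, ζ.reg (tempReg R d') = σ.reg (tempReg R d'))
    (K := K) (S := B) (T := X + 10 * (B + b + 2)) (fun _ _ h => h.2.1) (by omega)
      ?_ ?_).mono ?_ ?_
  · rintro a ha ζ ⟨⟨s', j', hI', hζ, hj'⟩, h1, h2, -, h5⟩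
    have hsa := Nat.size_le_self_nat (a + 1)
    have hlast : j + (K - (a + 1)) * c.calls B E + c.calls B E ≤ j + B * c.calls B E := by
      have := hcalls (K - (a + 1) + 1) (by omega)
      rw [add_mul] at this
      omega
    -- The loop register counts down, so the index K - (a+1) counts up. It is recomputed in each
    -- round from two protected temporary registers, and the body may therefore overwrite `x`.
    refine Runs.seq (Runs.sub ?_) (by rw [h1, h2]; omega)
    rw [h1, h2]
    refine Runs.seq ((hc B b E j' (d + 2) T _ _ _ (hζ.setVar x (K - (a + 1)) (by omega)) hE hE' hT
      (by omega) (hI _ (by omega) s' hI')).mono e1 ?_) (by omega)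
    rintro ξ ⟨s'', j'', hI'', hξ, hj'', htmp⟩
    have t0 := htmp d (by omega)
    have t1 := htmp (d + 1) (by omega)
    simp [h1, h2] at t0 t1
    refine (Runs.sub ?_).mono ?_ fun _ => id
    · rw [t1, hξ.regs.one, Nat.add_sub_cancel]
      refine ⟨⟨s'', j'', ?_, hξ.setTemp _ _, ?_⟩, by simp, by simp [t0], by omega,
        fun d' hd => ?_⟩
      · rwa [show K - a = K - (a + 1) + 1 by omega]
      · rw [show K - a = K - (a + 1) + 1 by omega, add_mul]
        omega
      · have := htmp d' (by omega)
        simp at this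
        rw [RAMState.reg_setReg, if_neg (by simp; omega), this, h5 d' hd]
    · rw [t1, hξ.regs.one]; omega
  · rw [hτv, hr.regs.zero, Nat.add_zero]
    refine ⟨⟨s, j, by simpa using hI0, hr.setTemp _ _, by omega⟩, by simp, by simp [hτv], le_rfl,
      fun d' hd => ?_⟩
    rw [RAMState.reg_setReg, if_neg (by simp; omega), hτ.temp hd]
  · rw [hτv, hr.regs.zero]; omega
  · rintro ζ ⟨⟨s', j', hI', hζ, hj'⟩, h1, h2, -, h5⟩
    exact ⟨s', j', hIQ s' (by simpa using hI'), hζ, hj'.trans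
      (Nat.add_le_add_left (hcalls _ (by omega)) j), h5⟩

/-- The number `E` of rounds is not bounded by `B`, only its length is. Big loops are thus the only
source of a superpolynomial factor, E to the power of the nesting depth. -/
theorem compRuns_big {c : RAMCmd} {k : ℕ} (hc : CompRuns R p c k) :
    ∃ κ, CompRuns R p (big c) κ := by
  refine ⟨2 * (k + 1) + 7, fun B b E j d T Q s σ hσ hE hE' hT hj hwp => ?_⟩
  have hG : 1 ≤ E ^ (big c).nest * T := Nat.mul_pos (Nat.one_le_pow _ _ hE) hT
  have hG' : 1 ≤ E ^ c.nest * T := Nat.mul_pos (Nat.one_le_pow _ _ hE) hT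
  obtain ⟨P, C, hP, hw, h1, h2, h3, h3', h4⟩ :=
    cost_bound (B + b + 2) (k + 1) _ (by omega) (by omega) hG
  refine Runs.mono ?_ h4 fun _ => id
  have e1 : (B + b + 2) ^ k * (E ^ c.nest * T) ≤ P * (E ^ c.nest * T) :=
    Nat.mul_le_mul (hP ▸ Nat.pow_le_pow_right (by omega) (by omega)) le_rfl
  have hGE : E ^ (big c).nest * T = E * (E ^ c.nest * T) := by rw [nest, pow_succ]; ring
  rw [hGE] at h3 h3'
  have hbody := fun j d Q s σ (h₁ : Rep R B b E j s σ) h₂ h₃ =>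
    (hc B b E j d T Q s σ h₁ hE hE' hT h₂ h₃).mono e1 fun _ => id
  generalize E ^ c.nest * T = G at *
  obtain ⟨I, hI0, hI, hIQ⟩ := hwp
  have hs1 : Nat.size 1 = 1 := Nat.size_one
  have hs0 : Nat.size 0 = 0 := Nat.size_zero
  simp only [calls] at hj ⊢
  simp only [comp, seqs]
  have hz := hσ.regs.zero
  have hb := hσ.big
  refine Runs.seq (Runs.add ?_) (by rw [hz, hb]; omega)
  have hloop : E * (1 + (B + 1) + (P * G + 10 * (B + b + 2))) + 1 ≤ 14 * C := by
    have : P ≤ P * G := Nat.le_mul_of_pos_right _ hG'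
    calc _ ≤ E * (13 * (P * G)) + 1 := by
          refine Nat.add_le_add_right (Nat.mul_le_mul_left _ (by omega)) 1
      _ = 13 * (P * (E * G)) + 1 := by ring
      _ ≤ _ := by omega
  have hcalls : ∀ a ≤ E, a * c.calls B E ≤ E * c.calls B E := fun a ha =>
    Nat.mul_le_mul_right _ ha
  refine (Runs.loop (I := fun a ζ => (∃ s' j', I (E - a) s' ∧ Rep R B b E j' s' ζ ∧
      j' ≤ j + (E - a) * c.calls B E) ∧ ζ.reg (tempReg R d) = a ∧
      a ≤ E ∧ ∀ d' < d, ζ.reg (tempReg R d') = σ.reg (tempReg R d'))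
    (K := E) (S := B + 1) (T := P * G + 10 * (B + b + 2)) (fun _ _ h => h.2.1) hE'
      ?_ ?_).mono ?_ ?_
  · rintro a ha ζ ⟨⟨s', j', hI', hζ, hj'⟩, h1, -, h5⟩
    have hsa : Nat.size (a + 1) ≤ B + 1 := (Nat.size_le_size (by omega)).trans hE'
    have hlast : j + (E - (a + 1)) * c.calls B E + c.calls B E ≤ j + E * c.calls B E := by
      have := hcalls (E - (a + 1) + 1) (by omega)
      rw [add_mul] at this
      omega
    refine Runs.seq ((hbody j' (d + 1) _ _ _ hζ (by omega)
      (hI _ (by omega) s' hI')).mono le_rfl ?_) (by omega)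
    rintro ξ ⟨s'', j'', hI'', hξ, hj'', htmp⟩
    have t0 := (htmp d (by omega)).trans h1
    refine (Runs.sub ?_).mono ?_ fun _ => id
    · rw [t0, hξ.regs.one, Nat.add_sub_cancel]
      refine ⟨⟨s'', j'', ?_, hξ.setTemp _ _, ?_⟩, by simp, by omega, fun d' hd => ?_⟩
      · rwa [show E - a = E - (a + 1) + 1 by omega]
      · rw [show E - a = E - (a + 1) + 1 by omega, add_mul]
        omega
      · rw [RAMState.reg_setReg, if_neg (by simp; omega), htmp d' (by omega), h5 d' hd]
    · rw [t0, hξ.regs.one]; omega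
  · rw [hz, hb, Nat.add_zero]
    refine ⟨⟨s, j, by simpa using hI0, hσ.setTemp _ _, by omega⟩, by simp, le_rfl,
      fun d' hd => ?_⟩
    rw [RAMState.reg_setReg, if_neg (by simp; omega)]
  · rw [hz, hb]; omega
  · rintro ζ ⟨⟨s', j', hI', hζ, hj'⟩, h1, -, h5⟩
    exact ⟨s', j', hIQ s' (by simpa using hI'), hζ, hj'.trans
      (Nat.add_le_add_left (hcalls _ (by omega)) j), h5⟩

/-- Commands compile to machine programs of polynomial overhead. -/
theorem exists_compRuns (hp : p.regBound ≤ R) (hR : 0 < R) (c : RAMCmd) :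
    ∃ κ, CompRuns R p c κ := by
  induction c with
  | skip => exact compRuns_skip R p
  | assign x e => exact compRuns_assign R p x e
  | store a e => exact compRuns_store R p a e
  | ostore a e => exact compRuns_ostore R p a e
  | ask x => exact compRuns_ask R p x hp hR
  | seq c c' ih ih' =>
    obtain ⟨k, hk⟩ := ih
    obtain ⟨l, hl⟩ := ih'
    exact compRuns_seq R p hk hl
  | ite e c c' ih ih' =>
    obtain ⟨k, hk⟩ := ih
    obtain ⟨l, hl⟩ := ih'
    exact compRuns_ite R p e hk hl
  | forLt x e c ih =>
    obtain ⟨k, hk⟩ := ih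
    exact compRuns_for R p x e hk
  | big c ih =>
    obtain ⟨k, hk⟩ := ih
    exact compRuns_big R p hk

theorem exists_calls_le (c : RAMCmd) : ∃ κ, ∀ B E, 1 ≤ E →
    c.calls B E ≤ (B + 2) ^ κ * E ^ c.nest := by
  induction c with
  | skip => exact ⟨0, fun B E hE => Nat.zero_le _⟩
  | assign x e => exact ⟨0, fun B E hE => Nat.zero_le _⟩
  | store a e => exact ⟨0, fun B E hE => Nat.zero_le _⟩
  | ostore a e => exact ⟨0, fun B E hE => Nat.zero_le _⟩
  | ask x => exact ⟨0, fun B E hE => by simp [calls, nest]⟩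
  | seq c c' ih ih' =>
    obtain ⟨k, hk⟩ := ih
    obtain ⟨l, hl⟩ := ih'
    refine ⟨k + l + 1, fun B E hE => ?_⟩
    exact calls_add_le (hk B E hE) (hl B E hE) hE
  | ite e c c' ih ih' =>
    obtain ⟨k, hk⟩ := ih
    obtain ⟨l, hl⟩ := ih'
    refine ⟨k + l + 1, fun B E hE => ?_⟩
    exact calls_add_le (hk B E hE) (hl B E hE) hE
  | forLt x e c ih =>
    obtain ⟨k, hk⟩ := ih
    refine ⟨k + 1, fun B E hE => ?_⟩
    calc B * c.calls B E ≤ (B + 2) * ((B + 2) ^ k * E ^ c.nest) :=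
          Nat.mul_le_mul (by omega) (hk B E hE)
      _ = _ := by rw [nest]; ring
  | big c ih =>
    obtain ⟨k, hk⟩ := ih
    refine ⟨k, fun B E hE => ?_⟩
    calc E * c.calls B E ≤ E * ((B + 2) ^ k * E ^ c.nest) := Nat.mul_le_mul_left _ (hk B E hE)
      _ = _ := by rw [nest]; ring

end
end RAMCmd

/-! ### Complete programs: setting up the special registers and running a command. -/

namespace RAMCmd
open RAMProg

/-- The initial values of the variables of a program for inputs that start with `n` and `m`. -/
def initVar (n m : ℕ) : ℕ → ℕ := fun x => if x = 0 then n else if x = 1 then m else 0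

/-- The initial state of a command on a given input. -/
def initState (input : List ℕ) : CmdState where
  var := initVar (input.getD 0 0) (input.getD 1 0)
  mem a := input.getD a 0
  orc _ := 0

/-- The machine program that runs the command `c`. The size of the working memory, the logarithm
of the number of rounds of big loops, and the number of bits for the number of oracle runs are
given by expressions. The variable `x` is the answer. -/
def program (R : ℕ) (p : RAMProg) (c : RAMCmd) (eB eL eb : RAMExp) (x : ℕ) : RAMProg := seqs [
  .imm (specialReg R 1) 1, .load (varReg R 0) (specialReg R 0),
  .load (varReg R 1) (specialReg R 1), eL.comp R 0,
  .add (specialReg R 5) (specialReg R 1) (specialReg R 0),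
  .loop (tempReg R 0) (seqs [.add (specialReg R 5) (specialReg R 5) (specialReg R 5),
    .sub (tempReg R 0) (tempReg R 0) (specialReg R 1)]),
  eb.comp R 0, .add (specialReg R 4) (tempReg R 0) (specialReg R 0),
  eB.comp R 0, .add (specialReg R 2) (tempReg R 0) (specialReg R 0),
  c.comp R p 0, .add 0 (varReg R x) (specialReg R 0)]

theorem program_runs (p : RAMProg) (c : RAMCmd) (eB eL : RAMExp) (x : ℕ) :
    ∃ (prog : RAMProg) (κ : ℕ), ∀ (input : List ℕ) (B L T : ℕ) (Q : CmdState → Prop),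
      eB.eval (fun _ => 0) (initState input).var = B →
      eL.eval (fun _ => 0) (initState input).var = L →
      L ≤ B → input.length ≤ B → (∀ a, input.getD a 0 ≤ B) → 1 ≤ T →
      c.wp B (2 ^ L) (OracleRuns p T) Q (initState input) →
      prog.Runs (RAMState.start input) ((B + 2) ^ κ * ((2 ^ L) ^ c.nest * T)) fun τ =>
        ∃ s, Q s ∧ (∀ a < B, τ.mem a = s.mem a) ∧ τ.reg 0 = s.var x := by
  set R := p.regBound + 1 with hR
  obtain ⟨κ₁, hκ₁⟩ := c.exists_calls_le
  obtain ⟨κ₂, hκ₂⟩ := exists_compRuns R p (by omega) (by omega) c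
  -- The number of calls is at most (B+2)^κ₁ · 2^(L · nest), and B + 2 ≤ 2^(B+2). So κ₁(B+2) + nest
  -- · L + 1 bits suffice for the numbers of the runs, and this is polynomial in B.
  set eb : RAMExp := .add (.mul (.const κ₁) (.add eB (.const 2)))
    (.add (.mul (.const c.nest) eL) (.const 1)) with heb
  obtain ⟨k₁, hk₁⟩ := eL.exists_compRuns
  obtain ⟨k₂, hk₂⟩ := eb.exists_compRuns
  obtain ⟨k₃, hk₃⟩ := eB.exists_compRuns
  set M := κ₁ + c.nest + 3 with hM
  -- The costs are collected in powers of B + 2: B + b + 2 is at most (B+2)^M, so the factor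
  -- (B+b+2)^κ₂ of the compiled command contributes M · κ₂.
  refine ⟨program R p c eB eL eb x, 2 * (k₁ + k₂ + k₃ + M * κ₂ + M + 1) + 7,
    fun input B L T Q hB hL hLB hlen hle hT hwp => ?_⟩
  have hE : 1 ≤ 2 ^ L := Nat.one_le_two_pow
  have hG : 1 ≤ (2 ^ L) ^ c.nest * T := Nat.mul_pos (Nat.one_le_pow _ _ hE) hT
  obtain ⟨P, C, hP, hw, h1, h2, h3, h3', h4⟩ :=
    cost_bound (B + 2) (k₁ + k₂ + k₃ + M * κ₂ + M + 1) _ (by omega) (by omega) hG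
  refine Runs.mono ?_ h4 fun _ => id
  have hpow : ∀ i ≤ k₁ + k₂ + k₃ + M * κ₂ + M + 1, (B + 2) ^ i ≤ P := fun i hi =>
    hP ▸ Nat.pow_le_pow_right (by omega) hi
  set ρ := (initState input).var with hρ
  have hρB : ∀ y, ρ y ≤ B := fun y => by
    simp only [hρ, initState, initVar]
    split_ifs
    exacts [hle 0, hle 1, Nat.zero_le _]
  set b := eb.eval (fun _ => 0) ρ with hb
  have hbv : b = κ₁ * (B + 2) + (c.nest * L + 1) := by
    rw [hb, heb]; simp [RAMExp.eval, hB, hL]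
  have hbB : B + b + 2 ≤ (B + 2) ^ M := by
    have e1 : c.nest * L ≤ c.nest * (B + 2) := Nat.mul_le_mul_left _ (by omega)
    have e2 : B + b + 2 ≤ (κ₁ + c.nest + 2) * (B + 2) := by
      rw [hbv]; nlinarith
    refine e2.trans ?_
    rw [hM, pow_succ]
    refine Nat.mul_le_mul_right _ ?_
    exact (Nat.lt_two_pow_self (n := κ₁ + c.nest + 2)).le.trans
      (Nat.pow_le_pow_left (by omega) _)
  have hbP : B + b + 2 ≤ P := hbB.trans (hpow M (by omega))
  have hcalls : 0 + c.calls B (2 ^ L) < 2 ^ b := by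
    have e1 := hκ₁ B (2 ^ L) hE
    have e2 : (B + 2) ^ κ₁ ≤ 2 ^ ((B + 2) * κ₁) := by
      rw [pow_mul]; exact Nat.pow_le_pow_left (Nat.lt_two_pow_self).le _
    have e3 : (B + 2) ^ κ₁ * (2 ^ L) ^ c.nest ≤ 2 ^ ((B + 2) * κ₁) * 2 ^ (L * c.nest) := by
      rw [← pow_mul]; exact Nat.mul_le_mul_right _ e2
    rw [← pow_add] at e3
    have e4 : 2 ^ ((B + 2) * κ₁ + L * c.nest) < 2 ^ b :=
      Nat.pow_lt_pow_right (by omega) (by rw [hbv]; nlinarith)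
    omega
  have hsB := Nat.size_le_self_nat B
  have hsb := Nat.size_le_self_nat b
  have hs0 : Nat.size 0 = 0 := Nat.size_zero
  have hs1 : Nat.size 1 = 1 := Nat.size_one
  have hsn := (Nat.size_le_self_nat _).trans (hle 0)
  have hsm := (Nat.size_le_self_nat _).trans (hle 1)
  rw [List.getD_eq_getElem?_getD] at hsn hsm
  have hc1 := hpow k₁ (by omega)
  have hc2 := hpow k₂ (by omega)
  have hc3 := hpow k₃ (by omega)
  have hc4 : (B + b + 2) ^ κ₂ * ((2 ^ L) ^ c.nest * T) ≤ C := by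
    refine le_trans (Nat.mul_le_mul_right _ ?_) h3
    refine (Nat.pow_le_pow_left hbB κ₂).trans ?_
    rw [← pow_mul]
    exact hpow _ (by omega)
  simp only [program, seqs]
  refine Runs.seq (Runs.imm ?_) (by omega)
  refine Runs.seq (Runs.load ?_) (by simp [RAMState.start]; omega)
  refine Runs.seq (Runs.load ?_) (by simp [RAMState.start]; omega)
  generalize hσ : ((((RAMState.start input).setReg (specialReg R 1) 1).setReg (varReg R 0)
    _).setReg (varReg R 1) _) = σ
  have hσm : σ.mem = (initState input).mem := by rw [← hσ]; rfl
  have hσr : ∀ r, σ.reg r = if r = varReg R 1 then input.getD 1 0 else if r = varReg R 0 then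
      input.getD 0 0 else if r = specialReg R 1 then 1 else 0 := fun r => by
    rw [← hσ]; simp [RAMState.start]
  have hrep : RAMExp.Rep R B (fun _ => 0) ρ σ := by
    refine ⟨by simp [hσr], by simp [hσr], fun y => ?_, fun a ha => ?_, fun _ _ => rfl, hρB,
      fun _ => Nat.zero_le _, by simp [hσr]⟩
    · simp only [hσr, varReg_inj, varReg_ne_specialReg, if_false, hρ, initState, initVar]
      split_ifs <;> first | rfl | omega
    · simp [hσr] at ha
  have hz : σ.reg (specialReg R 0) = 0 := by simp [hσr]
  have ho : σ.reg (specialReg R 1) = 1 := by simp [hσr]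
  refine Runs.seq ((hk₁ R 0 B _ _ σ hrep).mono hc1 ?_) (by simp [RAMState.start]; omega)
  rintro τ ⟨hτ, hτv⟩
  rw [hL] at hτv
  have hsL := Nat.size_le_self_nat L
  have hszero : ∀ ζ : RAMState, ζ.reg (specialReg R 0) = σ.reg (specialReg R 0) →
      Nat.size (ζ.reg (specialReg R 0)) = 0 := fun ζ h => by rw [h, hz, hs0]
  have hsone : ∀ ζ : RAMState, ζ.reg (specialReg R 1) = σ.reg (specialReg R 1) →
      Nat.size (ζ.reg (specialReg R 1)) = 1 := fun ζ h => by rw [h, ho, hs1]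
  refine Runs.seq (T₁ := 2) ((Runs.add ?_).mono ?_ fun _ => id) (by simp [RAMState.start]; omega)
  swap
  · rw [hszero τ (hτ.special 0), hsone τ (hτ.special 1)]
  have hloop : L * (1 + B + (10 * (B + 2))) + 1 ≤ 12 * C := by
    have : L * (1 + B + (10 * (B + 2))) ≤ P * (11 * P) := Nat.mul_le_mul (by omega) (by omega)
    have e : P * (11 * P) = 11 * (P * P) := by ring
    omega
  refine Runs.seq ((Runs.loop (I := fun i ζ => ζ.mem = σ.mem ∧ ζ.reg (tempReg R 0) = i ∧ i ≤ L ∧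
      ζ.reg (specialReg R 5) = 2 ^ (L - i) ∧ ∀ r, (∀ d, r ≠ tempReg R d) → r ≠ specialReg R 5 →
        ζ.reg r = σ.reg r)
    (K := L) (S := B) (T := 10 * (B + 2)) (fun _ _ h => h.2.1) (by omega) ?_ ?_).mono hloop ?_)
    (by simp [RAMState.start]; omega)
  · rintro i hi ζ ⟨g1, g2, g3, g4, g5⟩
    have hsx : Nat.size (2 ^ (L - (i + 1))) ≤ L := by
      rw [Nat.size_pow]; omega
    have hsi := Nat.size_le_self_nat (i + 1)
    have g6 := hsone ζ (g5 _ (by simp) (by simp))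
    have g7 : ζ.reg (specialReg R 1) = 1 := (g5 _ (by simp) (by simp)).trans ho
    refine Runs.seq (Runs.add ?_) (by rw [g4]; omega)
    refine (Runs.sub ?_).mono ?_ fun _ => id
    · refine ⟨g1, by simp [g2, g7], by omega, ?_, fun r h6 h7 => by simp [h6, h7, g5]⟩
      simp [g4]
      rw [show L - i = L - (i + 1) + 1 by omega, pow_succ]
      ring
    · simp [g2, g7, g4]; omega
  · refine ⟨hτ.1, by simp [hτv], le_rfl, ?_, fun r h6 h7 => ?_⟩
    · simp [hτ.special, hz, ho]
    · rw [RAMState.reg_setReg, if_neg h7]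
      exact hτ.2 r fun d _ => h6 d
  rintro υ ⟨g1, g2, -, g4, g5⟩
  rw [Nat.sub_zero] at g4
  have hυ : RAMExp.Rep R B (fun _ => 0) ρ υ := by
    refine ⟨?_, ?_, fun y => ?_, fun a ha => ?_, fun _ _ => rfl, hρB, fun _ => Nat.zero_le _, ?_⟩
    · rw [g5 _ (by simp) (by simp), hz]
    · rw [g5 _ (by simp) (by simp), ho]
    · rw [g5 _ (by simp) (by simp), hrep.var]
    · rw [g5 _ (by simp) (by simp)] at ha
      simp [hσr] at ha
    · rw [g5 _ (by simp) (by simp)]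
      simp [hσr]
  refine Runs.seq ((hk₂ R 0 B _ _ υ hυ).mono hc2 ?_) (by simp [RAMState.start]; omega)
  rintro ξ ⟨hξ, hξv⟩
  have hξz := (hυ.frame hξ).zero
  refine Runs.seq (T₁ := 1 + b) ((Runs.add ?_).mono ?_ fun _ => id)
    (by simp [RAMState.start]; omega)
  swap
  · rw [hξv, hξz, ← hb]; omega
  rw [hξv, hξz, Nat.add_zero]
  have hξ' : RAMExp.Rep R B (fun _ => 0) ρ (ξ.setReg (specialReg R 4) b) := by
    have h := hυ.frame hξ
    refine ⟨by simp [h.zero], by simp [h.one], fun y => by simp [h.var], fun a ha => ?_,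
      fun _ _ => rfl, hρB, fun _ => Nat.zero_le _, by simpa using h.bound_le⟩
    exact h.mem a (by simpa using ha)
  refine Runs.seq ((hk₃ R 0 B _ _ _ hξ').mono hc3 ?_) (by simp [RAMState.start]; omega)
  rintro ζ ⟨hζ, hζv⟩
  rw [hB] at hζv
  have hζz := (hξ'.frame hζ).zero
  refine Runs.seq (T₁ := 1 + B) ((Runs.add ?_).mono ?_ fun _ => id)
    (by simp [RAMState.start]; omega)
  swap
  · rw [hζv, hζz]; omega
  rw [hζv, hζz, Nat.add_zero]
  have hζr : ∀ r, (∀ d, r ≠ tempReg R d) → r ≠ specialReg R 5 → r ≠ specialReg R 4 →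
      ζ.reg r = σ.reg r := fun r e1 e2 e3 => by
    rw [hζ.2 r fun d _ => e1 d, RAMState.reg_setReg, if_neg e3, hξ.2 r fun d _ => e1 d,
      g5 r e1 e2]
  have hζm : ζ.mem = (initState input).mem := by
    rw [hζ.1, RAMState.mem_setReg, hξ.1, g1, hσm]
  have hbig : ∀ a, B ≤ a → (initState input).mem a = 0 := fun a ha => by
    simp only [initState]
    exact List.getD_eq_default _ _ (hlen.trans ha)
  have hcell : ∀ j a, (initState input).mem (oracleCell B b j a) = 0 := fun j a =>
    hbig _ (by rw [oracleCell]; omega)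
  have hRep : Rep R B b (2 ^ L) 0 (initState input) (ζ.setReg (specialReg R 2) B) := by
    refine ⟨⟨?_, ?_, ?_, ?_, ?_⟩, ?_, fun y => ?_, fun a ha => ?_, hbig, fun a => ?_,
      fun j' _ _ a => ?_, hρB, hle⟩
    · simp [hζz]
    · simp [(hξ'.frame hζ).one]
    · simp
    · rw [RAMState.reg_setReg, if_neg (by simp), hζr _ (by simp) (by simp) (by simp)]
      simp [hσr]
    · simp [hζ.special]
    · simp [hζ.special, hξ.special, g4]
    · simp [(hξ'.frame hζ).var, hρ]
    · rw [RAMState.mem_setReg, hζm]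
    · rw [RAMState.mem_setReg, hζm, hcell]; rfl
    · rw [RAMState.mem_setReg, hζm, hcell]
  refine Runs.seq ((hκ₂ B b (2 ^ L) 0 0 T Q _ _ hRep hE ?_ hT hcalls hwp).mono hc4 ?_)
    (by simp [RAMState.start]; omega)
  · rw [Nat.size_pow]; omega
  rintro ω ⟨s, j, hQ, hω, -, -⟩
  have hsx := (Nat.size_le_self_nat _).trans (hω.var_le x)
  refine (Runs.add ?_).mono ?_ fun _ => id
  · refine ⟨s, hQ, hω.mem, ?_⟩
    simp [hω.var, hω.regs.zero]
  · rw [hω.var, hω.regs.zero]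
    simp [RAMState.start]; omega

end RAMCmd

/-! ### Trees given by parents -/

/-- The graph on `Fin k` in which every vertex `v ≠ 0` is adjacent to `par v`. -/
def parentGraph (k : ℕ) (par : ℕ → ℕ) (hpar : ∀ v, 0 < v → par v < v) : SimpleGraph (Fin k) where
  Adj u v := (0 < (u : ℕ) ∧ par u = v) ∨ (0 < (v : ℕ) ∧ par v = u)
  symm := ⟨fun _ _ h => h.symm⟩
  loopless := ⟨fun u h => by
    rcases h with ⟨h1, h2⟩ | ⟨h1, h2⟩ <;> exact absurd h2 (hpar u h1).ne⟩

/-- Following parents leads to 0, so the graph is connected; every edge joins some vertex other than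
0 to its parent, so there are at most k - 1 edges, the least number for a connected graph. -/
theorem parentGraph_isTree {k : ℕ} (hk : 0 < k) (par : ℕ → ℕ) (hpar : ∀ v, 0 < v → par v < v) :
    (parentGraph k par hpar).IsTree := by
  have hreach : ∀ v (hv : v < k), (parentGraph k par hpar).Reachable ⟨v, hv⟩ ⟨0, hk⟩ := by
    intro v
    induction v using Nat.strong_induction_on with
    | _ v ih =>
      intro hv
      rcases Nat.eq_zero_or_pos v with rfl | hpos
      · exact SimpleGraph.Reachable.refl _
      · have h := hpar v hpos
        exact (SimpleGraph.Adj.reachable (G := parentGraph k par hpar) (u := ⟨v, hv⟩)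
          (v := ⟨par v, h.trans hv⟩) (Or.inl ⟨hpos, rfl⟩)).trans (ih _ h _)
  have hconn : (parentGraph k par hpar).Connected := by
    have : Nonempty (Fin k) := ⟨⟨0, hk⟩⟩
    exact SimpleGraph.Connected.mk fun u v => (hreach u u.2).trans (hreach v v.2).symm
  rw [SimpleGraph.isTree_iff_connected_and_card]
  refine ⟨hconn, ?_⟩
  have hle := hconn.card_vert_le_card_edgeSet_add_one
  refine le_antisymm ?_ hle
  have hsub : (parentGraph k par hpar).edgeSet ⊆ Set.range fun v : {v : Fin k // v ≠ ⟨0, hk⟩} =>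
      s(v.1, (⟨par v.1, (hpar v.1 (Nat.pos_of_ne_zero fun h => v.2 (Fin.ext h))).trans
        v.1.2⟩ : Fin k)) := by
    intro e he
    induction e using Sym2.ind with
    | _ u v =>
      rw [SimpleGraph.mem_edgeSet] at he
      rcases he with ⟨h1, h2⟩ | ⟨h1, h2⟩
      · exact ⟨⟨u, fun h => by rw [h] at h1; exact lt_irrefl _ h1⟩, by simp [h2]⟩
      · exact ⟨⟨v, fun h => by rw [h] at h1; exact lt_irrefl _ h1⟩, by simp [h2, Sym2.eq_swap]⟩
  have h1 : Nat.card (parentGraph k par hpar).edgeSet ≤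
      Nat.card {v : Fin k // v ≠ ⟨0, hk⟩} :=
    (Nat.card_mono (Set.toFinite _) hsub).trans (Finite.card_range_le _)
  have h2 : Nat.card {v : Fin k // v ≠ ⟨0, hk⟩} = k - 1 := by
    rw [Nat.card_eq_fintype_card, Fintype.card_subtype_compl, Fintype.card_fin]
    simp
  rw [Nat.card_eq_fintype_card (α := Fin k), Fintype.card_fin]
  omega

/-! ### The pattern tree and the host graph of a covering instance -/

/-- Parents in the pattern tree: the root `0` has `D` pendant paths of length two and `s` further
children, and the remaining vertices are leaves below these children, in blocks of `g`; `st j`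
tells whether block `j` belongs to a new child. -/
def patternParent (D s g : ℕ) (st : ℕ → ℕ) (v : ℕ) : ℕ :=
  if v ≤ D then 0 else if v ≤ 2 * D then v - D else if v ≤ 2 * D + s then 0 else
    2 * D + min s (∑ i ∈ Finset.range ((v - (2 * D + s + 1)) / g + 1), st i)

theorem patternParent_lt {D s g : ℕ} {st : ℕ → ℕ} (v : ℕ) (hv : 0 < v) :
    patternParent D s g st v < v := by
  unfold patternParent
  have := min_le_left s (∑ i ∈ Finset.range ((v - (2 * D + s + 1)) / g + 1), st i)
  split_ifs <;> omega

/-- The pattern tree, with `l` leaves below the children. -/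
def patternTree (D s g l : ℕ) (st : ℕ → ℕ) : SimpleGraph (Fin (2 * D + s + 1 + l)) :=
  parentGraph _ (patternParent D s g st) patternParent_lt

/-- The edges of the host graph, directed to the larger vertex. There are the root `0`, `D`
pendant paths of length two, `n` elements, `Δ` dummy elements of which `δ` are used, and sets;
`F u e` says that the set `u` is adjacent to the element `e`. -/
def hostArc (D n Δ δ : ℕ) (F : ℕ → ℕ → Prop) (i j : ℕ) : Prop :=
  (i = 0 ∧ 0 < j ∧ j ≤ D) ∨ (0 < i ∧ i ≤ D ∧ j = i + D) ∨
  (i = 0 ∧ 2 * D + 1 + n + Δ ≤ j) ∨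
  (2 * D + 1 ≤ i ∧ i < 2 * D + 1 + n ∧ 2 * D + 1 + n + Δ ≤ j ∧
    F (j - (2 * D + 1 + n + Δ)) (i - (2 * D + 1))) ∨
  (2 * D + 1 + n ≤ i ∧ i < 2 * D + 1 + n + min δ Δ ∧ 2 * D + 1 + n + Δ ≤ j)

/-- The truncation `min δ Δ` in the definition keeps the dummies in use below the vertices for sets,
so that this and the bipartiteness hold for all parameters. -/
theorem hostArc.lt {D n Δ δ : ℕ} {F : ℕ → ℕ → Prop} {i j : ℕ} (h : hostArc D n Δ δ F i j) :
    i < j := by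
  have := min_le_right δ Δ
  rcases h with h | h | h | h | h <;> omega

/-- The host graph, with `M` sets. -/
def hostGraph (D n Δ δ M : ℕ) (F : ℕ → ℕ → Prop) :
    SimpleGraph (Fin (2 * D + 1 + n + Δ + M)) where
  Adj i j := hostArc D n Δ δ F i j ∨ hostArc D n Δ δ F j i
  symm := ⟨fun _ _ h => h.symm⟩
  loopless := ⟨fun i h => by rcases h with h | h <;> exact lt_irrefl _ h.lt⟩

/-- The side of the children in the pattern tree. -/
def patternOdd (D s v : ℕ) : Prop := (0 < v ∧ v ≤ D) ∨ (2 * D < v ∧ v ≤ 2 * D + s)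

/-- The side of the sets in the host graph. -/
def hostOdd (D n Δ i : ℕ) : Prop := (0 < i ∧ i ≤ D) ∨ 2 * D + 1 + n + Δ ≤ i

theorem hostArc.odd {D n Δ δ : ℕ} {F : ℕ → ℕ → Prop} {i j : ℕ} (h : hostArc D n Δ δ F i j) :
    hostOdd D n Δ j ↔ ¬ hostOdd D n Δ i := by
  have := min_le_right δ Δ
  unfold hostOdd
  rcases h with h | h | h | h | h <;> omega

/-- A positive prefix sum of `st` and a positive `s` place the parent of a leaf among the s
children, at 2D + 1 or later, and not on the last vertex of a pendant path. -/
theorem patternParent_odd {D s g l : ℕ} {st : ℕ → ℕ}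
    (hst : ∀ i < l, 0 < ∑ i ∈ Finset.range (i / g + 1), st i) (hs : 0 < l → 0 < s) {v : ℕ}
    (h0 : 0 < v) (hv : v < 2 * D + s + 1 + l) :
    patternOdd D s v ↔ ¬ patternOdd D s (patternParent D s g st v) := by
  unfold patternOdd patternParent
  by_cases hc : v ≤ 2 * D + s
  · split_ifs <;> omega
  · have h1 := hst (v - (2 * D + s + 1)) (by omega)
    have h2 := hs (by omega)
    have h3 := min_le_left s
      (∑ i ∈ Finset.range ((v - (2 * D + s + 1)) / g + 1), st i)
    have h4 : 0 < min s (∑ i ∈ Finset.range ((v - (2 * D + s + 1)) / g + 1), st i) :=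
      lt_min h2 h1
    rw [if_neg (by omega), if_neg (by omega), if_neg (by omega)]
    omega

/-- The function `f` on numbers is a copy of the pattern tree in the host graph. -/
structure IsPatternCopy (D n Δ δ M s g l : ℕ) (st : ℕ → ℕ) (F : ℕ → ℕ → Prop) (f : ℕ → ℕ) :
    Prop where
  lt : ∀ v < 2 * D + s + 1 + l, f v < 2 * D + 1 + n + Δ + M
  inj : ∀ v < 2 * D + s + 1 + l, ∀ w < 2 * D + s + 1 + l, f v = f w → v = w
  adj : ∀ v, 0 < v → v < 2 * D + s + 1 + l →
    hostArc D n Δ δ F (f v) (f (patternParent D s g st v)) ∨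
    hostArc D n Δ δ F (f (patternParent D s g st v)) (f v)

/-- Copies are handled as functions on numbers from here on, which turns adjacency in both graphs
into linear arithmetic on vertex numbers. -/
theorem exists_isPatternCopy {D n Δ δ M s g l : ℕ} {st : ℕ → ℕ} {F : ℕ → ℕ → Prop} :
    (patternTree D s g l st).IsContained (hostGraph D n Δ δ M F) ↔
      ∃ f, IsPatternCopy D n Δ δ M s g l st F f := by
  constructor
  · rintro ⟨f⟩
    have hinj := f.injective
    obtain ⟨F', hF'⟩ : ∃ F' : ℕ → ℕ, ∀ v : Fin (2 * D + s + 1 + l), F' v = (f v : ℕ) :=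
      ⟨fun v => if hv : v < 2 * D + s + 1 + l then f ⟨v, hv⟩ else 0, fun v => by simp [v.2]⟩
    refine ⟨F', fun v hv => ?_, fun v hv w hw hvw => ?_, fun v h0 hv => ?_⟩
    · rw [hF' ⟨v, hv⟩]; exact (f ⟨v, hv⟩).2
    · rw [hF' ⟨v, hv⟩, hF' ⟨w, hw⟩] at hvw
      simpa using hinj (Fin.ext hvw)
    · have hp := patternParent_lt (D := D) (s := s) (g := g) (st := st) v h0
      rw [hF' ⟨v, hv⟩, hF' ⟨_, hp.trans hv⟩]
      exact f.toHom.map_rel (a := ⟨v, hv⟩) (b := ⟨_, hp.trans hv⟩) (Or.inl ⟨h0, rfl⟩)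
  · rintro ⟨f, hf⟩
    refine ⟨⟨⟨fun v => ⟨f v, hf.lt v v.2⟩, fun {a b} hab => ?_⟩, fun v w hvw => ?_⟩⟩
    · rcases hab with ⟨h1, h2⟩ | ⟨h1, h2⟩
      · have := hf.adj a h1 a.2
        rw [h2] at this
        exact this
      · have := hf.adj b h1 b.2
        rw [h2] at this
        exact this.symm
    · exact Fin.ext (hf.inj v v.2 w w.2 (congrArg Fin.val hvw))

/-! ### How a copy of the pattern tree must lie in the host graph. -/

namespace IsPatternCopy
variable {D n Δ δ M s g l θ : ℕ} {st : ℕ → ℕ} {F : ℕ → ℕ → Prop} {f : ℕ → ℕ} {U : Finset ℕ}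

theorem adj_root (hf : IsPatternCopy D n Δ δ M s g l st F f) {v : ℕ} (h0 : 0 < v) (hv : v ≤ D) :
    hostArc D n Δ δ F (f 0) (f v) ∨ hostArc D n Δ δ F (f v) (f 0) := by
  have := hf.adj v h0 (by omega)
  rw [patternParent, if_pos hv] at this
  exact this.symm

/-- Both graphs are bipartite and the tree is connected, so the side of every image is determined by
the side of the image of the root. The induction goes along parents. -/
theorem odd_iff (hf : IsPatternCopy D n Δ δ M s g l st F f)
    (hst : ∀ i < l, 0 < ∑ i ∈ Finset.range (i / g + 1), st i) (hs : 0 < l → 0 < s) :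
    ∀ v < 2 * D + s + 1 + l,
      (hostOdd D n Δ (f v) ↔ (patternOdd D s v ↔ ¬ hostOdd D n Δ (f 0))) := by
  have step : ∀ {a b c d r : Prop}, (a ↔ (b ↔ ¬ r)) → (d ↔ ¬ b) → (c ↔ ¬ a) → (c ↔ (d ↔ ¬ r)) := by
    intros; tauto
  intro v
  induction v using Nat.strong_induction_on with
  | _ v ih =>
    intro hv
    rcases Nat.eq_zero_or_pos v with rfl | h0
    · have : ¬ patternOdd D s 0 := by unfold patternOdd; omega
      generalize hostOdd D n Δ (f 0) = r at *
      generalize patternOdd D s 0 = r' at *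
      clear ih hf hst hs step
      tauto
    · have hp := patternParent_lt (D := D) (s := s) (g := g) (st := st) v h0
      refine step (ih _ hp (hp.trans hv)) (patternParent_odd hst hs h0 hv) ?_
      rcases hf.adj v h0 hv with h3 | h3
      · have := h3.odd
        generalize hostOdd D n Δ (f v) = r at *
        generalize hostOdd D n Δ (f _) = r' at *
        clear ih hf hst hs step
        tauto
      · exact h3.odd

theorem card_image_path (hf : IsPatternCopy D n Δ δ M s g l st F f) :
    ((Finset.Icc 1 D).image f).card = D := by
  rw [Finset.card_image_of_injOn, Nat.card_Icc, Nat.add_sub_cancel]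
  intro v hv w hw hvw
  simp at hv hw
  exact hf.inj v (by omega) w (by omega) hvw

/-- The image of the root has D distinct neighbours. The inner vertex of a pendant path has only
two, and a vertex for sets has at most 1 + θ + Δ: the root, its few elements, and the dummies. Both
are fewer than D. -/
theorem not_odd_root (hf : IsPatternCopy D n Δ δ M s g l st F f) (hD : θ + Δ + 3 ≤ D)
    (hθ : ∀ u < M, ∀ S : Finset ℕ, (∀ e ∈ S, F u e) → S.card ≤ θ) : ¬ hostOdd D n Δ (f 0) := by
  classical
  intro hc
  have hNcard := hf.card_image_path
  have hlt := hf.lt 0 (by omega)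
  have hNadj : ∀ i ∈ (Finset.Icc 1 D).image f,
      hostArc D n Δ δ F (f 0) i ∨ hostArc D n Δ δ F i (f 0) := by
    intro i hi
    simp only [Finset.mem_image, Finset.mem_Icc] at hi
    obtain ⟨v, hv, rfl⟩ := hi
    exact hf.adj_root hv.1 hv.2
  generalize (Finset.Icc 1 D).image f = N at *
  generalize f 0 = r at *
  clear hf
  have hmin := min_le_right δ Δ
  rcases hc with hc | hc
  · have : N ⊆ {0, r + D} := by
      intro i hi
      simp only [Finset.mem_insert, Finset.mem_singleton]
      rcases hNadj i hi with h | h <;> rcases h with h | h | h | h | h <;> omega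
    have h2 := (Finset.card_le_card this).trans Finset.card_le_two
    omega
  · have hScard := hθ (r - (2 * D + 1 + n + Δ)) (by omega)
      ((Finset.range n).filter fun e => F (r - (2 * D + 1 + n + Δ)) e)
      fun e he => (Finset.mem_filter.1 he).2
    set S : Finset ℕ := (Finset.range n).filter fun e => F (r - (2 * D + 1 + n + Δ)) e with hS
    have : N ⊆ insert 0 (S.image (fun e => 2 * D + 1 + e) ∪
        (Finset.range Δ).image (fun e => 2 * D + 1 + n + e)) := by
      intro i hi
      simp only [Finset.mem_insert, Finset.mem_union, Finset.mem_image, Finset.mem_range, hS,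
        Finset.mem_filter]
      rcases hNadj i hi with h | h
      · rcases h with h | h | h | h | h <;> omega
      · rcases h with h | h | h | h | h
        · omega
        · omega
        · omega
        · right; left
          exact ⟨i - (2 * D + 1), ⟨by omega, h.2.2.2⟩, by omega⟩
        · right; right
          exact ⟨i - (2 * D + 1 + n), by omega, by omega⟩
    have h2 := Finset.card_le_card this
    have h3 := Finset.card_insert_le 0 (S.image (fun e => 2 * D + 1 + e) ∪
        (Finset.range Δ).image (fun e => 2 * D + 1 + n + e))
    have h4 := Finset.card_union_le (S.image (fun e => 2 * D + 1 + e))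
      ((Finset.range Δ).image (fun e => 2 * D + 1 + n + e))
    have h5 : (S.image (fun e => 2 * D + 1 + e)).card ≤ S.card := Finset.card_image_le
    have h6 : ((Finset.range Δ).image (fun e => 2 * D + 1 + n + e)).card ≤ Δ :=
      Finset.card_image_le.trans (by simp)
    omega

theorem exists_adj (hf : IsPatternCopy D n Δ δ M s g l st F f) (hD : 0 < D) {v : ℕ}
    (hv : v < 2 * D + s + 1 + l) : ∃ w < 2 * D + s + 1 + l,
      hostArc D n Δ δ F (f v) (f w) ∨ hostArc D n Δ δ F (f w) (f v) := by
  rcases Nat.eq_zero_or_pos v with rfl | h0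
  · exact ⟨1, by omega, hf.adj_root one_pos (by omega)⟩
  · exact ⟨_, (patternParent_lt v h0).trans hv, hf.adj v h0 hv⟩

end IsPatternCopy

/-- The vertices of the host graph on the side of the elements that are not isolated. -/
def hostEven (D n δ : ℕ) (U : Finset ℕ) : Finset ℕ :=
  insert 0 (Finset.Icc (D + 1) (2 * D) ∪ (U.image (fun e => 2 * D + 1 + e) ∪
    (Finset.range δ).image (fun e => 2 * D + 1 + n + e)))

theorem card_hostEven_le (D n δ : ℕ) (U : Finset ℕ) :
    (hostEven D n δ U).card ≤ 1 + (D + (U.card + δ)) := by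
  refine (Finset.card_insert_le _ _).trans ?_
  have h1 := Finset.card_union_le (Finset.Icc (D + 1) (2 * D))
    (U.image (fun e => 2 * D + 1 + e) ∪ (Finset.range δ).image (fun e => 2 * D + 1 + n + e))
  have h4 := Finset.card_union_le (U.image (fun e => 2 * D + 1 + e))
    ((Finset.range δ).image (fun e => 2 * D + 1 + n + e))
  have h5 : (U.image (fun e => 2 * D + 1 + e)).card ≤ U.card := Finset.card_image_le
  have h6 : ((Finset.range δ).image (fun e => 2 * D + 1 + n + e)).card ≤ δ :=
    Finset.card_image_le.trans (by simp)
  have h7 : (Finset.Icc (D + 1) (2 * D)).card = D := by rw [Nat.card_Icc]; omega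
  omega

theorem mem_hostEven {D n δ i : ℕ} {U : Finset ℕ} : i ∈ hostEven D n δ U ↔
    i = 0 ∨ (D + 1 ≤ i ∧ i ≤ 2 * D) ∨ (∃ e ∈ U, 2 * D + 1 + e = i) ∨
      ∃ e < δ, 2 * D + 1 + n + e = i := by
  simp [hostEven]

/-- The vertices of the pattern tree on the side of the root. -/
def patternEven (D s l : ℕ) : Finset ℕ := insert 0 (Finset.Icc (D + 1) (2 * D) ∪
  Finset.Ico (2 * D + s + 1) (2 * D + s + 1 + l))

theorem card_patternEven (D s l : ℕ) : (patternEven D s l).card = 1 + (D + l) := by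
  rw [patternEven, Finset.card_insert_of_notMem (by simp), Finset.card_union_of_disjoint,
    Nat.card_Icc, Nat.card_Ico]
  · omega
  · rw [Finset.disjoint_left]; intro v; simp only [Finset.mem_Icc, Finset.mem_Ico]; omega

theorem of_mem_patternEven {D s l v : ℕ} (hv : v ∈ patternEven D s l) :
    v < 2 * D + s + 1 + l ∧ ¬ patternOdd D s v := by
  simp only [patternEven, Finset.mem_insert, Finset.mem_union, Finset.mem_Icc,
    Finset.mem_Ico] at hv
  unfold patternOdd
  omega

/-- On the side of the elements, everything outside `U` and the δ dummies in use is isolated, hence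
cannot occur in a copy. -/
theorem hostEven_of_adj {D n Δ δ i j : ℕ} {F : ℕ → ℕ → Prop} {U : Finset ℕ}
    (hF : ∀ u e, F u e → e ∈ U) (hδ : δ ≤ Δ) (hc : ¬ hostOdd D n Δ i)
    (h : hostArc D n Δ δ F i j ∨ hostArc D n Δ δ F j i) : i ∈ hostEven D n δ U := by
  unfold hostOdd at hc
  rw [mem_hostEven]
  have hmin := min_eq_left hδ
  rcases h with h | h
  · rcases h with h | h | h | h | h
    · omega
    · omega
    · omega
    · exact Or.inr (Or.inr (Or.inl ⟨_, hF _ _ h.2.2.2, by omega⟩))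
    · exact Or.inr (Or.inr (Or.inr ⟨i - (2 * D + 1 + n), by omega, by omega⟩))
  · rcases h with h | h | h | h | h <;> omega

/-- A copy of the pattern tree in the host graph shows a covering of the elements. -/
theorem cover_of_isContained {D n Δ δ M s g l θ : ℕ} {st : ℕ → ℕ} {F : ℕ → ℕ → Prop}
    {U : Finset ℕ} (hD : θ + Δ + 3 ≤ D) (hU : ∀ e ∈ U, e < n) (hF : ∀ u e, F u e → e ∈ U)
    (hθ : ∀ u < M, ∀ S : Finset ℕ, (∀ e ∈ S, F u e) → S.card ≤ θ)
    (hl : U.card + δ = l) (hδ : δ ≤ Δ)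
    (hst : ∀ i < l, 0 < ∑ i ∈ Finset.range (i / g + 1), st i)
    (hs : 0 < l → 0 < s)
    (h : (patternTree D s g l st).IsContained (hostGraph D n Δ δ M F)) :
    ∃ K : Finset ℕ, (∀ u ∈ K, u < M) ∧ K.card ≤ s ∧ ∀ e ∈ U, ∃ u ∈ K, F u e := by
  classical
  obtain ⟨f, hf⟩ := exists_isPatternCopy.1 h
  have hroot := hf.not_odd_root hD hθ
  have hcol : ∀ v < 2 * D + s + 1 + l, (hostOdd D n Δ (f v) ↔ patternOdd D s v) := fun v hv => by
    rw [hf.odd_iff hst hs v hv, iff_true_right hroot]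
  -- This is where l = |U| + δ is needed: the even side of the tree has at least as many vertices as
  -- there are non-isolated even vertices in the host, so an injective map between them is onto.
  have himg : (patternEven D s l).image f = hostEven D n δ U := by
    apply Finset.eq_of_subset_of_card_le
    · intro i hi
      obtain ⟨v, hv, rfl⟩ := Finset.mem_image.1 hi
      obtain ⟨hv1, hv2⟩ := of_mem_patternEven hv
      obtain ⟨w, hw, hvw⟩ := hf.exists_adj (by omega) hv1
      exact hostEven_of_adj hF hδ (by rwa [hcol v hv1]) hvw
    · rw [Finset.card_image_of_injOn, card_patternEven, ← hl]
      · exact card_hostEven_le D n δ U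
      · intro v hv w hw hvw
        exact hf.inj v (of_mem_patternEven hv).1 w (of_mem_patternEven hw).1 hvw
  set BT : Finset ℕ := Finset.Icc 1 D ∪ Finset.Icc (2 * D + 1) (2 * D + s) with hBT
  have hcovered : ∀ i ∈ hostEven D n δ U, ∃ j ∈ BT.image f, j < 2 * D + 1 + n + Δ + M ∧
      (hostArc D n Δ δ F i j ∨ hostArc D n Δ δ F j i) := by
    intro i hi
    rw [← himg] at hi
    obtain ⟨v, hv, rfl⟩ := Finset.mem_image.1 hi
    obtain ⟨hv1, hv2⟩ := of_mem_patternEven hv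
    obtain ⟨w, hw, hvw⟩ := hf.exists_adj (by omega) hv1
    have hodd : patternOdd D s w := by
      rw [← hcol v hv1] at hv2
      rw [← hcol w hw]
      rcases hvw with h | h
      · exact h.odd.2 hv2
      · by_contra hw'
        exact hv2 (h.odd.2 hw')
    refine ⟨f w, Finset.mem_image_of_mem _ ?_, hf.lt w hw, hvw⟩
    rw [hBT, Finset.mem_union, Finset.mem_Icc, Finset.mem_Icc]
    rcases hodd with h | h
    · left; omega
    · right; omega
  have hBTcard : (BT.image f).card ≤ D + s := by
    refine Finset.card_image_le.trans ((Finset.card_union_le _ _).trans ?_)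
    rw [Nat.card_Icc, Nat.card_Icc]; omega
  generalize BT.image f = BI at *
  clear himg hcol hroot hf h hst hs
  have hmin := min_eq_left hδ
  -- The end j + D of a pendant path of the host has `j` as its only neighbour, so all D inner path
  -- vertices occur among the D + s images.
  have hpaths : Finset.Icc 1 D ⊆ BI := by
    intro j hj
    rw [Finset.mem_Icc] at hj
    obtain ⟨i, hi, -, h⟩ := hcovered (j + D) (mem_hostEven.2 (by omega))
    have : i = j := by rcases h with h | h <;> rcases h with h | h | h | h | h <;> omega
    exact this ▸ hi
  -- At most s images remain after the D path vertices are removed; those that stand for sets form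
  -- the covering.
  refine ⟨((BI \ Finset.Icc 1 D).filter fun i =>
    2 * D + 1 + n + Δ ≤ i ∧ i < 2 * D + 1 + n + Δ + M).image fun i => i - (2 * D + 1 + n + Δ),
    ?_, ?_, ?_⟩
  · intro u hu
    obtain ⟨i, hi, rfl⟩ := Finset.mem_image.1 hu
    have := (Finset.mem_filter.1 hi).2
    omega
  · refine Finset.card_image_le.trans ((Finset.card_filter_le _ _).trans ?_)
    rw [Finset.card_sdiff_of_subset hpaths, Nat.card_Icc]
    omega
  · intro e he
    have hen := hU e he
    obtain ⟨i, hi, hi', h⟩ := hcovered (2 * D + 1 + e)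
      (mem_hostEven.2 (Or.inr (Or.inr (Or.inl ⟨e, he, rfl⟩))))
    have h' : 2 * D + 1 + n + Δ ≤ i ∧ F (i - (2 * D + 1 + n + Δ)) e := by
      rcases h with h | h <;> rcases h with h | h | h | h | h
      · omega
      · omega
      · omega
      · refine ⟨h.2.2.1, ?_⟩
        have := h.2.2.2
        rwa [show 2 * D + 1 + e - (2 * D + 1) = e by omega] at this
      all_goals omega
    refine ⟨i - (2 * D + 1 + n + Δ), Finset.mem_image.2 ⟨i, Finset.mem_filter.2
      ⟨Finset.mem_sdiff.2 ⟨hi, ?_⟩, h'.1, hi'⟩, rfl⟩, h'.2⟩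
    rw [Finset.mem_Icc]
    omega

/-- For each class `i` there are at least as many leaves as elements, so the elements embed into the
leaves class by class. Exactly δ leaves stay free by the count |U| + δ = l, and they are numbered
from `base` on. The map wanted is the inverse of this assignment. -/
theorem exists_leaf_map {U : Finset ℕ} {l δ s base : ℕ} {a c : ℕ → ℕ} (hl : U.card + δ = l)
    (ha : ∀ e ∈ U, a e < s)
    (hfib : ∀ i < s, (U.filter fun e => a e = i).card ≤
      ((Finset.range l).filter fun x => c x = i).card) (hU : ∀ e ∈ U, e < base) :
    ∃ φ : ℕ → ℕ, (∀ x < l, ∀ y < l, φ x = φ y → x = y) ∧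
      ∀ x < l, (φ x ∈ U ∧ a (φ x) = c x) ∨ (base ≤ φ x ∧ φ x < base + δ) := by
  classical
  have emb : ∀ i : ℕ, i < s → ((U.filter fun e => a e = i) ↪
      ((Finset.range l).filter fun x => c x = i)) := fun i hi =>
    (Function.Embedding.nonempty_of_card_le (by simpa using hfib i hi)).some
  set ψ : ℕ → ℕ := fun e => if h : e ∈ U then
    emb (a e) (ha e h) ⟨e, Finset.mem_filter.2 ⟨h, rfl⟩⟩ else 0 with hψ
  have hψ1 : ∀ e ∈ U, ψ e < l ∧ c (ψ e) = a e := by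
    intro e he
    simp only [hψ, dif_pos he]
    have := Finset.mem_filter.1 (emb (a e) (ha e he) ⟨e, Finset.mem_filter.2 ⟨he, rfl⟩⟩).2
    exact ⟨Finset.mem_range.1 this.1, this.2⟩
  have hψ2 : Set.InjOn ψ U := by
    intro e he e' he' h
    have h1 : a e = a e' := by rw [← (hψ1 e he).2, ← (hψ1 e' he').2, h]
    simp only [hψ, dif_pos (Finset.mem_coe.1 he), dif_pos (Finset.mem_coe.1 he')] at h
    have : ∀ (i i' : ℕ) (hi : i < s) (hi' : i' < s) (hii : i = i')
        (h1 : e ∈ U.filter fun e => a e = i) (h2 : e' ∈ U.filter fun e => a e = i'),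
        ((emb i hi ⟨e, h1⟩ : ℕ) = (emb i' hi' ⟨e', h2⟩ : ℕ)) → e = e' := by
      intro i i' hi hi' hii h1 h2 h3
      subst hii
      have := (emb i hi).injective (Subtype.ext h3)
      simpa using this
    exact this _ _ _ _ h1 _ _ h
  set P := U.image ψ with hP
  have hPcard : P.card = U.card := Finset.card_image_of_injOn hψ2
  have hPsub : P ⊆ Finset.range l := by
    intro x hx
    obtain ⟨e, he, rfl⟩ := Finset.mem_image.1 hx
    exact Finset.mem_range.2 (hψ1 e he).1
  have hR : (Finset.range l \ P).card = δ := by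
    rw [Finset.card_sdiff_of_subset hPsub, Finset.card_range]; omega
  set eR := (Finset.range l \ P).equivFin with heR
  refine ⟨fun x => if hx : x ∈ Finset.range l \ P then base + eR ⟨x, hx⟩ else
    Function.invFunOn ψ U x, ?_, ?_⟩
  · have hout : ∀ x < l, x ∉ Finset.range l \ P → Function.invFunOn ψ U x ∈ U ∧
        ψ (Function.invFunOn ψ U x) = x := by
      intro x hx hx'
      have hxP : x ∈ P := by
        by_contra h
        exact hx' (Finset.mem_sdiff.2 ⟨Finset.mem_range.2 hx, h⟩)
      obtain ⟨e, he, hex⟩ := Finset.mem_image.1 hxP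
      have hex' : ∃ e ∈ (U : Set ℕ), ψ e = x := ⟨e, he, hex⟩
      exact ⟨Function.invFunOn_mem hex', Function.invFunOn_eq hex'⟩
    intro x hx y hy h
    by_cases h1 : x ∈ Finset.range l \ P <;> by_cases h2 : y ∈ Finset.range l \ P
    · simp only [dif_pos h1, dif_pos h2] at h
      have : eR ⟨x, h1⟩ = eR ⟨y, h2⟩ := Fin.ext (by omega)
      simpa using eR.injective this
    · simp only [dif_pos h1, dif_neg h2] at h
      have := hU _ (hout y hy h2).1
      omega
    · simp only [dif_neg h1, dif_pos h2] at h
      have := hU _ (hout x hx h1).1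
      omega
    · simp only [dif_neg h1, dif_neg h2] at h
      rw [← (hout x hx h1).2, ← (hout y hy h2).2, h]
  · intro x hx
    by_cases h1 : x ∈ Finset.range l \ P
    · simp only [dif_pos h1]
      have := (eR ⟨x, h1⟩).2
      right; omega
    · simp only [dif_neg h1]
      have hxP : x ∈ P := by
        by_contra h
        exact h1 (Finset.mem_sdiff.2 ⟨Finset.mem_range.2 hx, h⟩)
      obtain ⟨e, he, hex⟩ := Finset.mem_image.1 hxP
      have hex' : ∃ e ∈ (U : Set ℕ), ψ e = x := ⟨e, he, hex⟩
      have h3 := Function.invFunOn_mem hex'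
      have h4 := Function.invFunOn_eq hex'
      left
      exact ⟨h3, by rw [← (hψ1 _ h3).2, h4]⟩

/-- A covering of the elements gives a copy of the pattern tree in the host graph. -/
theorem isContained_of_cover {D n Δ δ M s g l : ℕ} {st u a : ℕ → ℕ} {F : ℕ → ℕ → Prop}
    {U : Finset ℕ} (hU : ∀ e ∈ U, e < n) (hl : U.card + δ = l) (hδ : δ ≤ Δ)
    (hst : ∀ i < l, 0 < ∑ i ∈ Finset.range (i / g + 1), st i)
    (hst' : ∀ i < l, ∑ i ∈ Finset.range (i / g + 1), st i ≤ s)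
    (hu : ∀ i < s, u i < M) (hinj : ∀ i < s, ∀ j < s, u i = u j → i = j)
    (ha : ∀ e ∈ U, a e < s) (hF : ∀ e ∈ U, F (u (a e)) e)
    (hfib : ∀ i < s, (U.filter fun e => a e = i).card ≤ ((Finset.range l).filter fun x =>
      ∑ i ∈ Finset.range (x / g + 1), st i = i + 1).card) :
    (patternTree D s g l st).IsContained (hostGraph D n Δ δ M F) := by
  -- Children are counted from 0, whereas the prefix sums of `st`, which give the child of a leaf,
  -- start at 1; hence the subtraction.
  obtain ⟨φ, hφ1, hφ2⟩ := exists_leaf_map (U := U) (l := l) (δ := δ) (s := s) (base := n) (a := a)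
    (c := fun x => ∑ i ∈ Finset.range (x / g + 1), st i - 1) hl
    ha (fun i hi => by
      refine (hfib i hi).trans (Finset.card_le_card fun x hx => ?_)
      simp only [Finset.mem_filter, Finset.mem_range] at hx ⊢
      exact ⟨hx.1, by omega⟩) hU
  have hmin := min_eq_left hδ
  have hφn : ∀ x < l, φ x < n + δ := fun x hx => by
    rcases hφ2 x hx with h | h
    · have := hU _ h.1; omega
    · omega
  -- Root and pendant paths stay where they are, children go to their sets, and leaves go to
  -- elements or dummies, where the number n + i belongs to dummy `i`.
  refine exists_isPatternCopy.2 ⟨fun v => if v ≤ 2 * D then v else if v ≤ 2 * D + s then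
    2 * D + 1 + n + Δ + u (v - 2 * D - 1) else 2 * D + 1 + φ (v - (2 * D + s + 1)),
    fun v hv => ?_, fun v hv w hw h => ?_, fun v h0 hv => ?_⟩
  · split_ifs with h1 h2
    · omega
    · have := hu (v - 2 * D - 1) (by omega); omega
    · have := hφn (v - (2 * D + s + 1)) (by omega); omega
  · have hφv := fun h => hφn (v - (2 * D + s + 1)) h
    have hφw := fun h => hφn (w - (2 * D + s + 1)) h
    by_cases v1 : v ≤ 2 * D <;> by_cases w1 : w ≤ 2 * D <;>
      simp only [v1, w1, if_true, if_false] at h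
    · exact h
    · split_ifs at h <;> omega
    · split_ifs at h <;> omega
    · by_cases v2 : v ≤ 2 * D + s <;> by_cases w2 : w ≤ 2 * D + s <;>
        simp only [v2, w2, if_true, if_false] at h
      · have := hinj (v - 2 * D - 1) (by omega) (w - 2 * D - 1) (by omega) (by omega)
        omega
      · have := hφw (by omega); omega
      · have := hφv (by omega); omega
      · have := hφ1 _ (by omega) _ (by omega) (by omega :
          φ (v - (2 * D + s + 1)) = φ (w - (2 * D + s + 1)))
        omega
  · unfold patternParent
    by_cases v1 : v ≤ D
    · rw [if_pos v1, if_pos (by omega), if_pos (by omega)]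
      right; left; omega
    by_cases v2 : v ≤ 2 * D
    · rw [if_neg v1, if_pos v2, if_pos v2, if_pos (by omega)]
      right; right; left; omega
    by_cases v3 : v ≤ 2 * D + s
    · rw [if_neg v1, if_neg v2, if_pos v3, if_neg v2, if_pos v3, if_pos (by omega)]
      right; right; right; left; omega
    · have hx : v - (2 * D + s + 1) < l := by omega
      generalize v - (2 * D + s + 1) = x at *
      have e1 := hst x hx
      have e2 := hst' x hx
      have e3 := hφ2 x hx
      rw [if_neg v1, if_neg v2, if_neg v3, if_neg v2, if_neg v3, min_eq_right e2,
        if_neg (by omega), if_pos (by omega)]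
      generalize ∑ i ∈ Finset.range (x / g + 1), st i = y at *
      left
      rcases e3 with h | h
      · right; right; right; left
        have h1 := hU _ h.1
        have h2 := hF _ h.1
        refine ⟨by omega, by omega, by omega, ?_⟩
        rw [h.2] at h2
        rw [show 2 * D + 1 + n + Δ + u (2 * D + y - 2 * D - 1) - (2 * D + 1 + n + Δ) = u (y - 1) by
          rw [show 2 * D + y - 2 * D - 1 = y - 1 by omega]; omega,
          show 2 * D + 1 + φ x - (2 * D + 1) = φ x by omega]
        exact h2
      · right; right; right; right
        omega

/-! ### Codes of collections of sets, and the guesses of the covering algorithm -/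

/-- Every sequence of digits is given by a number. -/
theorem Nat.exists_digits (m : ℕ) : ∀ (c : ℕ) (f : ℕ → ℕ), (∀ w < c, f w ≤ m) →
    ∃ y < (m + 1) ^ c, ∀ w < c, y / (m + 1) ^ w % (m + 1) = f w
  | 0, f, _ => ⟨0, by simp, by simp⟩
  | c + 1, f, hf => by
    obtain ⟨y, hy, h⟩ := Nat.exists_digits m c (fun w => f (w + 1)) fun w hw => hf _ (by omega)
    have h0 := hf 0 (by omega)
    refine ⟨f 0 + (m + 1) * y, ?_, fun w hw => ?_⟩
    · calc f 0 + (m + 1) * y < (m + 1) * (y + 1) := by rw [mul_add]; omega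
        _ ≤ (m + 1) * (m + 1) ^ c := Nat.mul_le_mul_left _ hy
        _ = _ := by ring
    · rcases w with - | w
      · simp [Nat.add_mul_mod_self_left, Nat.mod_eq_of_lt (Nat.lt_succ_of_le h0)]
      · rw [pow_succ', ← Nat.div_div_eq_div_mul, Nat.add_mul_div_left _ _ (Nat.succ_pos m),
          Nat.div_eq_of_lt (Nat.lt_succ_of_le h0), Nat.zero_add]
        exact h w (by omega)

/-- An enumeration of a finite set. -/
theorem Finset.exists_enum (C : Finset ℕ) : ∃ d : ℕ → ℕ, (∀ j < C.card, d j ∈ C) ∧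
    (∀ i < C.card, ∀ j < C.card, d i = d j → i = j) ∧ ∀ x ∈ C, ∃ j < C.card, d j = x := by
  refine ⟨fun j => if h : j < C.card then C.equivFin.symm ⟨j, h⟩ else 0, fun j hj => ?_,
    fun i hi j hj h => ?_, fun x hx => ?_⟩
  · simp only [dif_pos hj]; exact (C.equivFin.symm ⟨j, hj⟩).2
  · simp only [dif_pos hi, dif_pos hj] at h
    simpa using C.equivFin.symm.injective (Subtype.ext h)
  · exact ⟨C.equivFin ⟨x, hx⟩, (C.equivFin ⟨x, hx⟩).2, by simp⟩

/-- Consecutive blocks of given sizes, described by the indicator function of their starts. -/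
theorem exists_blockStarts (p : ℕ → ℕ) (hp : ∀ i, 0 < p i) (s : ℕ) :
    ∃ st : ℕ → ℕ, (∀ j, st j ≤ 1) ∧ st 0 = 1 ∧
      (∑ j ∈ Finset.range (∑ i ∈ Finset.range s, p i), st j = s) ∧
      ∀ i < s, ((Finset.range (∑ i ∈ Finset.range s, p i)).filter fun j =>
        ∑ r ∈ Finset.range (j + 1), st r = i + 1).card = p i := by
  induction s with
  | zero => exact ⟨fun j => if j = 0 then 1 else 0, fun j => by dsimp only; split_ifs <;> omega,
      by simp, by simp, by simp⟩
  | succ s ih =>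
    obtain ⟨st, h1, h0, hs, hf⟩ := ih
    rw [Finset.sum_range_succ]
    set z := ∑ i ∈ Finset.range s, p i with hz
    -- A further block of p s positions is appended. Only its first position z is a start, so the
    -- prefix sums equal s + 1 from there on and are unchanged before.
    set st' : ℕ → ℕ := fun j => if j < z then st j else if j = z then 1 else 0 with hst'
    have e1 : ∀ j ≤ z, ∑ r ∈ Finset.range j, st' r = ∑ r ∈ Finset.range j, st r := fun j hj =>
      Finset.sum_congr rfl fun r hr => by
        rw [Finset.mem_range] at hr
        simp only [hst', if_pos (by omega : r < z)]
    have e2 : ∀ k, ∑ r ∈ Finset.range (z + 1 + k), st' r = s + 1 := by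
      intro k
      rw [Finset.sum_range_add, Finset.sum_range_succ, e1 z le_rfl, hs]
      have : ∀ i, st' (z + 1 + i) = 0 := fun i => by
        simp only [hst']
        rw [if_neg (by omega), if_neg (by omega)]
      simp only [this, Finset.sum_const_zero]
      simp [hst']
    refine ⟨st', fun j => ?_, ?_, ?_, fun i hi => ?_⟩
    · simp only [hst']
      have := h1 j
      split_ifs <;> omega
    · simp only [hst']
      split_ifs <;> omega
    · have := hp s
      rw [show z + p s = z + 1 + (p s - 1) by omega, e2]
    · have e3 : ∀ j, z ≤ j → ∑ r ∈ Finset.range (j + 1), st' r = s + 1 := fun j hj => by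
        rw [show j + 1 = z + 1 + (j - z) by omega, e2]
      have e4 : ∀ j < z, ∑ r ∈ Finset.range (j + 1), st r ≤ s := fun j hj => by
        rw [← hs]
        exact Finset.sum_le_sum_of_subset (Finset.range_mono hj)
      rcases Nat.lt_succ_iff_lt_or_eq.1 hi with hi | rfl
      · rw [← hf i hi]
        congr 1
        ext j
        simp only [Finset.mem_filter, Finset.mem_range]
        constructor
        · rintro ⟨h, h'⟩
          rcases lt_or_ge j z with hj | hj
          · rw [e1 _ hj] at h'
            exact ⟨hj, h'⟩
          · rw [e3 j hj] at h'; omega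
        · rintro ⟨h, h'⟩
          rw [e1 _ h]
          exact ⟨by omega, h'⟩
      · have : ((Finset.range (z + p i)).filter fun j =>
            ∑ r ∈ Finset.range (j + 1), st' r = i + 1) = Finset.Ico z (z + p i) := by
          ext j
          simp only [Finset.mem_filter, Finset.mem_range, Finset.mem_Ico]
          constructor
          · rintro ⟨h, h'⟩
            rcases lt_or_ge j z with hj | hj
            · rw [e1 (j + 1) hj] at h'
              have := e4 j hj
              omega
            · exact ⟨hj, h⟩
          · rintro ⟨h, h'⟩
            exact ⟨h', e3 j h⟩
        rw [this]; simp

/-- Writing x = g · j + r with r < g, every admissible block `j` contributes g positions. -/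
theorem card_filter_div (g z : ℕ) (hg : 0 < g) (P : ℕ → Prop) [DecidablePred P] :
    g * ((Finset.range z).filter P).card ≤
      ((Finset.range (g * z)).filter fun x => P (x / g)).card := by
  rw [mul_comm, ← Finset.card_range g, ← Finset.card_product]
  rw [Finset.card_range g]
  refine Finset.card_le_card_of_injOn (fun x => g * x.1 + x.2) ?_ ?_
  · rintro ⟨j, r⟩ h
    simp only [Finset.coe_product, Set.mem_prod, Finset.mem_coe, Finset.mem_filter,
      Finset.mem_range] at h
    simp only [Finset.mem_coe, Finset.mem_filter, Finset.mem_range]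
    rw [Nat.mul_add_div hg, Nat.div_eq_of_lt h.2, Nat.add_zero]
    refine ⟨?_, h.1.2⟩
    calc g * j + r < g * (j + 1) := by rw [mul_add]; omega
      _ ≤ g * z := Nat.mul_le_mul_left _ h.1.1
  · rintro ⟨j, r⟩ h ⟨j', r'⟩ h' e
    simp only [Finset.coe_product, Set.mem_prod, Finset.mem_coe, Finset.mem_range] at h h' e
    have e1 := congrArg (· / g) e
    simp only [Nat.mul_add_div hg, Nat.div_eq_of_lt h.2, Nat.div_eq_of_lt h'.2, Nat.add_zero] at e1
    subst e1
    simp only [Prod.mk.injEq, true_and]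
    omega

/-- The element `e` belongs to one of the `c` sets whose indices are the digits of `y`; `A d e`
tells that the set `d` contains the element `e`. -/
def InDigits (A : ℕ → ℕ → Prop) (b c y e : ℕ) : Prop := ∃ w < c, A (y / b ^ w % b) e

/-- The elements that are left over by the sets whose indices are the digits of `y`. -/
noncomputable def openElems (A : ℕ → ℕ → Prop) (n b c y : ℕ) : Finset ℕ :=
  open Classical in (Finset.range n).filter fun e => ¬ InDigits A b c y e

/-- The elements of `U` that are covered by the sets whose indices are the digits of `u`. -/
noncomputable def groupElems (A : ℕ → ℕ → Prop) (b q u : ℕ) (U : Finset ℕ) : Finset ℕ :=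
  open Classical in U.filter fun e => InDigits A b q u e

/-- The edges between small groups of sets and elements. -/
def smallArc (A : ℕ → ℕ → Prop) (b q θ : ℕ) (U : Finset ℕ) (u e : ℕ) : Prop :=
  e ∈ groupElems A b q u U ∧ (groupElems A b q u U).card ≤ θ

/-- The number of digits below `m` among the `c` lowest digits of `y` to base `m + 1`. -/
def digitCount (m c y : ℕ) : ℕ :=
  ((Finset.range c).filter fun w => y / (m + 1) ^ w % (m + 1) < m).card

/-- Indicator function of block starts that is given by the binary digits of `v`. -/
def blockStart (v j : ℕ) : ℕ := if j = 0 then 1 else v / 2 ^ j % 2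

/-- The guess `y`, `z`, `v` shows that there is a cover with `t` sets. -/
structure Accepts (A : ℕ → ℕ → Prop) (n m g t y z v : ℕ) : Prop where
  card_le : (openElems A n (m + 1) (g ^ 3) y).card ≤ g * z
  le_card : g * z ≤ (openElems A n (m + 1) (g ^ 3) y).card + g * (n / g ^ 2)
  count_le : digitCount m (g ^ 3) y + g ^ 2 * ∑ j ∈ Finset.range z, blockStart v j ≤ t
  isContained : (patternTree (n / g + g * (n / g ^ 2) + 3)
      (∑ j ∈ Finset.range z, blockStart v j) g (g * z) (blockStart v)).IsContained
    (hostGraph (n / g + g * (n / g ^ 2) + 3) n (g * (n / g ^ 2))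
      (g * z - (openElems A n (m + 1) (g ^ 3) y).card) ((m + 1) ^ g ^ 2)
      (smallArc A (m + 1) (g ^ 2) (n / g) (openElems A n (m + 1) (g ^ 3) y)))

theorem blockStart_sum_pos (v k : ℕ) : 0 < ∑ j ∈ Finset.range (k + 1), blockStart v j := by
  rw [Finset.sum_range_succ']
  simp [blockStart]

/-- Elements outside the open set are covered by the guessed sets, the open ones by at most s groups
found in the host graph, each with at most g^2 sets. The digit `m` stands for no set, and digits
that are not below `m` are dropped. -/
theorem Accepts.exists_cover {A : ℕ → ℕ → Prop} {n m g t y z v : ℕ}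
    (h : Accepts A n m g t y z v) (hA : ∀ d e, A d e → d < m) :
    ∃ C : Finset ℕ, C.card ≤ t ∧ (∀ d ∈ C, d < m) ∧ ∀ e < n, ∃ d ∈ C, A d e := by
  classical
  set U := openElems A n (m + 1) (g ^ 3) y with hU
  have hmem : ∀ e, e ∈ U ↔ e < n ∧ ¬ InDigits A (m + 1) (g ^ 3) y e := fun e => by
    simp [hU, openElems]
  have hc := h.card_le
  have hc' := h.le_card
  rw [← hU] at hc hc'
  obtain ⟨K, -, hK, hKU⟩ := cover_of_isContained (θ := n / g) (U := U) (by omega)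
    (fun e he => ((hmem e).1 he).1)
    (fun u e hF => (Finset.mem_filter.1 (hF.1 : e ∈ U.filter _)).1)
    -- A single edge at `u` already certifies that the whole group is small, since the size bound is
    -- part of `smallArc`.
    (fun u _ S hS => by
      rcases S.eq_empty_or_nonempty with rfl | ⟨e, he⟩
      · simp
      · exact (Finset.card_le_card fun e he => (hS e he).1).trans (hS e he).2)
    (Nat.add_sub_of_le h.card_le) (by omega) (fun i _ => blockStart_sum_pos v _)
    (fun hl => by
      have : 0 < z := Nat.pos_of_mul_pos_left hl
      obtain ⟨z', rfl⟩ : ∃ z', z = z' + 1 := ⟨z - 1, by omega⟩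
      exact blockStart_sum_pos v z') h.isContained
  set C₁ := ((Finset.range (g ^ 3)).filter fun w => y / (m + 1) ^ w % (m + 1) < m).image
    fun w => y / (m + 1) ^ w % (m + 1) with hC₁
  set C₂ := K.biUnion fun u => ((Finset.range (g ^ 2)).image
    fun w => u / (m + 1) ^ w % (m + 1)).filter fun d => d < m with hC₂
  refine ⟨C₁ ∪ C₂, ?_, ?_, ?_⟩
  · have h1 : C₁.card ≤ digitCount m (g ^ 3) y := Finset.card_image_le
    have h2 : C₂.card ≤ K.card * g ^ 2 := Finset.card_biUnion_le_card_mul _ _ _ fun u _ =>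
      (Finset.card_filter_le _ _).trans (Finset.card_image_le.trans (by simp))
    have h3 := Finset.card_union_le C₁ C₂
    have h4 := h.count_le
    have h5 := Nat.mul_le_mul_right (g ^ 2) hK
    rw [mul_comm (∑ j ∈ _, _)] at h5
    omega
  · intro d hd
    simp only [hC₁, hC₂, Finset.mem_union, Finset.mem_image, Finset.mem_biUnion,
      Finset.mem_filter] at hd
    rcases hd with ⟨w, h1, rfl⟩ | ⟨u, _, h1⟩
    · exact h1.2
    · exact h1.2
  · intro e he
    by_cases hg : InDigits A (m + 1) (g ^ 3) y e
    · obtain ⟨w, hw, hAw⟩ := hg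
      refine ⟨_, Finset.mem_union_left _ (Finset.mem_image.2 ⟨w, Finset.mem_filter.2
        ⟨Finset.mem_range.2 hw, hA _ _ hAw⟩, rfl⟩), hAw⟩
    · obtain ⟨u, hu, hF⟩ := hKU e ((hmem e).2 ⟨he, hg⟩)
      obtain ⟨w, hw, hAw⟩ := (Finset.mem_filter.1 (hF.1 : e ∈ U.filter _)).2
      exact ⟨_, Finset.mem_union_right _ (Finset.mem_biUnion.2 ⟨u, hu, Finset.mem_filter.2
        ⟨Finset.mem_image.2 ⟨w, Finset.mem_range.2 hw, rfl⟩, hA _ _ hAw⟩⟩), hAw⟩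

/-- Every cover with `t` sets is found by some guess. -/
theorem exists_accepts {A : ℕ → ℕ → Prop} {n m g t : ℕ} {C : Finset ℕ} (hg : 0 < g) (htn : t ≤ n)
    (hA : ∀ d e, A d e → d < m) (hCt : C.card ≤ t) (hCm : ∀ d ∈ C, d < m)
    (hC : ∀ e < n, ∃ d ∈ C, A d e) :
    ∃ y < (m + 1) ^ g ^ 3, ∃ z ≤ n / g + n / g ^ 2, ∃ v < 2 ^ (n / g + n / g ^ 2),
      Accepts A n m g t y z v := by
  classical
  obtain ⟨d, hdC, hdinj, hdsurj⟩ := C.exists_enum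
  set c := C.card with hc
  have hq : 0 < g ^ 2 := by positivity
  have hgq : g ^ 3 = g * g ^ 2 := by ring
  set q := g ^ 2 with hq'
  set θ := n / g with hθ
  have hsq : c / q * q + c % q = c := Nat.div_add_mod' c q
  have hcq : c % q < q := Nat.mod_lt _ hq
  have hs₀n : c / q ≤ n / q := Nat.div_le_div_right (hCt.trans htn)
  set s₀ := c / q with hs₀
  have hs₀c : ∀ i < s₀, ∀ w < q, i * q + w < c := fun i hi w hw => by
    have : (i + 1) * q ≤ s₀ * q := Nat.mul_le_mul_right _ hi
    rw [add_mul] at this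
    omega
  have hcode : ∀ i, ∃ u < (m + 1) ^ q, ∀ w < q,
      u / (m + 1) ^ w % (m + 1) = if i * q + w < c then d (i * q + w) else m := fun i =>
    Nat.exists_digits m q (fun w => if i * q + w < c then d (i * q + w) else m) fun w _ => by
      split_ifs with h
      · exact (hCm _ (hdC _ h)).le
      · exact le_rfl
  choose u huM hu using hcode
  -- The indices of the sets to be guessed outright: those in the groups of P, and those of the
  -- incomplete last group, which has number s₀.
  set J : Finset ℕ → Finset ℕ := fun P =>
    (Finset.range c).filter fun j => j / q ∈ P ∨ s₀ ≤ j / q with hJ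
  set cov : Finset ℕ → Finset ℕ := fun P =>
    (Finset.range n).filter fun e => ∃ j ∈ J P, A (d j) e with hcov
  have hJcard : ∀ P, (J P).card ≤ P.card * q + c % q := by
    intro P
    have : J P ⊆ (P.biUnion fun i => Finset.Ico (i * q) (i * q + q)) ∪
        Finset.Ico (s₀ * q) c := by
      intro j hj
      simp only [hJ, Finset.mem_filter, Finset.mem_range] at hj
      have h1 := Nat.div_add_mod' j q
      have h2 := Nat.mod_lt j hq
      rcases hj with ⟨hj, h | h⟩
      · exact Finset.mem_union_left _ (Finset.mem_biUnion.2 ⟨_, h, Finset.mem_Ico.2 (by omega)⟩)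
      · have := Nat.mul_le_mul_right q h
        exact Finset.mem_union_right _ (Finset.mem_Ico.2 (by omega))
    refine (Finset.card_le_card this).trans ((Finset.card_union_le _ _).trans
      (Nat.add_le_add (Finset.card_biUnion_le_card_mul _ _ _ fun i _ => by simp) ?_))
    rw [Nat.card_Ico]; omega
  -- A largest family of full groups that covers, along with the incomplete group, at least θ + 1
  -- elements per member. The empty family qualifies, and maximality plays the role of a greedy
  -- choice.
  obtain ⟨P, hP, hPmax⟩ := Finset.exists_max_image
    ((Finset.range s₀).powerset.filter fun P => P.card * (θ + 1) ≤ (cov P).card) Finset.card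
    ⟨∅, by simp⟩
  simp only [Finset.mem_filter, Finset.mem_powerset] at hP hPmax
  have hcovn : (cov P).card ≤ n := (Finset.card_filter_le _ _).trans (by simp)
  -- With g or more members the family would cover at least g(θ+1) > n elements. The guessed sets
  -- then number at most (g-1)g^2 + (g^2-1) < g^3.
  have hPg : P.card < g := by
    have h1 : n < g * (θ + 1) := Nat.lt_mul_div_succ n hg
    by_contra h
    have := Nat.mul_le_mul_right (θ + 1) (not_lt.1 h)
    have := hP.2
    omega
  have hJW : (J P).card < g ^ 3 := by
    have h1 : (P.card + 1) * q ≤ g * q := Nat.mul_le_mul_right q hPg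
    rw [add_mul] at h1
    have := hJcard P
    omega
  obtain ⟨dJ, hdJ, -, hdJsurj⟩ := (J P).exists_enum
  obtain ⟨y, hyM, hy⟩ := Nat.exists_digits m (g ^ 3)
    (fun w => if w < (J P).card then d (dJ w) else m) fun w _ => by
      split_ifs with h
      · exact (hCm _ (hdC _ (Finset.mem_range.1 (Finset.mem_filter.1 (hdJ w h)).1))).le
      · exact le_rfl
  have hyin : ∀ e, InDigits A (m + 1) (g ^ 3) y e ↔ ∃ j ∈ J P, A (d j) e := by
    intro e
    constructor
    · rintro ⟨w, hw, h⟩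
      rw [hy w hw] at h
      split_ifs at h with h1
      · exact ⟨_, hdJ w h1, h⟩
      · exact absurd (hA _ _ h) (lt_irrefl _)
    · rintro ⟨j, hj, h⟩
      obtain ⟨w, hw, rfl⟩ := hdJsurj j hj
      refine ⟨w, hw.trans hJW, ?_⟩
      rwa [hy w (hw.trans hJW), if_pos hw]
  have hycount : digitCount m (g ^ 3) y ≤ (J P).card := by
    rw [← Finset.card_range (J P).card]
    refine Finset.card_le_card fun w hw => ?_
    rw [Finset.mem_filter, Finset.mem_range] at hw
    rw [Finset.mem_range]
    by_contra h
    rw [hy w hw.1, if_neg h] at hw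
    exact lt_irrefl _ hw.2
  set U := openElems A n (m + 1) (g ^ 3) y with hU
  have hUmem : ∀ e, e ∈ U ↔ e < n ∧ ¬ ∃ j ∈ J P, A (d j) e := fun e => by
    rw [hU, openElems, Finset.mem_filter, Finset.mem_range, hyin]
  -- A group with more than θ open elements could be added to P, as open elements are disjoint from
  -- those that P covers.
  have hsmall : ∀ i < s₀, i ∉ P → (groupElems A (m + 1) q (u i) U).card ≤ θ := by
    intro i hi hiP
    by_contra h
    have hsub : cov P ∪ groupElems A (m + 1) q (u i) U ⊆ cov (insert i P) := by
      intro e he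
      rcases Finset.mem_union.1 he with he | he
      · obtain ⟨h1, j, hj, h2⟩ := Finset.mem_filter.1 he
        refine Finset.mem_filter.2 ⟨h1, j, ?_, h2⟩
        simp only [hJ, Finset.mem_filter, Finset.mem_insert] at hj ⊢
        tauto
      · obtain ⟨h1, w, hw, h2⟩ := Finset.mem_filter.1 he
        refine Finset.mem_filter.2 ⟨Finset.mem_range.2 ((hUmem e).1 h1).1, i * q + w, ?_, ?_⟩
        · simp only [hJ, Finset.mem_filter, Finset.mem_insert, Finset.mem_range]
          refine ⟨hs₀c i hi w hw, Or.inl (Or.inl ?_)⟩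
          rw [mul_comm, Nat.mul_add_div hq, Nat.div_eq_of_lt hw, Nat.add_zero]
        · rwa [hu i w hw, if_pos (hs₀c i hi w hw)] at h2
    have hdisj : Disjoint (cov P) (groupElems A (m + 1) q (u i) U) := by
      rw [Finset.disjoint_left]
      intro e h1 h2
      exact ((hUmem e).1 (Finset.mem_filter.1 h2).1).2 (Finset.mem_filter.1 h1).2
    have h1 := Finset.card_le_card hsub
    rw [Finset.card_union_of_disjoint hdisj] at h1
    have h2 := hPmax (insert i P) ⟨Finset.insert_subset (Finset.mem_range.2 hi) hP.1, by
      rw [Finset.card_insert_of_notMem hiP, add_mul]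
      have := hP.2
      omega⟩
    rw [Finset.card_insert_of_notMem hiP] at h2
    omega
  obtain ⟨dS, hdS, hdSinj, hdSsurj⟩ := (Finset.range s₀ \ P).exists_enum
  have hs : (Finset.range s₀ \ P).card + P.card = s₀ := by
    rw [Finset.card_sdiff_of_subset hP.1, Finset.card_range]
    have := Finset.card_le_card hP.1
    rw [Finset.card_range] at this
    omega
  set s := (Finset.range s₀ \ P).card with hs'
  have hdS' : ∀ i < s, dS i < s₀ ∧ dS i ∉ P := fun i hi => by simpa using hdS i hi
  have hassign : ∀ e ∈ U, ∃ i < s, InDigits A (m + 1) q (u (dS i)) e := by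
    intro e he
    obtain ⟨hen, hej⟩ := (hUmem e).1 he
    obtain ⟨x, hx, hxe⟩ := hC e hen
    obtain ⟨j, hj, rfl⟩ := hdsurj x hx
    have hjJ : j ∉ J P := fun h => hej ⟨j, h, hxe⟩
    simp only [hJ, Finset.mem_filter, Finset.mem_range, not_and, not_or, not_le] at hjJ
    obtain ⟨h1, h2⟩ := hjJ hj
    obtain ⟨i, hi, hij⟩ := hdSsurj (j / q) (by simp [h1, h2])
    refine ⟨i, hi, j % q, Nat.mod_lt _ hq, ?_⟩
    rw [hij, hu _ _ (Nat.mod_lt _ hq), Nat.div_add_mod', if_pos hj]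
    exact hxe
  choose! a has haF using hassign
  have hUsum : U.card = ∑ i ∈ Finset.range s, (U.filter fun e => a e = i).card :=
    Finset.card_eq_sum_card_fiberwise fun e he => by simpa using has e he
  have hUn : U.card ≤ n := (Finset.card_filter_le _ _).trans (by simp)
  -- A group with f assigned elements gets f/g + 1 blocks of g leaves. This rounds up, and it gives
  -- every group a block, so that the number of starts is the number of groups. The total is at most
  -- n/g + s blocks, with at most g · s surplus leaves.
  obtain ⟨st, hst1, hst0, hsts, hstf⟩ := exists_blockStarts
    (fun i => (U.filter fun e => a e = i).card / g + 1) (fun i => Nat.succ_pos _) s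
  set z := ∑ i ∈ Finset.range s, ((U.filter fun e => a e = i).card / g + 1) with hz
  have hz' : z = ∑ i ∈ Finset.range s, ((U.filter fun e => a e = i).card / g) + s := by
    rw [hz, Finset.sum_add_distrib]; simp
  have hz1 : g * ∑ i ∈ Finset.range s, ((U.filter fun e => a e = i).card / g) ≤ U.card := by
    rw [hUsum, Finset.mul_sum]
    exact Finset.sum_le_sum fun i _ => Nat.mul_div_le _ _
  have hz2 : U.card ≤ g * z := by
    rw [hUsum, hz, Finset.mul_sum]
    exact Finset.sum_le_sum fun i _ => (Nat.lt_mul_div_succ _ hg).le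
  have hsn : s ≤ n / q := by omega
  have hzL : z ≤ n / g + n / q := by
    rw [hz']
    refine Nat.add_le_add ?_ hsn
    rw [Nat.le_div_iff_mul_le hg, mul_comm]
    exact hz1.trans hUn
  obtain ⟨v, hvL, hv⟩ := Nat.exists_digits 1 (n / g + n / q) st fun j _ => hst1 j
  have hvst : ∀ j < z, blockStart v j = st j := fun j hj => by
    unfold blockStart
    split_ifs with h
    · rw [h, hst0]
    · exact hv j (hj.trans_le hzL)
  have hvsum : ∀ k ≤ z, ∑ j ∈ Finset.range k, blockStart v j = ∑ j ∈ Finset.range k, st j :=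
    fun k hk => Finset.sum_congr rfl fun j hj => hvst j ((Finset.mem_range.1 hj).trans_le hk)
  have hdiv : ∀ x < g * z, x / g < z := fun x hx => Nat.div_lt_of_lt_mul hx
  refine ⟨y, hyM, z, hzL, v, hvL, hz2, ?_, ?_, ?_⟩
  · rw [← hU, ← hq', hz', mul_add]
    have := Nat.mul_le_mul_left g hsn
    omega
  · rw [hvsum z le_rfl, hsts, ← hq']
    have h1 := hJcard P
    have h2 : q * s + P.card * q = s₀ * q := by rw [← hs]; ring
    omega
  · rw [hvsum z le_rfl, hsts]
    refine isContained_of_cover (U := U) (u := fun i => u (dS i)) (a := a)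
      (fun e he => ((hUmem e).1 he).1) (Nat.add_sub_of_le hz2) ?_
      (fun i _ => blockStart_sum_pos v _) (fun x hx => ?_) (fun i _ => huM _)
      (fun i hi j hj h => ?_) has (fun e he => ?_) (fun i hi => ?_)
    · rw [← hU, ← hq', hz', mul_add]
      have := Nat.mul_le_mul_left g hsn
      omega
    · rw [hvsum _ (hdiv x hx), ← hsts]
      exact Finset.sum_le_sum_of_subset (Finset.range_mono (hdiv x hx))
    -- Codes of different groups differ already in digit 0, because the enumeration of the cover is
    -- injective.
    · have hi' := hs₀c _ (hdS' i hi).1 0 hq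
      have hj' := hs₀c _ (hdS' j hj).1 0 hq
      have h1 := hu (dS i) 0 hq
      have h2 := hu (dS j) 0 hq
      rw [if_pos hi'] at h1
      rw [if_pos hj', ← h, h1] at h2
      have h3 := hdinj _ hi' _ hj' h2
      exact hdSinj i hi j hj (Nat.eq_of_mul_eq_mul_right hq (by omega))
    · exact ⟨Finset.mem_filter.2 ⟨he, haF e he⟩,
        hsmall _ (hdS' _ (has e he)).1 (hdS' _ (has e he)).2⟩
    · have h1 := card_filter_div g z hg fun j => ∑ r ∈ Finset.range (j + 1), st r = i + 1
      rw [hstf i hi] at h1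
      refine (Nat.lt_mul_div_succ _ hg).le.trans (h1.trans (Finset.card_le_card fun x hx => ?_))
      simp only [Finset.mem_filter, Finset.mem_range] at hx ⊢
      rw [hvsum _ (hdiv x hx.1)]
      exact hx

/-! ### Expressible functions of the memory and the variables -/

/-- The function is given by an arithmetic expression. -/
def IsExp (f : (ℕ → ℕ) → (ℕ → ℕ) → ℕ) : Prop := ∃ e : RAMExp, ∀ μ ρ, e.eval μ ρ = f μ ρ

/-- The property is tested by an arithmetic expression. -/
def IsTest (P : (ℕ → ℕ) → (ℕ → ℕ) → Prop) : Prop :=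
  ∃ e : RAMExp, ∀ μ ρ, e.eval μ ρ ≠ 0 ↔ P μ ρ

namespace IsExp
variable {f f' : (ℕ → ℕ) → (ℕ → ℕ) → ℕ} {P : (ℕ → ℕ) → (ℕ → ℕ) → Prop}

theorem var (x : ℕ) : IsExp fun _ ρ => ρ x := ⟨.var x, fun _ _ => rfl⟩

theorem const (c : ℕ) : IsExp fun _ _ => c := ⟨.const c, fun _ _ => rfl⟩

theorem add (h : IsExp f) (h' : IsExp f') : IsExp fun μ ρ => f μ ρ + f' μ ρ := by
  obtain ⟨e, he⟩ := h
  obtain ⟨e', he'⟩ := h'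
  exact ⟨.add e e', fun μ ρ => by rw [RAMExp.eval, he, he']⟩

theorem sub (h : IsExp f) (h' : IsExp f') : IsExp fun μ ρ => f μ ρ - f' μ ρ := by
  obtain ⟨e, he⟩ := h
  obtain ⟨e', he'⟩ := h'
  exact ⟨.sub e e', fun μ ρ => by rw [RAMExp.eval, he, he']⟩

theorem mul (h : IsExp f) (h' : IsExp f') : IsExp fun μ ρ => f μ ρ * f' μ ρ := by
  obtain ⟨e, he⟩ := h
  obtain ⟨e', he'⟩ := h'
  exact ⟨.mul e e', fun μ ρ => by rw [RAMExp.eval, he, he']⟩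

theorem pow (h : IsExp f) : ∀ c : ℕ, IsExp fun μ ρ => f μ ρ ^ c
  | 0 => by simpa using const 1
  | c + 1 => by simpa only [pow_succ] using (h.pow c).mul h

theorem read (h : IsExp f) : IsExp fun μ ρ => μ (f μ ρ) := by
  obtain ⟨e, he⟩ := h
  exact ⟨.read e, fun μ ρ => by rw [RAMExp.eval, he]⟩

/-- The decidability instance is left arbitrary, so that the lemma fits classical and computable
conditionals alike. -/
theorem ite (hP : IsTest P) (h : IsExp f) (h' : IsExp f') {_ : ∀ μ ρ, Decidable (P μ ρ)} :
    IsExp fun μ ρ => if P μ ρ then f μ ρ else f' μ ρ := by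
  obtain ⟨e, he⟩ := h
  obtain ⟨e', he'⟩ := h'
  obtain ⟨b, hb⟩ := hP
  refine ⟨.ite b e e', fun μ ρ => ?_⟩
  rw [RAMExp.eval, he, he']
  exact if_congr (hb μ ρ) rfl rfl

theorem test (h : IsExp f) : IsTest fun μ ρ => f μ ρ ≠ 0 := by
  obtain ⟨e, he⟩ := h
  exact ⟨e, fun μ ρ => by rw [he]⟩

theorem div (h : IsExp f) (h' : IsExp f') : IsExp fun μ ρ => f μ ρ / f' μ ρ := by
  obtain ⟨e, he⟩ := h
  obtain ⟨e', he'⟩ := h'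
  -- The divisor of `RAMExp.div` is shifted by one, and division by zero has to give 0.
  refine ⟨.ite e' (.div e (.sub e' (.const 1))) (.const 0), fun μ ρ => ?_⟩
  simp only [RAMExp.eval, he, he']
  rcases Nat.eq_zero_or_pos (f' μ ρ) with h0 | h0
  · simp [h0]
  · rw [if_pos h0.ne', Nat.sub_add_cancel h0]

theorem mod (h : IsExp f) (h' : IsExp f') : IsExp fun μ ρ => f μ ρ % f' μ ρ := by
  have : (fun μ ρ => f μ ρ % f' μ ρ) = fun μ ρ => f μ ρ - f' μ ρ * (f μ ρ / f' μ ρ) := by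
    funext μ ρ
    have := Nat.div_add_mod (f μ ρ) (f' μ ρ)
    omega
  rw [this]
  exact h.sub (h'.mul (h.div h'))

/-- Summation, where the variable `x` serves as the running index. -/
theorem sum (x : ℕ) {b : ℕ → (ℕ → ℕ) → (ℕ → ℕ) → ℕ} (h : IsExp f)
    (hb : IsExp fun μ ρ => b (ρ x) μ ρ)
    (hx : ∀ i μ ρ j, b i μ (Function.update ρ x j) = b i μ ρ) :
    IsExp fun μ ρ => ∑ i ∈ Finset.range (f μ ρ), b i μ ρ := by
  obtain ⟨e, he⟩ := h
  obtain ⟨e', he'⟩ := hb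
  refine ⟨.sum x e e', fun μ ρ => ?_⟩
  simp only [RAMExp.eval, he, he', Function.update_self, hx]

end IsExp

namespace IsTest
variable {f f' : (ℕ → ℕ) → (ℕ → ℕ) → ℕ} {P P' : (ℕ → ℕ) → (ℕ → ℕ) → Prop}

theorem congr (h : IsTest P) (hP : ∀ μ ρ, P' μ ρ ↔ P μ ρ) : IsTest P' := by
  obtain ⟨e, he⟩ := h
  exact ⟨e, fun μ ρ => (he μ ρ).trans (hP μ ρ).symm⟩

theorem not (h : IsTest P) : IsTest fun μ ρ => ¬ P μ ρ := by
  obtain ⟨e, he⟩ := h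
  refine ⟨.sub (.const 1) e, fun μ ρ => ?_⟩
  simp only [RAMExp.eval, ← he]
  omega

theorem and (h : IsTest P) (h' : IsTest P') : IsTest fun μ ρ => P μ ρ ∧ P' μ ρ := by
  obtain ⟨e, he⟩ := h
  obtain ⟨e', he'⟩ := h'
  refine ⟨.mul e e', fun μ ρ => ?_⟩
  simp only [← he, ← he', RAMExp.eval, Nat.mul_ne_zero_iff]

theorem or (h : IsTest P) (h' : IsTest P') : IsTest fun μ ρ => P μ ρ ∨ P' μ ρ := by
  obtain ⟨e, he⟩ := h
  obtain ⟨e', he'⟩ := h'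
  refine ⟨.add e e', fun μ ρ => ?_⟩
  simp only [← he, ← he', RAMExp.eval]
  omega

theorem lt (h : IsExp f) (h' : IsExp f') : IsTest fun μ ρ => f μ ρ < f' μ ρ :=
  (h'.sub h).test.congr fun μ ρ => by omega

theorem le (h : IsExp f) (h' : IsExp f') : IsTest fun μ ρ => f μ ρ ≤ f' μ ρ :=
  (lt h' h).not.congr fun μ ρ => by omega

theorem eq (h : IsExp f) (h' : IsExp f') : IsTest fun μ ρ => f μ ρ = f' μ ρ :=
  ((le h h').and (le h' h)).congr fun μ ρ => by omega

theorem indicator (h : IsTest P) {_ : ∀ μ ρ, Decidable (P μ ρ)} :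
    IsExp fun μ ρ => if P μ ρ then 1 else 0 := IsExp.ite h (.const 1) (.const 0)

/-- Bounded quantification, where the variable `x` serves as the running index. -/
theorem exists_lt (x : ℕ) {b : ℕ → (ℕ → ℕ) → (ℕ → ℕ) → Prop} (h : IsExp f)
    (hb : IsTest fun μ ρ => b (ρ x) μ ρ)
    (hx : ∀ i μ ρ j, b i μ (Function.update ρ x j) = b i μ ρ) :
    IsTest fun μ ρ => ∃ i < f μ ρ, b i μ ρ := by
  classical
  refine (IsExp.sum x (b := fun i μ ρ => if b i μ ρ then 1 else 0) h hb.indicator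
    fun i μ ρ j => by simp only [hx]).test.congr fun μ ρ => ?_
  simp

/-- Counting, where the variable `x` serves as the running index. -/
theorem card (x : ℕ) {b : ℕ → (ℕ → ℕ) → (ℕ → ℕ) → Prop} [∀ i μ ρ, Decidable (b i μ ρ)]
    (h : IsExp f) (hb : IsTest fun μ ρ => b (ρ x) μ ρ)
    (hx : ∀ i μ ρ j, b i μ (Function.update ρ x j) = b i μ ρ) :
    IsExp fun μ ρ => ((Finset.range (f μ ρ)).filter fun i => b i μ ρ).card := by
  simp only [Finset.card_filter]
  exact IsExp.sum x (b := fun i μ ρ => if b i μ ρ then 1 else 0) h hb.indicator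
    fun i μ ρ j => by simp only [hx]

/-- A quantifier with constant range is unrolled. This is needed for digits: the power (m+1)^w is
expressible for each fixed `w` only. -/
theorem exists_lt_const {b : ℕ → (ℕ → ℕ) → (ℕ → ℕ) → Prop} (hb : ∀ w, IsTest (b w)) :
    ∀ c : ℕ, IsTest fun μ ρ => ∃ w < c, b w μ ρ
  | 0 => (lt (.const 0) (.const 0)).congr fun μ ρ => by simp
  | c + 1 => ((exists_lt_const hb c).or (hb c)).congr fun μ ρ => by
    simp only [Nat.lt_succ_iff_lt_or_eq]
    exact ⟨fun ⟨w, hw, h⟩ => hw.elim (fun hw => Or.inl ⟨w, hw, h⟩) fun hw => Or.inr (hw ▸ h),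
      fun h => h.elim (fun ⟨w, hw, h⟩ => ⟨w, Or.inl hw, h⟩) fun h => ⟨c, Or.inr rfl, h⟩⟩

theorem card_const {b : ℕ → (ℕ → ℕ) → (ℕ → ℕ) → Prop} [∀ i μ ρ, Decidable (b i μ ρ)]
    (hb : ∀ w, IsTest (b w)) : ∀ c : ℕ,
      IsExp fun μ ρ => ((Finset.range c).filter fun i => b i μ ρ).card
  | 0 => by simpa using IsExp.const 0
  | c + 1 => by
    simp only [Finset.card_filter, Finset.sum_range_succ]
    refine IsExp.add ?_ (hb c).indicator
    simpa only [Finset.card_filter] using card_const hb c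

end IsTest

/-! ### The predicates of the covering algorithm are expressible

The variables are `0` and `1` for the numbers of elements and sets, `2` for the size of the cover,
`3` for the current attempt, `4` for the result of the search, `5` and `6` for the guess,
`7` for the answer of the oracle, `8` for the position in the query, `9` for other loops,
`10` for the carry, and `11` for coverability. -/

/-- The memory `μ` tells that the set `d` contains the element `e` and is available in the
attempt `a`. -/
def liveMem (μ : ℕ → ℕ) (n m a d e : ℕ) : Prop :=
  d < m ∧ e < n ∧ d + n ≠ a ∧ μ (2 + m * n + d) ≠ 0 ∧ μ (2 + d * n + e) ≠ 0

theorem IsTest.liveMem {d e : (ℕ → ℕ) → (ℕ → ℕ) → ℕ} (hd : IsExp d) (he : IsExp e) :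
    IsTest fun μ ρ => _root_.liveMem μ (ρ 0) (ρ 1) (ρ 3) (d μ ρ) (e μ ρ) :=
  (lt hd (.var 1)).and ((lt he (.var 0)).and ((eq (hd.add (.var 0)) (.var 3)).not.and
    ((IsExp.read (((IsExp.const 2).add ((IsExp.var 1).mul (.var 0))).add hd)).test.and
      (IsExp.read (((IsExp.const 2).add (hd.mul (.var 0))).add he)).test)))

theorem IsTest.inDigits (c : ℕ) {u e : (ℕ → ℕ) → (ℕ → ℕ) → ℕ} (hu : IsExp u) (he : IsExp e) :
    IsTest fun μ ρ => InDigits (_root_.liveMem μ (ρ 0) (ρ 1) (ρ 3)) (ρ 1 + 1) c (u μ ρ) (e μ ρ) :=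
  exists_lt_const (fun w => IsTest.liveMem ((hu.div (((IsExp.var 1).add (.const 1)).pow w)).mod
    ((IsExp.var 1).add (.const 1))) he) c

theorem IsExp.digitCount (c : ℕ) : IsExp fun _ ρ => digitCount (ρ 1) c (ρ 5) :=
  IsTest.card_const (fun w => IsTest.lt (((IsExp.var 5).div
    (((IsExp.var 1).add (.const 1)).pow w)).mod ((IsExp.var 1).add (.const 1))) (.var 1)) c

/-- The elements left over by the guess in variable `5`. -/
noncomputable def guessOpen (g : ℕ) (μ ρ : ℕ → ℕ) : Finset ℕ :=
  openElems (liveMem μ (ρ 0) (ρ 1) (ρ 3)) (ρ 0) (ρ 1 + 1) (g ^ 3) (ρ 5)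

theorem IsTest.mem_guessOpen (g : ℕ) {e : (ℕ → ℕ) → (ℕ → ℕ) → ℕ} (he : IsExp e) :
    IsTest fun μ ρ => e μ ρ ∈ guessOpen g μ ρ :=
  ((lt he (.var 0)).and (inDigits (g ^ 3) (.var 5) he).not).congr fun μ ρ => by
    simp [guessOpen, openElems]

theorem IsExp.card_guessOpen (g : ℕ) : IsExp fun μ ρ => (guessOpen g μ ρ).card := by
  classical
  unfold guessOpen openElems
  exact IsTest.card 20 (.var 0) (IsTest.inDigits (g ^ 3) (.var 5) (.var 20)).not
    fun _ _ _ _ => rfl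

/-- The group `u` is evaluated inside a count whose index is the variable 21, so it must not depend
on that variable. The indices 20, 21 and 22 are kept apart from the variables of the algorithm. -/
theorem IsExp.card_groupElems (g : ℕ) {u : (ℕ → ℕ) → (ℕ → ℕ) → ℕ} (hu : IsExp u)
    (hux : ∀ μ ρ j, u μ (Function.update ρ 21 j) = u μ ρ) :
    IsExp fun μ ρ => (groupElems (liveMem μ (ρ 0) (ρ 1) (ρ 3)) (ρ 1 + 1) (g ^ 2) (u μ ρ)
      (guessOpen g μ ρ)).card := by
  classical
  have : (fun μ ρ => (groupElems (liveMem μ (ρ 0) (ρ 1) (ρ 3)) (ρ 1 + 1) (g ^ 2) (u μ ρ)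
      (guessOpen g μ ρ)).card) = fun μ ρ => ((Finset.range (ρ 0)).filter fun e =>
        e ∈ guessOpen g μ ρ ∧
        InDigits (liveMem μ (ρ 0) (ρ 1) (ρ 3)) (ρ 1 + 1) (g ^ 2) (u μ ρ) e).card := by
    funext μ ρ
    congr 1
    ext e
    simp only [groupElems, guessOpen, openElems, Finset.mem_filter]
    tauto
  rw [this]
  refine IsTest.card 21 (.var 0) ((IsTest.mem_guessOpen g (.var 21)).and
    (IsTest.inDigits (g ^ 2) hu (.var 21))) fun i μ ρ j => ?_
  rw [hux]
  rfl

/-- The edges between small groups of sets and elements for the guess in variable `5`. -/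
def guessArc (g : ℕ) (μ ρ : ℕ → ℕ) (u e : ℕ) : Prop :=
  smallArc (liveMem μ (ρ 0) (ρ 1) (ρ 3)) (ρ 1 + 1) (g ^ 2) (ρ 0 / g) (guessOpen g μ ρ) u e

theorem IsTest.guessArc (g : ℕ) {u e : (ℕ → ℕ) → (ℕ → ℕ) → ℕ} (hu : IsExp u) (he : IsExp e)
    (hux : ∀ μ ρ j, u μ (Function.update ρ 21 j) = u μ ρ) :
    IsTest fun μ ρ => _root_.guessArc g μ ρ (u μ ρ) (e μ ρ) :=
  (((mem_guessOpen g he).and (inDigits (g ^ 2) hu he)).and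
    (le (IsExp.card_groupElems g hu hux) ((IsExp.var 0).div (.const g)))).congr fun μ ρ => by
    simp [_root_.guessArc, smallArc, groupElems]

/-- The block starts that are given by the bits in the memory. -/
def memStart (μ ρ : ℕ → ℕ) (j : ℕ) : ℕ :=
  if j = 0 then 1 else μ (2 + ρ 1 * ρ 0 + ρ 1 + j)

theorem IsExp.sum_memStart {k : (ℕ → ℕ) → (ℕ → ℕ) → ℕ} (hk : IsExp k) :
    IsExp fun μ ρ => ∑ j ∈ Finset.range (k μ ρ), memStart μ ρ j :=
  IsExp.sum 22 hk (IsExp.ite (IsTest.eq (.var 22) (.const 0)) (.const 1)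
    (IsExp.read ((((IsExp.const 2).add ((IsExp.var 1).mul (.var 0))).add (.var 1)).add (.var 22))))
    fun _ _ _ _ => rfl

/-! ### The oracle query of a guess -/

/-- The size of the new cover in the current attempt. -/
def attemptSize (ρ : ℕ → ℕ) : ℕ := if ρ 3 < ρ 0 then ρ 2 - 1 else ρ 2

theorem IsExp.attemptSize : IsExp fun _ ρ => attemptSize ρ :=
  IsExp.ite (IsTest.lt (.var 3) (.var 0)) ((IsExp.var 2).sub (.const 1)) (.var 2)

/-- The number of pendant paths in pattern and host. -/
def pathCount (g n : ℕ) : ℕ := n / g + g * (n / g ^ 2) + 3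

theorem IsExp.dummyCount (g : ℕ) : IsExp fun _ ρ => g * (ρ 0 / g ^ 2) :=
  (IsExp.const g).mul ((IsExp.var 0).div (.const (g ^ 2)))

theorem IsExp.pathCount (g : ℕ) : IsExp fun _ ρ => pathCount g (ρ 0) :=
  (((IsExp.var 0).div (.const g)).add (.dummyCount g)).add (.const 3)

/-- The number of vertices of the host graph. -/
def hostSize (g n m : ℕ) : ℕ := 2 * pathCount g n + 1 + n + g * (n / g ^ 2) + (m + 1) ^ g ^ 2

theorem IsExp.hostSize (g : ℕ) : IsExp fun _ ρ => hostSize g (ρ 0) (ρ 1) :=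
  (((((IsExp.const 2).mul (.pathCount g)).add (.const 1)).add (.var 0)).add (.dummyCount g)).add
    (((IsExp.var 1).add (.const 1)).pow _)

/-- The number of children in the pattern tree of the guess in variable `6`. -/
def guessGroups (μ ρ : ℕ → ℕ) : ℕ := ∑ j ∈ Finset.range (ρ 6), memStart μ ρ j

theorem IsExp.guessGroups : IsExp fun μ ρ => guessGroups μ ρ := IsExp.sum_memStart (.var 6)

/-- The number of vertices of the pattern tree. -/
def patternSize (g n s z : ℕ) : ℕ := 2 * pathCount g n + s + 1 + g * z

theorem IsExp.patternSize (g : ℕ) :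
    IsExp fun μ ρ => patternSize g (ρ 0) (_root_.guessGroups μ ρ) (ρ 6) :=
  ((((IsExp.const 2).mul (.pathCount g)).add .guessGroups).add (.const 1)).add
    ((IsExp.const g).mul (.var 6))

/-- The oracle is to be asked for this guess. -/
def guessCond (g : ℕ) (μ ρ : ℕ → ℕ) : Prop :=
  (guessOpen g μ ρ).card ≤ g * ρ 6 ∧
  g * ρ 6 ≤ (guessOpen g μ ρ).card + g * (ρ 0 / g ^ 2) ∧
  digitCount (ρ 1) (g ^ 3) (ρ 5) + g ^ 2 * guessGroups μ ρ ≤ attemptSize ρ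

theorem IsTest.guessCond (g : ℕ) : IsTest fun μ ρ => guessCond g μ ρ :=
  (le (.card_guessOpen g) ((IsExp.const g).mul (.var 6))).and
    ((le ((IsExp.const g).mul (.var 6)) ((IsExp.card_guessOpen g).add (.dummyCount g))).and
      (le ((IsExp.digitCount _).add ((IsExp.const _).mul .guessGroups)) .attemptSize))

/-- The edges of the host graph of the guess. -/
def guessHostArc (g : ℕ) (μ ρ : ℕ → ℕ) (i j : ℕ) : Prop :=
  hostArc (pathCount g (ρ 0)) (ρ 0) (g * (ρ 0 / g ^ 2)) (g * ρ 6 - (guessOpen g μ ρ).card)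
    (guessArc g μ ρ) i j

theorem IsTest.guessHostArc (g : ℕ) {i j : (ℕ → ℕ) → (ℕ → ℕ) → ℕ} (hi : IsExp i) (hj : IsExp j)
    (hjx : ∀ μ ρ r, j μ (Function.update ρ 21 r) = j μ ρ) :
    IsTest fun μ ρ => guessHostArc g μ ρ (i μ ρ) (j μ ρ) := by
  have hD := IsExp.pathCount g
  have h0 : IsExp fun _ _ => 0 := .const 0
  have hD1 : IsExp fun _ ρ => 2 * _root_.pathCount g (ρ 0) + 1 :=
    ((IsExp.const 2).mul hD).add (.const 1)
  have hDn := hD1.add (.var 0)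
  have hDd := hDn.add (.dummyCount g)
  have hδ : IsExp fun μ ρ => min (g * ρ 6 - (guessOpen g μ ρ).card) (g * (ρ 0 / g ^ 2)) := by
    have h1 : IsExp fun μ ρ => g * ρ 6 - (guessOpen g μ ρ).card :=
      ((IsExp.const g).mul (.var 6)).sub (.card_guessOpen g)
    simp only [min_def]
    exact IsExp.ite (IsTest.le h1 (.dummyCount g)) h1 (.dummyCount g)
  unfold _root_.guessHostArc hostArc
  refine (and (eq hi h0) ((lt h0 hj).and (le hj hD))).or
    (((lt h0 hi).and ((le hi hD).and (eq hj (hi.add hD)))).or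
    (((eq hi h0).and (le hDd hj)).or
    (((le hD1 hi).and ((lt hi hDn).and ((le hDd hj).and
      (IsTest.guessArc g (hj.sub hDd) (hi.sub hD1) ?_)))).or
    ((le hDn hi).and ((lt hi (hDn.add hδ)).and (le hDd hj))))))
  intro μ ρ r
  rw [hjx]
  rfl

/-- The parents in the pattern tree of the guess. -/
def guessParent (g : ℕ) (μ ρ : ℕ → ℕ) (v : ℕ) : ℕ :=
  patternParent (pathCount g (ρ 0)) (guessGroups μ ρ) g (memStart μ ρ) v

theorem IsExp.guessParent (g : ℕ) {v : (ℕ → ℕ) → (ℕ → ℕ) → ℕ} (hv : IsExp v) :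
    IsExp fun μ ρ => guessParent g μ ρ (v μ ρ) := by
  have hD := IsExp.pathCount g
  have h0 : IsExp fun _ _ => 0 := .const 0
  have h2D := (IsExp.const 2).mul hD
  have hs := h2D.add IsExp.guessGroups
  have hk := IsExp.sum_memStart
    (((hv.sub (hs.add (.const 1))).div (.const g)).add (.const 1))
  unfold _root_.guessParent patternParent
  simp only [min_def]
  exact ite (.le hv hD) h0 (ite (.le hv h2D) (hv.sub hD) (ite (.le hv hs) h0
    (h2D.add (ite (.le .guessGroups hk) .guessGroups hk))))

open Classical in
/-- The entries of the input of kTree, for graphs that are given on numbers. -/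
noncomputable def graphCode (N k : ℕ) (P Q : ℕ → ℕ → Prop) (f : ℕ) : ℕ :=
  if f = 0 then N else if f = 1 then k else
  if f < 2 + N * N then (if P ((f - 2) / N) ((f - 2) % N) then 1 else 0) else
  if f < 2 + N * N + k * k then
    (if Q ((f - (2 + N * N)) / k) ((f - (2 + N * N)) % k) then 1 else 0)
  else 0

/-- The oracle query of the guess. -/
noncomputable def guessCode (g : ℕ) (μ ρ : ℕ → ℕ) (f : ℕ) : ℕ :=
  graphCode (hostSize g (ρ 0) (ρ 1)) (patternSize g (ρ 0) (guessGroups μ ρ) (ρ 6))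
    (fun i j => guessHostArc g μ ρ i j ∨ guessHostArc g μ ρ j i)
    (fun i j => (0 < i ∧ guessParent g μ ρ i = j) ∨ (0 < j ∧ guessParent g μ ρ j = i)) f

theorem IsExp.guessCode (g : ℕ) : IsExp fun μ ρ => guessCode g μ ρ (ρ 8) := by
  have hN := IsExp.hostSize g
  have hk := IsExp.patternSize g
  have h2N := (IsExp.const 2).add (hN.mul hN)
  have hi := ((IsExp.var 8).sub (.const 2)).div hN
  have hj := ((IsExp.var 8).sub (.const 2)).mod hN
  have hi' := ((IsExp.var 8).sub h2N).div hk
  have hj' := ((IsExp.var 8).sub h2N).mod hk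
  unfold _root_.guessCode graphCode
  refine ite (.eq (.var 8) (.const 0)) hN (ite (.eq (.var 8) (.const 1)) hk
    (ite (.lt (.var 8) h2N) (IsTest.indicator (.or (.guessHostArc g hi hj fun _ _ _ => rfl)
      (.guessHostArc g hj hi fun _ _ _ => rfl))) (ite (.lt (.var 8) (h2N.add (hk.mul hk)))
      (IsTest.indicator (.or (.and (.lt (.const 0) hi') (.eq (.guessParent g hi') hj'))
        (.and (.lt (.const 0) hj') (.eq (.guessParent g hj') hi')))) (.const 0))))

/-! ### The oracle query encodes an instance of kTree -/

theorem List.length_flatMap_range (a b : ℕ) (h : ℕ → ℕ → ℕ) :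
    ((List.range a).flatMap fun i => (List.range b).map (h i)).length = a * b := by
  induction a with
  | zero => simp
  | succ a ih =>
    rw [List.range_succ, List.flatMap_append, List.length_append, ih]
    simp [Nat.succ_mul]

theorem List.getD_flatMap_range (a b : ℕ) (h : ℕ → ℕ → ℕ) (p : ℕ) :
    ((List.range a).flatMap fun i => (List.range b).map (h i)).getD p 0 =
      if p < a * b then h (p / b) (p % b) else 0 := by
  induction a with
  | zero => simp
  | succ a ih =>
    rw [List.range_succ, List.flatMap_append]
    have hlen := List.length_flatMap_range a b h
    rcases lt_or_ge p (a * b) with hp | hp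
    · rw [List.getD_append _ _ _ _ (by omega), ih, if_pos hp, if_pos (by rw [Nat.succ_mul]; omega)]
    · rw [List.getD_append_right _ _ _ _ (by omega), hlen]
      simp only [List.flatMap_cons, List.flatMap_nil, List.append_nil]
      by_cases hp' : p < (a + 1) * b
      · rw [if_pos hp']
        rw [Nat.succ_mul] at hp'
        have hb : 0 < b := by omega
        have h1 : p / b = a := by
          rw [Nat.div_eq_iff hb]
          omega
        have h2 : p % b = p - a * b := by
          have := Nat.div_add_mod' p b
          rw [h1] at this
          omega
        rw [h1, h2, List.getD_eq_getElem _ _ (by simp; omega)]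
        simp
      · rw [if_neg hp', List.getD_eq_default]
        rw [Nat.succ_mul] at hp'
        simp
        omega

theorem bitMatrix_eq {a b : ℕ} {R : Fin a → Fin b → Prop} {P : ℕ → ℕ → Prop}
    [∀ i j, Decidable (P i j)] (h : ∀ i j, R i j ↔ P i j) :
    bitMatrix R = (List.range a).flatMap fun i => (List.range b).map fun j =>
      if P i j then 1 else 0 := by
  rw [← List.map_coe_finRange_eq_range (n := a), List.flatMap_map, bitMatrix]
  congr 1
  funext i
  rw [← List.map_coe_finRange_eq_range (n := b), List.map_map]
  congr 1
  funext j
  classical exact if_congr (h i j) rfl rfl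

theorem length_bitMatrix {a b : ℕ} (R : Fin a → Fin b → Prop) : (bitMatrix R).length = a * b := by
  simp [bitMatrix]

theorem getD_bitMatrix {a b : ℕ} {R : Fin a → Fin b → Prop} {P : ℕ → ℕ → Prop}
    [∀ i j, Decidable (P i j)] (h : ∀ i j, R i j ↔ P i j) (p : ℕ) :
    (bitMatrix R).getD p 0 = if p < a * b then (if P (p / b) (p % b) then 1 else 0) else 0 := by
  rw [bitMatrix_eq h, List.getD_flatMap_range]

theorem getD_encode_kTree {x : KTreeInst} {P Q : ℕ → ℕ → Prop} (hP : ∀ i j, x.G.Adj i j ↔ P i j)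
    (hQ : ∀ i j, x.T.Adj i j ↔ Q i j) (f : ℕ) :
    (kTree.encode x).getD f 0 = graphCode x.N x.k P Q f := by
  classical
  have e : kTree.encode x = x.N :: x.k :: (bitMatrix x.G.Adj ++ bitMatrix x.T.Adj) := rfl
  rw [e]
  unfold graphCode
  rcases f with - | - | f
  · simp
  · simp
  · rw [if_neg (by omega), if_neg (by omega), List.getD_cons_succ, List.getD_cons_succ,
      show f + 1 + 1 - 2 = f by omega,
      show f + 1 + 1 - (2 + x.N * x.N) = f - x.N * x.N by omega]
    have hlen := length_bitMatrix x.G.Adj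
    by_cases hf : f < x.N * x.N
    · rw [List.getD_append _ _ _ _ (by omega), getD_bitMatrix hP, if_pos hf,
        if_pos (by omega : f + 1 + 1 < 2 + x.N * x.N)]
    · rw [List.getD_append_right _ _ _ _ (by omega), hlen, getD_bitMatrix hQ,
        if_neg (by omega : ¬ f + 1 + 1 < 2 + x.N * x.N)]
      exact if_congr (by omega) rfl rfl

/-- The instance of kTree that belongs to the guess. -/
noncomputable def guessInst (g : ℕ) (μ ρ : ℕ → ℕ) : KTreeInst where
  N := hostSize g (ρ 0) (ρ 1)
  k := patternSize g (ρ 0) (guessGroups μ ρ) (ρ 6)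
  G := hostGraph (pathCount g (ρ 0)) (ρ 0) (g * (ρ 0 / g ^ 2))
    (g * ρ 6 - (guessOpen g μ ρ).card) ((ρ 1 + 1) ^ g ^ 2) (guessArc g μ ρ)
  T := patternTree (pathCount g (ρ 0)) (guessGroups μ ρ) g (g * ρ 6) (memStart μ ρ)
  isTree := parentGraph_isTree (by omega) _ _

theorem getD_encode_guessInst (g : ℕ) (μ ρ : ℕ → ℕ) (f : ℕ) :
    (kTree.encode (guessInst g μ ρ)).getD f 0 = guessCode g μ ρ f :=
  getD_encode_kTree (x := guessInst g μ ρ) (fun _ _ => Iff.rfl) (fun _ _ => Iff.rfl) f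

theorem guessCode_eq_zero {g : ℕ} {μ ρ : ℕ → ℕ} {f : ℕ}
    (hf : 2 + (guessInst g μ ρ).N * (guessInst g μ ρ).N +
      (guessInst g μ ρ).k * (guessInst g μ ρ).k ≤ f) : guessCode g μ ρ f = 0 := by
  have : ∀ N k P Q, 2 + N * N + k * k ≤ f → graphCode N k P Q f = 0 := by
    intro N k P Q h
    unfold graphCode
    rw [if_neg (by omega), if_neg (by omega), if_neg (by omega), if_neg (by omega)]
  exact this _ _ _ _ hf

/-- The memory `μ` up to address `c`, and the binary digits of `v` from there on. -/
def searchMem (μ : ℕ → ℕ) (c v : ℕ) : ℕ → ℕ := fun x => if x < c then μ x else v / 2 ^ (x - c) % 2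

/-- The bits of the counter lie behind the incidence matrix and the availability flags, so counting
does not disturb the instance. -/
theorem liveMem_searchMem (μ : ℕ → ℕ) (n m a v : ℕ) :
    liveMem (searchMem μ (2 + m * n + m) v) n m a = liveMem μ n m a := by
  funext d e
  unfold liveMem searchMem
  refine propext (and_congr_right fun hd => and_congr_right fun he => ?_)
  have : (d + 1) * n ≤ m * n := Nat.mul_le_mul_right _ hd
  rw [Nat.succ_mul] at this
  rw [if_pos (by omega), if_pos (by omega)]

theorem memStart_searchMem (μ ρ : ℕ → ℕ) (v : ℕ) :
    memStart (searchMem μ (2 + ρ 1 * ρ 0 + ρ 1) v) ρ = blockStart v := by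
  funext j
  unfold memStart blockStart searchMem
  rw [if_neg (by omega : ¬ 2 + ρ 1 * ρ 0 + ρ 1 + j < 2 + ρ 1 * ρ 0 + ρ 1), Nat.add_sub_cancel_left]

theorem guess_iff_accepts {g : ℕ} {μ ρ : ℕ → ℕ} {v : ℕ} :
    (guessCond g (searchMem μ (2 + ρ 1 * ρ 0 + ρ 1) v) ρ ∧
      (guessInst g (searchMem μ (2 + ρ 1 * ρ 0 + ρ 1) v) ρ).T.IsContained
        (guessInst g (searchMem μ (2 + ρ 1 * ρ 0 + ρ 1) v) ρ).G) ↔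
      Accepts (liveMem μ (ρ 0) (ρ 1) (ρ 3)) (ρ 0) (ρ 1) g (attemptSize ρ) (ρ 5) (ρ 6) v := by
  have e1 := liveMem_searchMem μ (ρ 0) (ρ 1) (ρ 3) v
  have e2 := memStart_searchMem μ ρ v
  generalize searchMem μ (2 + ρ 1 * ρ 0 + ρ 1) v = μ' at *
  unfold guessInst guessCond guessArc guessGroups guessOpen pathCount
  dsimp only
  rw [e1, e2]
  exact ⟨fun ⟨⟨h1, h2, h3⟩, h4⟩ => ⟨h1, h2, h3, h4⟩, fun ⟨h1, h2, h3, h4⟩ => ⟨⟨h1, h2, h3⟩, h4⟩⟩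

/-- Since g(n/g^2) ≤ n/g and n/g^2 ≤ n/g, the root and the pendant paths take at most 4(n/g) + 7
vertices, the children at most 2(n/g), and the leaves at most n + n/g by the second clause of
`guessCond`. -/
theorem guessInst_k_le {g : ℕ} (hg : 0 < g) {μ ρ : ℕ → ℕ} {v : ℕ}
    (hz : ρ 6 ≤ ρ 0 / g + ρ 0 / g ^ 2)
    (h : guessCond g (searchMem μ (2 + ρ 1 * ρ 0 + ρ 1) v) ρ) :
    (guessInst g (searchMem μ (2 + ρ 1 * ρ 0 + ρ 1) v) ρ).k ≤ ρ 0 + 7 * (ρ 0 / g) + 7 := by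
  have e2 := memStart_searchMem μ ρ v
  generalize searchMem μ (2 + ρ 1 * ρ 0 + ρ 1) v = μ' at *
  have h1 := h.2.1
  have h2 : (guessOpen g μ' ρ).card ≤ ρ 0 := by
    classical
    exact (Finset.card_filter_le _ _).trans (by simp)
  have h3 : guessGroups μ' ρ ≤ ρ 6 := by
    rw [guessGroups, e2]
    calc _ ≤ ∑ j ∈ Finset.range (ρ 6), 1 := Finset.sum_le_sum fun j _ => by
            unfold blockStart; split_ifs <;> omega
      _ = ρ 6 := by simp
  have h4 : g * (ρ 0 / g ^ 2) ≤ ρ 0 / g := by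
    rw [Nat.le_div_iff_mul_le hg]
    calc _ = ρ 0 / g ^ 2 * g ^ 2 := by ring
      _ ≤ ρ 0 := Nat.div_mul_le_self _ _
  have h5 : ρ 0 / g ^ 2 ≤ ρ 0 / g := Nat.div_le_div_left (Nat.le_self_pow two_ne_zero g) hg
  change 2 * (ρ 0 / g + g * (ρ 0 / g ^ 2) + 3) + guessGroups μ' ρ + 1 + g * ρ 6 ≤ _
  omega

/-! ### The search for a guess -/

/-- The expressions of the covering algorithm. -/
structure AlgoExps (g : ℕ) where
  bits : RAMExp
  bits_eval : ∀ μ ρ, bits.eval μ ρ = 2 + ρ 1 * ρ 0 + ρ 1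
  len : RAMExp
  len_eval : ∀ μ ρ, len.eval μ ρ = ρ 0 / g + ρ 0 / g ^ 2
  guesses : RAMExp
  guesses_eval : ∀ μ ρ, guesses.eval μ ρ = (ρ 1 + 1) ^ g ^ 3
  cond : RAMExp
  cond_eval : ∀ μ ρ, cond.eval μ ρ ≠ 0 ↔ guessCond g μ ρ
  querySize : RAMExp
  querySize_eval : ∀ μ ρ, querySize.eval μ ρ =
    2 + (guessInst g μ ρ).N * (guessInst g μ ρ).N + (guessInst g μ ρ).k * (guessInst g μ ρ).k
  query : RAMExp
  query_eval : ∀ μ ρ, query.eval μ ρ = guessCode g μ ρ (ρ 8)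
  attempt : RAMExp
  attempt_eval : ∀ μ ρ, attempt.eval μ ρ = attemptSize ρ
  coverable : RAMExp
  coverable_eval : ∀ μ ρ, coverable.eval μ ρ =
    open Classical in if ∀ e < ρ 0, ∃ d < ρ 1, μ (2 + d * ρ 0 + e) ≠ 0 then 1 else 0
  keep : RAMExp
  keep_eval : ∀ μ ρ, keep.eval μ ρ =
    if ρ 9 + ρ 0 = ρ 3 then 0 else μ (2 + ρ 1 * ρ 0 + ρ 9)

theorem exists_algoExps (g : ℕ) : Nonempty (AlgoExps g) := by
  classical
  have hmn : IsExp fun _ ρ => 2 + ρ 1 * ρ 0 := (IsExp.const 2).add ((IsExp.var 1).mul (.var 0))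
  obtain ⟨e₁, h₁⟩ := hmn.add (.var 1)
  obtain ⟨e₂, h₂⟩ := ((IsExp.var 0).div (.const g)).add ((IsExp.var 0).div (.const (g ^ 2)))
  obtain ⟨e₃, h₃⟩ := ((IsExp.var 1).add (.const 1)).pow (g ^ 3)
  obtain ⟨e₄, h₄⟩ := IsTest.guessCond g
  obtain ⟨e₅, h₅⟩ := ((IsExp.const 2).add ((IsExp.hostSize g).mul (.hostSize g))).add
    ((IsExp.patternSize g).mul (.patternSize g))
  obtain ⟨e₆, h₆⟩ := IsExp.guessCode g
  obtain ⟨e₇, h₇⟩ := IsExp.attemptSize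
  have hc : IsTest fun μ ρ => ∀ e < ρ 0, ∃ d < ρ 1, μ (2 + d * ρ 0 + e) ≠ 0 := by
    have h : IsTest fun μ ρ => ∃ d < ρ 1, μ (2 + d * ρ 0 + ρ 20) ≠ 0 :=
      IsTest.exists_lt 21 (b := fun d μ ρ => μ (2 + d * ρ 0 + ρ 20) ≠ 0) (.var 1)
        (IsExp.read (((IsExp.const 2).add ((IsExp.var 21).mul (.var 0))).add (.var 20))).test
        fun _ _ _ _ => rfl
    refine (IsTest.exists_lt 20 (b := fun e μ ρ => ¬ ∃ d < ρ 1, μ (2 + d * ρ 0 + e) ≠ 0) (.var 0)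
      h.not fun _ _ _ _ => rfl).not.congr fun μ ρ => ?_
    push Not
    rfl
  obtain ⟨e₈, h₈⟩ := hc.indicator
  obtain ⟨e₉, h₉⟩ := IsExp.ite (IsTest.eq ((IsExp.var 9).add (.var 0)) (.var 3)) (.const 0)
    (IsExp.read (hmn.add (.var 9)))
  exact ⟨⟨e₁, h₁, e₂, h₂, e₃, h₃, e₄, h₄, e₅, h₅, e₆, h₆, e₇, h₇, e₈, h₈, e₉, h₉⟩⟩

namespace AlgoExps
open RAMCmd
variable {g : ℕ} (a : AlgoExps g)

/-- The address of the bit with the index in variable `9`. -/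
def bitAddr : RAMExp := .add a.bits (.var 9)

/-- Add one to the number with the bits in the memory. -/
def increment : RAMCmd := .seq (.assign 10 (.const 1)) (.forLt 9 a.len (.seq
  (.store a.bitAddr (.sub (.add (.read a.bitAddr) (.var 10))
    (.mul (.const 2) (.div (.add (.read a.bitAddr) (.var 10)) (.const 1)))))
  (.assign 10 (.sub (.var 10) (.read a.bitAddr)))))

/-- Test the guess in the variables `5` and `6` and in the bits. -/
def testGuess : RAMCmd := .ite a.cond (.seq (.forLt 8 a.querySize (.ostore (.var 8) a.query))
  (.seq (.ask 7) (.ite (.var 7) (.assign 4 (.const 1)) .skip))) .skip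

/-- Test all guesses. -/
def search : RAMCmd := .seq (.assign 4 (.const 0)) (.forLt 5 a.guesses
  (.forLt 6 (.add a.len (.const 1)) (.big (.seq a.testGuess a.increment))))

end AlgoExps

theorem Nat.mod_two_pow_bit (v j i : ℕ) :
    v % 2 ^ j / 2 ^ i % 2 = if i < j then v / 2 ^ i % 2 else 0 := by
  rw [← Nat.toNat_testBit, ← Nat.toNat_testBit, Nat.testBit_mod_two_pow]
  split_ifs with h <;> simp [h]

/-- Bits of the successor by the school method. -/
theorem Nat.succ_bit (v i : ℕ) : (v + 1) / 2 ^ i % 2 =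
    (v / 2 ^ i % 2 + if 2 ^ i ∣ v + 1 then 1 else 0) % 2 := by
  rw [Nat.succ_div]
  omega

/-- The carry into position `i` is 1 exactly if 2^i divides v + 1. It survives exactly if the new
bit is 0, so subtracting the new bit from the carry gives the next one; without a carry the
truncated subtraction leaves 0. -/
theorem Nat.succ_carry (v i : ℕ) : (if 2 ^ (i + 1) ∣ v + 1 then 1 else 0) =
    (if 2 ^ i ∣ v + 1 then 1 else 0) - (v + 1) / 2 ^ i % 2 := by
  by_cases h : 2 ^ i ∣ v + 1
  · obtain ⟨k, hk⟩ := h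
    have h2 : 0 < 2 ^ i := by positivity
    rw [if_pos (Dvd.intro k hk.symm : 2 ^ i ∣ v + 1), hk, Nat.mul_div_cancel_left _ h2, pow_succ,
      if_congr (Nat.mul_dvd_mul_iff_left h2) rfl rfl]
    split_ifs <;> omega
  · rw [if_neg h, if_neg fun h' => h ((pow_dvd_pow 2 (Nat.le_succ i)).trans h')]
    omega

/-- The bounds on which the covering algorithm relies. -/
structure AlgoBounds (g n m B : ℕ) : Prop where
  sum : n + m ≤ B
  guesses : (m + 1) ^ g ^ 3 ≤ B
  mem : 2 + m * n + m + (n / g + n / g ^ 2) ≤ B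
  query : 2 + hostSize g n m * hostSize g n m +
    (n + 7 * (n / g) + 7) * (n + 7 * (n / g) + 7) ≤ B

/-- `O` answers the queries of the covering algorithm correctly. -/
def GoodOracle (g n m : ℕ) (O : (ℕ → ℕ) → ℕ → Prop) : Prop :=
  ∀ x : KTreeInst, x.N = hostSize g n m → x.k ≤ n + 7 * (n / g) + 7 →
    ∃ v, ((x.T.IsContained x.G ∧ v = 1) ∨ (¬ x.T.IsContained x.G ∧ v = 0)) ∧
      O (fun f => (kTree.encode x).getD f 0) v

/-! ### Correctness of the search. -/

namespace AlgoExps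
open RAMCmd
variable {g : ℕ} (a : AlgoExps g) {B E : ℕ} {O : (ℕ → ℕ) → ℕ → Prop} {Q : CmdState → Prop}

theorem increment_wp {s : CmdState} {μ : ℕ → ℕ} {n m v : ℕ} (hn : s.var 0 = n) (hm : s.var 1 = m)
    (hb : AlgoBounds g n m B) (hs : s.mem = searchMem μ (2 + m * n + m) v)
    (hv : v < 2 ^ (n / g + n / g ^ 2))
    (h : ∀ s' : CmdState, (∀ x, x ≠ 9 → x ≠ 10 → s'.var x = s.var x) →
      s'.mem = searchMem μ (2 + m * n + m) ((v + 1) % 2 ^ (n / g + n / g ^ 2)) →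
      s'.orc = s.orc → Q s') :
    a.increment.wp B E O Q s := by
  have hB := hb.mem
  set c := 2 + m * n + m with hc
  set L := n / g + n / g ^ 2 with hL
  clear_value c L
  -- Midway, the positions below `i` hold the bits of v + 1 and the others still those of v.
  set incMem : ℕ → ℕ → ℕ := fun i x => if x < c then μ x else
    if x - c < i then (v + 1) / 2 ^ (x - c) % 2 else v / 2 ^ (x - c) % 2 with hinc
  simp only [increment, wp, RAMExp.eval]
  refine ⟨by omega, ?_⟩
  rw [a.len_eval, Function.update_of_ne (by omega), hn, ← hL]
  refine ⟨by omega, fun i s' => (∀ x, x ≠ 9 → x ≠ 10 → s'.var x = s.var x) ∧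
    s'.var 10 = (if 2 ^ i ∣ v + 1 then 1 else 0) ∧ s'.mem = incMem i ∧ s'.orc = s.orc, ?_, ?_, ?_⟩
  · refine ⟨fun x _ h => Function.update_of_ne h _ _, by simp, ?_, rfl⟩
    rw [hs]
    funext x
    simp [hinc, searchMem]
  · rintro i hi s' ⟨h1, h2, h3, h4⟩
    have hadr : ∀ μ', a.bitAddr.eval μ' (Function.update s'.var 9 i) = c + i := fun μ' => by
      simp only [bitAddr, RAMExp.eval, a.bits_eval, Function.update_self]
      rw [Function.update_of_ne (by omega), Function.update_of_ne (by omega),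
        h1 0 (by omega) (by omega), h1 1 (by omega) (by omega), hn, hm, ← hc]
    have h10 : Function.update s'.var 9 i 10 = s'.var 10 := Function.update_of_ne (by omega) _ _
    have hold : s'.mem (c + i) = v / 2 ^ i % 2 := by
      rw [h3]
      simp [hinc]
    simp only [hadr, h10, h2, hold, Function.update_self]
    have hbit := Nat.succ_bit v i
    have hcarry := Nat.succ_carry v i
    have hb₁ : (if 2 ^ i ∣ v + 1 then 1 else 0) ≤ 1 := by split_ifs <;> omega
    generalize (if 2 ^ i ∣ v + 1 then 1 else 0) = b₁ at *
    generalize (if 2 ^ (i + 1) ∣ v + 1 then 1 else 0) = b₂ at *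
    have hnew : v / 2 ^ i % 2 + b₁ - 2 * ((v / 2 ^ i % 2 + b₁) / (1 + 1)) =
        (v + 1) / 2 ^ i % 2 := by omega
    have hbit2 : (v + 1) / 2 ^ i % 2 ≤ 1 := by omega
    simp only [hnew]
    refine ⟨by omega, by omega, by omega, fun x h9 h10 => ?_, ?_, ?_, h4⟩
    · rw [Function.update_of_ne h10, Function.update_of_ne h9, h1 x h9 h10]
    · exact hcarry.symm
    · rw [h3]
      funext x
      simp only [hinc, Function.update_apply]
      by_cases hx : x = c + i
      · rw [if_pos hx, if_neg (by omega), if_pos (by omega), hx, Nat.add_sub_cancel_left]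
      · rw [if_neg hx]
        exact if_ctx_congr Iff.rfl (fun _ => rfl) fun hx' => if_congr (by omega) rfl rfl
  · rintro s' ⟨h1, -, h3, h4⟩
    refine h s' h1 ?_ h4
    rw [h3]
    funext x
    simp only [hinc, searchMem, Nat.mod_two_pow_bit]
    split_ifs with h5 h6
    · rfl
    · rfl
    -- Beyond the L processed positions the bits of v are 0, and the last carry is dropped. So the
    -- counter wraps around to 0 after 2^L steps.
    · rw [Nat.div_eq_of_lt (hv.trans_le (Nat.pow_le_pow_right (by omega) (by omega)))]

/-- A search through the guesses for the cover size `t` in attempt `r`. -/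
abbrev Found (g : ℕ) (μ : ℕ → ℕ) (n m r t y z v : ℕ) : Prop :=
  Accepts (liveMem μ n m r) n m g t y z v

/-- Variable 4 is only ever raised, so it records whether some guess so far was accepted. The oracle
is asked only if the numerical conditions hold, which also keep the query within the size promised
to the oracle. -/
theorem testGuess_wp {s : CmdState} {μ : ℕ → ℕ} {n m v : ℕ} (hg : 0 < g) (hn : s.var 0 = n)
    (hm : s.var 1 = m) (hb : AlgoBounds g n m B) (hO : GoodOracle g n m O)
    (hs : s.mem = searchMem μ (2 + m * n + m) v) (ho : s.orc = fun _ => 0)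
    (hz : s.var 6 ≤ n / g + n / g ^ 2)
    (h : ∀ s' : CmdState, (∀ x, x ≠ 4 → x ≠ 7 → x ≠ 8 → s'.var x = s.var x) →
      s'.mem = s.mem → (s'.orc = fun _ => 0) →
      (s'.var 4 ≠ 0 ↔ s.var 4 ≠ 0 ∨
        Found g μ n m (s.var 3) (attemptSize s.var) (s.var 5) (s.var 6) v) → Q s') :
    a.testGuess.wp B E O Q s := by
  have hB : 2 ≤ B := by
    have := hb.query
    omega
  have hacc := guess_iff_accepts (g := g) (μ := μ) (ρ := s.var) (v := v)
  have hk := guessInst_k_le hg (μ := μ) (ρ := s.var) (v := v) (by rwa [hn])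
  rw [hn, hm, ← hs] at hacc hk
  simp only [testGuess, wp]
  refine ⟨fun hc => ?_, fun hc => ?_⟩
  · rw [a.cond_eval] at hc
    have hN : (guessInst g s.mem s.var).N = hostSize g n m := by
      rw [← hn, ← hm]; rfl
    have hk' := hk hc
    obtain ⟨w, hw, hOw⟩ := hO (guessInst g s.mem s.var) hN hk'
    have hw1 : w ≤ 1 := by rcases hw with ⟨-, h⟩ | ⟨-, h⟩ <;> omega
    rw [a.querySize_eval]
    have hsize := hb.query
    have hsize' := Nat.mul_le_mul hk' hk'
    rw [hN]
    set len := 2 + hostSize g n m * hostSize g n m +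
      (guessInst g s.mem s.var).k * (guessInst g s.mem s.var).k with hlen
    refine ⟨by omega, fun i s' => (∃ r, s'.var = Function.update s.var 8 r) ∧ s'.mem = s.mem ∧
      s'.orc = fun f => if f < i then guessCode g s.mem s.var f else 0, ?_, ?_, ?_⟩
    · refine ⟨⟨s.var 8, by simp⟩, rfl, ?_⟩
      simp [ho]
    · rintro i hi s' ⟨⟨r, h1⟩, h2, h3⟩
      refine ⟨⟨i, ?_⟩, h2, ?_⟩
      · dsimp only
        rw [h1, Function.update_idem]
      · dsimp only
        rw [a.query_eval, h1, Function.update_idem, h2, h3]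
        simp only [RAMExp.eval, Function.update_self]
        funext f
        rw [Function.update_apply]
        split_ifs with h4 h5 h6 h7
        · rw [h4]; rfl
        · omega
        · rfl
        · omega
        · omega
        · rfl
    · rintro s' ⟨⟨r, h1⟩, h2, h3⟩
      -- The written cells are exactly the encoding, and the untouched cells behind it are 0, as the
      -- machine expects.
      have horc : s'.orc = fun f => (kTree.encode (guessInst g s.mem s.var)).getD f 0 := by
        rw [h3]
        funext f
        rw [getD_encode_guessInst]
        split_ifs with h4
        · rfl
        · rw [guessCode_eq_zero]
          rw [hN]
          exact not_lt.1 h4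
      refine ⟨w, by omega, by rwa [horc], fun hw0 => ⟨by simp [RAMExp.eval]; omega, ?_⟩,
        fun hw0 => ?_⟩
      · simp only [RAMExp.eval, Function.update_self] at hw0
        refine h _ (fun x h4 h7 h8 => ?_) h2 rfl ?_
        · simp only [h1, Function.update_of_ne h4, Function.update_of_ne h7,
            Function.update_of_ne h8]
        · rw [Found, ← hacc]
          rcases hw with hw | hw
          · simp [RAMExp.eval, hc, hw.1]
          · omega
      · simp only [RAMExp.eval, Function.update_self] at hw0
        refine h _ (fun x h4 h7 h8 => ?_) h2 rfl ?_
        · simp only [h1, Function.update_of_ne h7, Function.update_of_ne h8]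
        · rw [Found, ← hacc]
          rcases hw with hw | hw
          · omega
          · simp [h1, hw.1]
  · have hc : ¬ guessCond g s.mem s.var := fun h => (a.cond_eval _ _).2 h hc
    refine h s (fun _ _ _ _ => rfl) rfl ho ?_
    rw [Found, ← hacc]
    simp [hc]

/-- The state of a search that started in the state `s₀`, with the number `v` in the bits. -/
structure SearchState (s₀ : CmdState) (v : ℕ) (s : CmdState) : Prop where
  var : ∀ x, x < 4 ∨ x = 11 → s.var x = s₀.var x
  mem : s.mem = searchMem s₀.mem (2 + s₀.var 1 * s₀.var 0 + s₀.var 1) v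
  orc : s.orc = fun _ => 0

/-- The three loops exhaust all guesses. The exponentially many values of `v` are not available as a
loop variable, whose values are bounded by B, and are instead counted in binary in the memory. -/
theorem search_wp {s₀ : CmdState} {n m : ℕ} (hg : 0 < g) (hn : s₀.var 0 = n) (hm : s₀.var 1 = m)
    (hb : AlgoBounds g n m B) (hO : GoodOracle g n m O)
    (hE : E = 2 ^ (n / g + n / g ^ 2))
    (hs : SearchState s₀ 0 s₀)
    (h : ∀ s', SearchState s₀ 0 s' →
      (s'.var 4 ≠ 0 ↔ ∃ y < (m + 1) ^ g ^ 3, ∃ z ≤ n / g + n / g ^ 2,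
        ∃ v < 2 ^ (n / g + n / g ^ 2),
          Found g s₀.mem n m (s₀.var 3) (attemptSize s₀.var) y z v) → Q s') :
    a.search.wp B E O Q s₀ := by
  have hB := hb.mem
  have hB' := hb.guesses
  set L := n / g + n / g ^ 2 with hL
  clear_value L
  set acc := Found g s₀.mem n m (s₀.var 3) (attemptSize s₀.var) with hacc
  have hv0 : ∀ s', SearchState s₀ 0 s' → s'.var 0 = n ∧ s'.var 1 = m := fun s' h' =>
    ⟨(h'.var 0 (by omega)).trans hn, (h'.var 1 (by omega)).trans hm⟩
  have hset : ∀ {v s'} (x i : ℕ), SearchState s₀ v s' → 4 ≤ x → x ≠ 11 →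
      SearchState s₀ v { s' with var := Function.update s'.var x i } := fun x i h' h4 h11 =>
    ⟨fun y hy => by
      dsimp only
      rw [Function.update_of_ne (by omega), h'.var y hy], h'.mem, h'.orc⟩
  simp only [search, wp, a.guesses_eval]
  refine ⟨by simp [RAMExp.eval], ?_⟩
  rw [Function.update_of_ne (by omega), hm]
  refine ⟨hB', fun i s => SearchState s₀ 0 s ∧ (s.var 4 ≠ 0 ↔
    ∃ y < i, ∃ z ≤ L, ∃ v < 2 ^ L, acc y z v), ⟨hset 4 _ hs le_rfl (by omega), ?_⟩, ?_,
    fun s ⟨h1, h2⟩ => h s h1 h2⟩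
  · simp [RAMExp.eval]
  rintro y - s ⟨h1, h2⟩
  simp only [RAMExp.eval, a.len_eval]
  rw [Function.update_of_ne (by omega), (hv0 s h1).1, ← hL]
  refine ⟨by omega, fun i s => SearchState s₀ 0 s ∧ s.var 5 = y ∧ (s.var 4 ≠ 0 ↔
    (∃ y' < y, ∃ z ≤ L, ∃ v < 2 ^ L, acc y' z v) ∨ ∃ z < i, ∃ v < 2 ^ L, acc y z v),
    ⟨hset 5 _ h1 (by omega) (by omega), by simp, ?_⟩, ?_, ?_⟩
  · dsimp only
    rw [Function.update_of_ne (by omega), h2]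
    simp
  · rintro z hz s ⟨h1, h2, h3⟩
    rw [hE]
    -- The residue makes the invariant valid after the last increment too: the counter is back at 0,
    -- ready for the next pair of `y` and `z`.
    refine ⟨fun i s => SearchState s₀ (i % 2 ^ L) s ∧ s.var 5 = y ∧ s.var 6 = z ∧ (s.var 4 ≠ 0 ↔
      ((∃ y' < y, ∃ z ≤ L, ∃ v < 2 ^ L, acc y' z v) ∨ ∃ z' < z, ∃ v < 2 ^ L, acc y z' v) ∨
      ∃ v < i, acc y z v), ⟨?_, ?_, ?_, ?_⟩, ?_, ?_⟩
    · rw [Nat.zero_mod]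
      exact hset 6 _ h1 (by omega) (by omega)
    · dsimp only
      rw [Function.update_of_ne (by omega), h2]
    · simp
    · dsimp only
      rw [Function.update_of_ne (by omega), h3]
      simp
    · rintro v hv s ⟨h1, h2, h3, h4⟩
      rw [Nat.mod_eq_of_lt hv] at h1
      have hsn : s.var 0 = n := (h1.var 0 (by omega)).trans hn
      have hsm : s.var 1 = m := (h1.var 1 (by omega)).trans hm
      have hmem := h1.mem
      rw [hn, hm] at hmem
      refine a.testGuess_wp hg hsn hsm hb hO hmem h1.orc (by omega) fun s' g1 g2 g3 g4 => ?_
      refine a.increment_wp (by rw [g1 0 (by omega) (by omega) (by omega), hsn])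
        (by rw [g1 1 (by omega) (by omega) (by omega), hsm]) hb (g2.trans hmem) (by rwa [← hL])
        fun s'' f1 f2 f3 => ?_
      have hatt : attemptSize s.var = attemptSize s₀.var := by
        unfold attemptSize
        rw [h1.var 0 (by omega), h1.var 2 (by omega), h1.var 3 (by omega)]
      refine ⟨⟨fun x hx => ?_, ?_, f3.trans g3⟩, ?_, ?_, ?_⟩
      · rw [f1 x (by omega) (by omega), g1 x (by omega) (by omega) (by omega), h1.var x hx]
      · rw [f2, ← hL, hn, hm]
      · rw [f1 5 (by omega) (by omega), g1 5 (by omega) (by omega) (by omega), h2]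
      · rw [f1 6 (by omega) (by omega), g1 6 (by omega) (by omega) (by omega), h3]
      · rw [f1 4 (by omega) (by omega), g4, h4, hatt, h1.var 3 (by omega), h2, h3, or_assoc]
        refine or_congr_right ⟨?_, ?_⟩
        · rintro (⟨v', hv', h⟩ | h)
          · exact ⟨v', by omega, h⟩
          · exact ⟨v, by omega, h⟩
        · rintro ⟨v', hv', h⟩
          rcases Nat.lt_succ_iff_lt_or_eq.1 hv' with h' | rfl
          · exact Or.inl ⟨v', h', h⟩
          · exact Or.inr h
    · rintro s ⟨h1, h2, h3, h4⟩
      rw [Nat.mod_self] at h1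
      refine ⟨h1, h2, h4.trans ?_⟩
      rw [or_assoc]
      refine or_congr_right ⟨?_, ?_⟩
      · rintro (⟨z', hz', h⟩ | h)
        · exact ⟨z', by omega, h⟩
        · exact ⟨z, by omega, h⟩
      · rintro ⟨z', hz', h⟩
        rcases Nat.lt_succ_iff_lt_or_eq.1 hz' with h' | rfl
        · exact Or.inl ⟨z', h', h⟩
        · exact Or.inr h
  · rintro s ⟨h1, h2, h3⟩
    refine ⟨h1, h3.trans ⟨?_, ?_⟩⟩
    · rintro (⟨y', hy', h⟩ | ⟨z, hz, h⟩)
      · exact ⟨y', by omega, h⟩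
      · exact ⟨y, by omega, z, by omega, h⟩
    · rintro ⟨y', hy', z, hz, h⟩
      rcases Nat.lt_succ_iff_lt_or_eq.1 hy' with h' | rfl
      · exact Or.inl ⟨y', h', z, hz, h⟩
      · exact Or.inr ⟨z, by omega, h⟩

end AlgoExps

/-! ### The progress of the covering algorithm -/

/-- There is a cover with `t` sets that are available in the attempt `r`. -/
def Live (μ : ℕ → ℕ) (n m r t : ℕ) : Prop :=
  ∃ C : Finset ℕ, C.card ≤ t ∧ (∀ d ∈ C, d < m) ∧ ∀ e < n, ∃ d ∈ C, liveMem μ n m r d e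

theorem Live.mono {μ μ' : ℕ → ℕ} {n m r r' t t' : ℕ} (h : Live μ n m r t) (ht : t ≤ t')
    (hμ : ∀ d e, liveMem μ n m r d e → liveMem μ' n m r' d e) : Live μ' n m r' t' := by
  obtain ⟨C, h1, h2, h3⟩ := h
  refine ⟨C, h1.trans ht, h2, fun e he => ?_⟩
  obtain ⟨d, hd, h4⟩ := h3 e he
  exact ⟨d, hd, hμ d e h4⟩

theorem exists_found_iff {g n m r t : ℕ} {μ : ℕ → ℕ} (hg : 0 < g) (ht : t ≤ n) :
    (∃ y < (m + 1) ^ g ^ 3, ∃ z ≤ n / g + n / g ^ 2, ∃ v < 2 ^ (n / g + n / g ^ 2),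
      Accepts (liveMem μ n m r) n m g t y z v) ↔ Live μ n m r t := by
  constructor
  · rintro ⟨y, -, z, -, v, -, h⟩
    exact h.exists_cover fun d e h => h.1
  · rintro ⟨C, h1, h2, h3⟩
    exact exists_accepts hg ht (fun d e h => h.1) h1 h2 h3

/-- The sets with indices in `C` cover all elements. -/
def MemCover (μ : ℕ → ℕ) (n m : ℕ) (C : Finset ℕ) : Prop :=
  (∀ d ∈ C, d < m) ∧ ∀ e < n, ∃ d ∈ C, μ (2 + d * n + e) ≠ 0

/-- All elements occur in sets. -/
def Coverable (μ : ℕ → ℕ) (n m : ℕ) : Prop := ∀ e < n, ∃ d < m, μ (2 + d * n + e) ≠ 0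

/-- The state of the algorithm before the attempt `r`, where the input is in the memory `μ₀`. -/
structure Progress (μ₀ : ℕ → ℕ) (n m r t : ℕ) (μ : ℕ → ℕ) : Prop where
  input : ∀ x < 2 + m * n, μ x = μ₀ x
  zero : ∀ x, 2 + m * n + m ≤ x → μ x = 0
  le_one : ∀ d < m, μ (2 + m * n + d) ≤ 1
  size_le : t ≤ n
  live : Coverable μ₀ n m → Live μ n m (n + m) t
  min : ∀ C, MemCover μ₀ n m C → t ≤ max C.card (n - r)
  needed : ∀ d < m, d + n < r → μ (2 + m * n + d) ≠ 0 → ¬ Live μ n m (d + n) t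
  all : r ≤ n → ∀ d < m, μ (2 + m * n + d) ≠ 0

theorem address_lt {n m d e : ℕ} (hd : d < m) (he : e < n) : 2 + d * n + e < 2 + m * n := by
  have : (d + 1) * n ≤ m * n := Nat.mul_le_mul_right _ hd
  rw [Nat.succ_mul] at this
  omega

/-! ### Self-reduction: each attempt preserves the invariant. -/

namespace Progress
variable {μ₀ μ : ℕ → ℕ} {n m r t : ℕ}

/-- Choosing one set for each element gives a cover with at most n sets, so t = n is a valid start.
-/
theorem init (h₁ : ∀ x < 2 + m * n, μ x = μ₀ x) (h₂ : ∀ x, 2 + m * n + m ≤ x → μ x = 0)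
    (h₃ : ∀ d < m, μ (2 + m * n + d) = 1) : Progress μ₀ n m 0 n μ where
  input := h₁
  zero := h₂
  le_one d hd := (h₃ d hd).le
  size_le := le_rfl
  live h := by
    choose! f hf using h
    refine ⟨(Finset.range n).image f, Finset.card_image_le.trans (by simp), fun d hd => ?_,
      fun e he => ⟨f e, Finset.mem_image_of_mem _ (Finset.mem_range.2 he), ?_⟩⟩
    · obtain ⟨e, he, rfl⟩ := Finset.mem_image.1 hd
      exact (hf e (Finset.mem_range.1 he)).1
    · have h1 := (hf e he).1
      refine ⟨h1, he, by omega, by rw [h₃ _ h1]; omega, ?_⟩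
      rw [h₁ _ (address_lt h1 he)]
      exact (hf e he).2
  min C _ := le_max_right _ _
  needed d _ h := by omega
  all _ d hd := by rw [h₃ d hd]; omega

/-- For r < n no set is excluded, and failure for t - 1 means that every cover has at least t sets.
For r = n + d the attempt excludes the set `d`, and failure says that it is needed. -/
theorem not_found (h : Progress μ₀ n m r t μ)
    (hl : ¬ Live μ n m r (if r < n then t - 1 else t)) : Progress μ₀ n m (r + 1) t μ where
  input := h.input
  zero := h.zero
  le_one := h.le_one
  size_le := h.size_le
  live := h.live
  min C hC := by
    by_contra hlt
    have h1 := h.min C hC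
    have h2 := not_or.1 (mt le_max_iff.2 hlt)
    have h3 := le_max_iff.1 h1
    have hr : r < n := by omega
    rw [if_pos hr] at hl
    refine hl ⟨C, by omega, hC.1, fun e he => ?_⟩
    obtain ⟨d, hd, hde⟩ := hC.2 e he
    have hdm := hC.1 d hd
    refine ⟨d, hd, hdm, he, by omega, h.all hr.le d hdm, ?_⟩
    rwa [h.input _ (address_lt hdm he)]
  needed d hd hdr hμ := by
    rcases Nat.lt_succ_iff_lt_or_eq.1 hdr with h1 | rfl
    · exact h.needed d hd h1 hμ
    · rwa [if_neg (by omega)] at hl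
  all hr := h.all (by omega)

/-- The memory after the removal of the set of the attempt `r`, as far as the index `i`. -/
def removed (μ : ℕ → ℕ) (n m r i : ℕ) : ℕ → ℕ := fun x =>
  if 2 + m * n ≤ x ∧ x < 2 + m * n + i ∧ x - (2 + m * n) + n = r then 0 else μ x

theorem removed_alive {d : ℕ} (hd : d < m) :
    removed μ n m r m (2 + m * n + d) = if d + n = r then 0 else μ (2 + m * n + d) := by
  unfold removed
  exact if_congr (by omega) rfl rfl

theorem removed_input {i x : ℕ} (hx : x < 2 + m * n) : removed μ n m r i x = μ x := by
  unfold removed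
  rw [if_neg (by omega)]

theorem liveMem_removed {a d e : ℕ} :
    liveMem (removed μ n m r m) n m a d e ↔ liveMem μ n m a d e ∧ d + n ≠ r := by
  unfold liveMem
  constructor
  · rintro ⟨h1, h2, h3, h4, h5⟩
    rw [removed_alive h1] at h4
    rw [removed_input (address_lt h1 h2)] at h5
    have h6 : ¬ d + n = r := fun h6 => h4 (if_pos h6)
    rw [if_neg h6] at h4
    exact ⟨⟨h1, h2, h3, h4, h5⟩, h6⟩
  · rintro ⟨⟨h1, h2, h3, h4, h5⟩, h6⟩
    rw [removed_alive h1, removed_input (address_lt h1 h2), if_neg h6]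
    exact ⟨h1, h2, h3, h4, h5⟩

/-- Fewer available sets or a smaller `t` only make covers rarer, so sets found to be needed stay
needed. The cover that was found avoids the removed set, so it survives the removal. -/
theorem found (h : Progress μ₀ n m r t μ)
    (hl : Live μ n m r (if r < n then t - 1 else t)) :
    Progress μ₀ n m (r + 1) (if r < n then t - 1 else t) (removed μ n m r m) where
  input x hx := by rw [removed_input hx, h.input x hx]
  zero x hx := by
    unfold removed
    rw [if_neg (by omega), h.zero x hx]
  le_one d hd := by
    rw [removed_alive hd]
    have := h.le_one d hd
    split_ifs <;> omega
  size_le := by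
    have := h.size_le
    split_ifs <;> omega
  live _ := hl.mono le_rfl fun d e hde => liveMem_removed.2
    ⟨⟨hde.1, hde.2.1, by have := hde.1; omega, hde.2.2.2⟩, hde.2.2.1⟩
  min C hC := by
    have := le_max_iff.1 (h.min C hC)
    apply le_max_iff.2
    split_ifs <;> omega
  needed d hd hdr hμ hL := by
    rw [removed_alive hd] at hμ
    have h1 : ¬ d + n = r := fun h1 => hμ (if_pos h1)
    rw [if_neg h1] at hμ
    exact h.needed d hd (by omega) hμ
      (hL.mono (by split_ifs <;> omega) fun d' e hde => (liveMem_removed.1 hde).1)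
  all hr d hd := by
    rw [removed_alive hd, if_neg (by omega)]
    exact h.all (by omega) d hd

/-- At the end, the remaining sets form a smallest cover. -/
theorem isMin (h : Progress μ₀ n m (n + m) t μ) (hcov : Coverable μ₀ n m) :
    MemCover μ₀ n m ((Finset.range m).filter fun d => μ (2 + m * n + d) ≠ 0) ∧
    ∀ C, MemCover μ₀ n m C →
      ((Finset.range m).filter fun d => μ (2 + m * n + d) ≠ 0).card ≤ C.card := by
  obtain ⟨C, h1, h2, h3⟩ := h.live hcov
  -- A cover with at most t available sets cannot omit an available set, as every such set is
  -- needed. So the available sets are contained in it, and it has no available sets besides them.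
  have hsub : ((Finset.range m).filter fun d => μ (2 + m * n + d) ≠ 0) ⊆ C := by
    intro d hd
    obtain ⟨hd, hμ⟩ := Finset.mem_filter.1 hd
    rw [Finset.mem_range] at hd
    by_contra hdC
    refine h.needed d hd (by omega) hμ ⟨C, h1, h2, fun e he => ?_⟩
    obtain ⟨d', hd', h4⟩ := h3 e he
    refine ⟨d', hd', h4.1, h4.2.1, fun h5 => ?_, h4.2.2.2⟩
    exact hdC (by rwa [show d = d' by omega])
  refine ⟨⟨fun d hd => by simpa using (Finset.mem_filter.1 hd).1, fun e he => ?_⟩,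
    fun D hD => (Finset.card_le_card hsub).trans ?_⟩
  · obtain ⟨d, hd, h4, h5, h6, h7, h8⟩ := h3 e he
    rw [h.input _ (address_lt h4 he)] at h8
    exact ⟨d, Finset.mem_filter.2 ⟨Finset.mem_range.2 h4, h7⟩, h8⟩
  · have := le_max_iff.1 (h.min D hD)
    omega

end Progress

/-! ### The covering algorithm -/

namespace AlgoExps
open RAMCmd
variable {g : ℕ} (a : AlgoExps g) {B E : ℕ} {O : (ℕ → ℕ) → ℕ → Prop} {Q : CmdState → Prop}

/-- The address that tells whether the set with the index in variable `9` is available. -/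
def aliveAddr : RAMExp := .add (.add (.const 2) (.mul (.var 1) (.var 0))) (.var 9)

/-- Make all sets available. -/
def initAlive : RAMCmd := .forLt 9 (.var 1) (.store aliveAddr (.const 1))

/-- Accept the current attempt. -/
def commit : RAMCmd :=
  .seq (.assign 2 a.attempt) (.forLt 9 (.var 1) (.store aliveAddr a.keep))

/-- Perform all attempts. -/
def attempts : RAMCmd :=
  .forLt 3 (.add (.var 0) (.var 1)) (.seq a.search (.ite (.var 4) a.commit .skip))

/-- Put out the available sets. -/
def output : RAMCmd := .forLt 9 (.var 1) (.store (.var 9) (.read aliveAddr))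

/-- The covering algorithm. -/
def main : RAMCmd := .seq (.assign 2 (.var 0)) (.seq (.assign 11 a.coverable)
  (.seq initAlive (.seq a.attempts output)))

theorem initAlive_wp {s : CmdState} {n m : ℕ} (hn : s.var 0 = n) (hm : s.var 1 = m)
    (hb : AlgoBounds g n m B)
    (h : ∀ s' : CmdState, (∀ x, x ≠ 9 → s'.var x = s.var x) →
      (s'.mem = fun x => if 2 + m * n ≤ x ∧ x < 2 + m * n + m then 1 else s.mem x) →
      s'.orc = s.orc → Q s') : initAlive.wp B E O Q s := by
  have hB : 2 + m * n + m ≤ B := (Nat.le_add_right _ _).trans hb.mem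
  have hB' := hb.sum
  simp only [initAlive, wp, RAMExp.eval]
  rw [hm]
  refine ⟨by omega, fun i s' => (∀ x, x ≠ 9 → s'.var x = s.var x) ∧
    (s'.mem = fun x => if 2 + m * n ≤ x ∧ x < 2 + m * n + i then 1 else s.mem x) ∧
    s'.orc = s.orc, ⟨fun _ _ => rfl, ?_, rfl⟩, ?_, fun s' ⟨h1, h2, h3⟩ => h s' h1 h2 h3⟩
  · funext x
    rw [if_neg (by omega)]
  · rintro i hi s' ⟨h1, h2, h3⟩
    have hadr : ∀ μ', aliveAddr.eval μ' (Function.update s'.var 9 i) = 2 + m * n + i := fun μ' => by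
      simp only [aliveAddr, RAMExp.eval, Function.update_self]
      rw [Function.update_of_ne (by omega), Function.update_of_ne (by omega),
        h1 0 (by omega), h1 1 (by omega), hn, hm]
    simp only [hadr]
    refine ⟨?_, ?_, fun x hx => ?_, ?_, h3⟩
    · generalize m * n = p at *; omega
    · generalize m * n = p at *; omega
    · rw [Function.update_of_ne hx, h1 x hx]
    · rw [h2]
      funext x
      rw [Function.update_apply]
      by_cases hx : x = 2 + m * n + i
      · rw [if_pos hx, if_pos (by omega)]
      · rw [if_neg hx]
        exact if_congr (by omega) rfl rfl

theorem commit_wp {s : CmdState} {n m : ℕ} (hn : s.var 0 = n) (hm : s.var 1 = m)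
    (hb : AlgoBounds g n m B) (ht : s.var 2 ≤ n) (hle : ∀ d < m, s.mem (2 + m * n + d) ≤ 1)
    (h : ∀ s' : CmdState, (∀ x, x ≠ 9 → x ≠ 2 → s'.var x = s.var x) →
      s'.var 2 = attemptSize s.var → s'.mem = Progress.removed s.mem n m (s.var 3) m →
      s'.orc = s.orc → Q s') : a.commit.wp B E O Q s := by
  have hB : 2 + m * n + m ≤ B := (Nat.le_add_right _ _).trans hb.mem
  have hB' := hb.sum
  simp only [commit, wp, RAMExp.eval, a.attempt_eval]
  rw [Function.update_of_ne (by omega), hm]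
  refine ⟨?_, by omega, fun i s' => (∀ x, x ≠ 9 → x ≠ 2 → s'.var x = s.var x) ∧
    s'.var 2 = attemptSize s.var ∧ s'.mem = Progress.removed s.mem n m (s.var 3) i ∧
    s'.orc = s.orc, ⟨fun x _ h => Function.update_of_ne h _ _, by simp, ?_, rfl⟩, ?_,
    fun s' ⟨h1, h2, h3, h4⟩ => h s' h1 h2 h3 h4⟩
  · unfold attemptSize
    split_ifs <;> omega
  · funext x
    unfold Progress.removed
    rw [if_neg (by omega)]
  · rintro i hi s' ⟨h1, h2, h3, h4⟩
    have h9 : ∀ x, x ≠ 9 → x ≠ 2 → Function.update s'.var 9 i x = s.var x := fun x hx hx' => by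
      rw [Function.update_of_ne hx, h1 x hx hx']
    have hadr : ∀ μ', aliveAddr.eval μ' (Function.update s'.var 9 i) = 2 + m * n + i := fun μ' => by
      simp only [aliveAddr, RAMExp.eval, Function.update_self]
      rw [h9 0 (by omega) (by omega), h9 1 (by omega) (by omega), hn, hm]
    have hkeep : a.keep.eval s'.mem (Function.update s'.var 9 i) =
        if i + n = s.var 3 then 0 else s.mem (2 + m * n + i) := by
      rw [a.keep_eval, Function.update_self, h9 0 (by omega) (by omega),
        h9 1 (by omega) (by omega), h9 3 (by omega) (by omega), hn, hm, h3]
      refine if_congr Iff.rfl rfl ?_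
      unfold Progress.removed
      rw [if_neg (by omega)]
    simp only [hadr, hkeep]
    have h5 := hle i hi
    refine ⟨?_, ?_, fun x hx hx' => h9 x hx hx', ?_, ?_, h4⟩
    · generalize m * n = p at *; omega
    · generalize m * n = p at *; split_ifs <;> omega
    · rw [Function.update_of_ne (by omega), h2]
    · rw [h3]
      funext x
      unfold Progress.removed
      rw [Function.update_apply]
      by_cases hx : x = 2 + m * n + i
      · rw [if_pos hx, hx]
        exact if_congr (by omega) rfl rfl
      · rw [if_neg hx]
        exact if_congr (by omega) rfl rfl

theorem output_wp {s : CmdState} {n m : ℕ} (hn : s.var 0 = n) (hm : s.var 1 = m)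
    (hb : AlgoBounds g n m B) (hle : ∀ d < m, s.mem (2 + m * n + d) ≤ 1)
    (h : ∀ s' : CmdState, (∀ x, x ≠ 9 → s'.var x = s.var x) →
      (∀ d < m, s'.mem d = s.mem (2 + m * n + d)) → Q s') : output.wp B E O Q s := by
  have hB : 2 + m * n + m ≤ B := (Nat.le_add_right _ _).trans hb.mem
  have hB' := hb.sum
  simp only [output, wp, RAMExp.eval]
  rw [hm]
  refine ⟨by omega, fun i s' => (∀ x, x ≠ 9 → s'.var x = s.var x) ∧
    (∀ d < i, s'.mem d = s.mem (2 + m * n + d)) ∧ ∀ d, i ≤ d → s'.mem d = s.mem d,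
    ⟨fun _ _ => rfl, fun _ h => by omega, fun _ _ => rfl⟩, ?_,
    fun s' ⟨h1, h2, h3⟩ => h s' h1 h2⟩
  rintro i hi s' ⟨h1, h2, h3⟩
  have hadr : ∀ μ', aliveAddr.eval μ' (Function.update s'.var 9 i) = 2 + m * n + i := fun μ' => by
    simp only [aliveAddr, RAMExp.eval, Function.update_self]
    rw [Function.update_of_ne (by omega), Function.update_of_ne (by omega),
      h1 0 (by omega), h1 1 (by omega), hn, hm]
  simp only [hadr, Function.update_self]
  have h5 := hle i hi
  -- The flag at 2 + m · n + i has not been overwritten yet, since the output so far fills only the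
  -- cells below i.
  rw [h3 _ (by omega)]
  refine ⟨?_, ?_, fun x hx => ?_, fun d hd => ?_, fun d hd => ?_⟩
  · generalize m * n = p at *; omega
  · generalize m * n = p at *; omega
  · rw [Function.update_of_ne hx, h1 x hx]
  · rcases Nat.lt_succ_iff_lt_or_eq.1 hd with hd | rfl
    · rw [Function.update_of_ne (by omega), h2 d hd]
    · rw [Function.update_self]
  · rw [Function.update_of_ne (by omega), h3 d (by omega)]

theorem attempts_wp {s : CmdState} {μ₀ : ℕ → ℕ} {n m : ℕ} (hg : 0 < g) (hn : s.var 0 = n)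
    (hm : s.var 1 = m) (hb : AlgoBounds g n m B) (hO : GoodOracle g n m O)
    (hE : E = 2 ^ (n / g + n / g ^ 2)) (hs : Progress μ₀ n m 0 (s.var 2) s.mem)
    (ho : s.orc = fun _ => 0)
    (h : ∀ s' : CmdState, (s'.var 0 = n ∧ s'.var 1 = m ∧ s'.var 11 = s.var 11) →
      Progress μ₀ n m (n + m) (s'.var 2) s'.mem → Q s') : a.attempts.wp B E O Q s := by
  simp only [attempts, wp, RAMExp.eval]
  rw [hn, hm]
  refine ⟨hb.sum, fun r s' => (s'.var 0 = n ∧ s'.var 1 = m ∧ s'.var 11 = s.var 11) ∧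
    Progress μ₀ n m r (s'.var 2) s'.mem ∧ s'.orc = fun _ => 0, ⟨⟨hn, hm, rfl⟩, hs, ho⟩, ?_,
    fun s' ⟨h1, h2, _⟩ => h s' h1 h2⟩
  rintro r hr s' ⟨⟨h0, h1, h11⟩, hP, ho'⟩
  have u : ∀ x, x ≠ 3 → Function.update s'.var 3 r x = s'.var x := fun x hx =>
    Function.update_of_ne hx _ _
  have hatt : attemptSize (Function.update s'.var 3 r) =
      if r < n then s'.var 2 - 1 else s'.var 2 := by
    unfold attemptSize
    rw [Function.update_self, u 0 (by omega), u 2 (by omega), h0]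
  refine a.search_wp hg (by rw [← h0]; exact u 0 (by omega)) (by rw [← h1]; exact u 1 (by omega))
    hb hO hE ⟨fun _ _ => rfl, ?_, ho'⟩ fun s₁ hs₁ hfound => ?_
  · dsimp only
    rw [u 0 (by omega), u 1 (by omega), h0, h1]
    funext x
    unfold searchMem
    split_ifs with hx
    · rfl
    · rw [hP.zero x (not_lt.1 hx)]; simp
  · have e0 : s₁.var 0 = n := by rw [hs₁.var 0 (by omega), ← h0]; exact u 0 (by omega)
    have e1 : s₁.var 1 = m := by rw [hs₁.var 1 (by omega), ← h1]; exact u 1 (by omega)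
    have e2 : s₁.var 2 = s'.var 2 := by rw [hs₁.var 2 (by omega)]; exact u 2 (by omega)
    have e3 : s₁.var 3 = r := by rw [hs₁.var 3 (by omega)]; simp
    have e11 : s₁.var 11 = s.var 11 := by
      rw [hs₁.var 11 (by omega), ← h11]; exact u 11 (by omega)
    have emem : s₁.mem = s'.mem := by
      rw [hs₁.mem]
      dsimp only
      rw [u 0 (by omega), u 1 (by omega), h0, h1]
      funext x
      unfold searchMem
      split_ifs with hx
      · rfl
      · rw [hP.zero x (not_lt.1 hx)]; simp
    dsimp only at hfound
    rw [hatt, Function.update_self, exists_found_iff hg (by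
      have := hP.size_le
      split_ifs <;> omega)] at hfound
    refine ⟨fun h4 => ?_, fun h4 => ?_⟩
    · refine a.commit_wp e0 e1 hb (by rw [e2]; exact hP.size_le) (by rw [emem]; exact hP.le_one)
        fun s₂ f1 f2 f3 f4 => ⟨⟨?_, ?_, ?_⟩, ?_, f4.trans hs₁.orc⟩
      · rw [f1 0 (by omega) (by omega), e0]
      · rw [f1 1 (by omega) (by omega), e1]
      · rw [f1 11 (by omega) (by omega), e11]
      · rw [f2, f3, e3, emem]
        unfold attemptSize
        rw [e0, e2, e3]
        exact hP.found (hfound.1 h4)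
    · refine ⟨⟨e0, e1, e11⟩, ?_, hs₁.orc⟩
      rw [e2, emem]
      exact hP.not_found fun hl => hfound.2 hl h4

/-- Coverability is tested at the start and kept in variable 11, because the output overwrites part
of the input. An instance that is not coverable runs through the same attempts with a meaningless
result. -/
theorem main_wp {s : CmdState} {n m : ℕ} (hg : 0 < g) (hn : s.var 0 = n) (hm : s.var 1 = m)
    (hb : AlgoBounds g n m B) (hO : GoodOracle g n m O)
    (hE : E = 2 ^ (n / g + n / g ^ 2)) (hzero : ∀ x, 2 + m * n ≤ x → s.mem x = 0)
    (ho : s.orc = fun _ => 0)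
    (h : ∀ (s' : CmdState) (C : Finset ℕ),
      (s'.var 11 = open Classical in if Coverable s.mem n m then 1 else 0) →
      (Coverable s.mem n m → MemCover s.mem n m C ∧ ∀ D, MemCover s.mem n m D → C.card ≤ D.card) →
      (∀ d < m, s'.mem d = if d ∈ C then 1 else 0) → Q s') : a.main.wp B E O Q s := by
  classical
  have hB : 2 + m * n + m ≤ B := (Nat.le_add_right _ _).trans hb.mem
  have hB' := hb.sum
  simp only [main, wp, RAMExp.eval, a.coverable_eval]
  rw [Function.update_of_ne (by omega), Function.update_of_ne (by omega), hn, hm]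
  refine ⟨by omega, ?_, ?_⟩
  · split_ifs
    · generalize m * n = p at *; omega
    · omega
  refine initAlive_wp (by simpa using hn) (by simpa using hm) hb fun s₁ h1 h2 h3 => ?_
  have e0 : s₁.var 0 = n := by rw [h1 0 (by omega)]; simpa using hn
  have e1 : s₁.var 1 = m := by rw [h1 1 (by omega)]; simpa using hm
  have e2 : s₁.var 2 = n := by rw [h1 2 (by omega)]; simp
  have e11 := h1 11 (by omega)
  simp only [Function.update_self] at e11
  refine a.attempts_wp hg (μ₀ := s.mem) e0 e1 hb hO hE ?_ (h3.trans ho)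
    fun s₂ ⟨f0, f1, f11⟩ hP => ?_
  · rw [e2, h2]
    refine Progress.init (fun x hx => if_neg (by omega)) (fun x hx => ?_)
      fun d hd => if_pos (by omega)
    dsimp only
    rw [if_neg (by omega), hzero x (by omega)]
  refine output_wp f0 f1 hb hP.le_one fun s₃ g1 g2 => h s₃
    ((Finset.range m).filter fun d => s₂.mem (2 + m * n + d) ≠ 0) ?_ hP.isMin fun d hd => ?_
  · rw [g1 11 (by omega), f11, e11]
    exact if_congr Iff.rfl rfl rfl
  · have := hP.le_one d hd
    rw [g2 d hd]
    simp only [Finset.mem_filter, Finset.mem_range, hd, true_and]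
    split_ifs <;> omega

theorem nest_main : a.main.nest = 1 := rfl

end AlgoExps

/-! ### Set Cover instances -/

namespace SetCoverInst
variable (x : SetCoverInst)

/-- The memory that holds the instance. -/
noncomputable def memory (a : ℕ) : ℕ := (setCover.encode x).getD a 0

theorem encode_eq : setCover.encode x = x.n :: x.m :: bitMatrix fun i e => e ∈ x.S i := rfl

theorem length_encode : (setCover.encode x).length = 2 + x.m * x.n := by
  rw [encode_eq, List.length_cons, List.length_cons, length_bitMatrix]
  omega

theorem memory_zero {a : ℕ} (ha : 2 + x.m * x.n ≤ a) : x.memory a = 0 :=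
  List.getD_eq_default _ _ (by rwa [length_encode])

theorem memory_bit (p : ℕ) : x.memory (2 + p) = (bitMatrix fun i e => e ∈ x.S i).getD p 0 := by
  rw [memory, encode_eq, show 2 + p = p + 1 + 1 by omega, List.getD_cons_succ, List.getD_cons_succ]

theorem memory_le (a : ℕ) : x.memory a ≤ x.n + x.m + 1 := by
  classical
  rcases a with - | - | a
  · simp [memory, encode_eq]; omega
  · simp [memory, encode_eq]; omega
  · rw [show a + 1 + 1 = 2 + a by omega, memory_bit, getD_bitMatrix
      (P := fun d e => ∃ (hd : d < x.m) (he : e < x.n), (⟨e, he⟩ : Fin x.n) ∈ x.S ⟨d, hd⟩)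
      (fun i e => by simp)]
    split_ifs <;> omega

theorem memory_ne_zero (i : Fin x.m) (e : Fin x.n) :
    x.memory (2 + i * x.n + e) ≠ 0 ↔ e ∈ x.S i := by
  classical
  have he := e.2
  have h1 : ((i : ℕ) * x.n + e) / x.n = i := by
    rw [mul_comm, Nat.mul_add_div (by omega), Nat.div_eq_of_lt he, Nat.add_zero]
  have h2 : ((i : ℕ) * x.n + e) % x.n = e := by
    rw [mul_comm, Nat.mul_add_mod, Nat.mod_eq_of_lt he]
  have h3 := address_lt i.2 he
  rw [add_assoc, memory_bit, getD_bitMatrix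
      (P := fun d e => ∃ (hd : d < x.m) (he : e < x.n), (⟨e, he⟩ : Fin x.n) ∈ x.S ⟨d, hd⟩)
      (fun i e => by simp), h1, h2, if_pos (by omega)]
  simp

theorem isCover_iff (D : Finset (Fin x.m)) :
    x.IsCover D ↔ MemCover x.memory x.n x.m (D.image Fin.val) := by
  constructor
  · intro h
    refine ⟨fun d hd => ?_, fun e he => ?_⟩
    · obtain ⟨i, -, rfl⟩ := Finset.mem_image.1 hd
      exact i.2
    · obtain ⟨i, hi, hie⟩ := h ⟨e, he⟩
      exact ⟨i, Finset.mem_image_of_mem _ hi, (x.memory_ne_zero i ⟨e, he⟩).2 hie⟩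
  · rintro ⟨-, h⟩ e
    obtain ⟨d, hd, hde⟩ := h e e.2
    obtain ⟨i, hi, rfl⟩ := Finset.mem_image.1 hd
    exact ⟨i, hi, (x.memory_ne_zero i e).1 hde⟩

theorem coverable_of_isCover {D : Finset (Fin x.m)} (h : x.IsCover D) :
    Coverable x.memory x.n x.m := fun e he => by
  obtain ⟨i, -, hie⟩ := h ⟨e, he⟩
  exact ⟨i, i.2, (x.memory_ne_zero i ⟨e, he⟩).2 hie⟩

theorem correct_of_memCover {C : Finset ℕ} {τ : RAMState}
    (h₁ : τ.reg 0 = open Classical in if Coverable x.memory x.n x.m then 1 else 0)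
    (h₂ : Coverable x.memory x.n x.m → MemCover x.memory x.n x.m C ∧
      ∀ D, MemCover x.memory x.n x.m D → C.card ≤ D.card)
    (h₃ : ∀ d < x.m, τ.mem d = if d ∈ C then 1 else 0) : setCover.Correct x τ := by
  classical
  by_cases hc : Coverable x.memory x.n x.m
  · left
    obtain ⟨h4, h5⟩ := h₂ hc
    have himg : (Finset.univ.filter fun i : Fin x.m => (i : ℕ) ∈ C).image Fin.val = C := by
      ext d
      simp only [Finset.mem_image, Finset.mem_filter, Finset.mem_univ, true_and]
      exact ⟨fun ⟨i, hi, h⟩ => h ▸ hi, fun hd => ⟨⟨d, h4.1 d hd⟩, hd, rfl⟩⟩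
    refine ⟨by rw [h₁, if_pos hc], Finset.univ.filter fun i : Fin x.m => (i : ℕ) ∈ C,
      ⟨(x.isCover_iff _).2 (by rwa [himg]), fun D hD => ?_⟩, fun i => ?_⟩
    · have := h5 _ ((x.isCover_iff D).1 hD)
      rw [← himg] at this
      rwa [Finset.card_image_of_injective _ Fin.val_injective,
        Finset.card_image_of_injective _ Fin.val_injective] at this
    · rw [h₃ i i.2]
      simp
  · right
    exact ⟨by rw [h₁, if_neg hc], fun D hD => hc (x.coverable_of_isCover hD)⟩

end SetCoverInst

/-! ### The running time of the covering algorithm -/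

/-- The size of the working memory of the covering algorithm. -/
def workSize (g n m : ℕ) : ℕ := n + m + (m + 1) ^ g ^ 3 + (2 + m * n + m + (n / g + n / g ^ 2)) +
  (2 + hostSize g n m * hostSize g n m + (n + 7 * (n / g) + 7) * (n + 7 * (n / g) + 7))

theorem algoBounds (g n m : ℕ) : AlgoBounds g n m (workSize g n m) := by
  constructor <;> unfold workSize <;> generalize n / g = a <;> generalize n / g ^ 2 = b <;> omega

theorem add_lt_workSize (g n m : ℕ) : n + m < workSize g n m := by
  unfold workSize
  generalize n / g = a
  generalize n / g ^ 2 = b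
  omega

theorem IsExp.workSize (g : ℕ) : IsExp fun _ ρ => workSize g (ρ 0) (ρ 1) := by
  have hK : IsExp fun _ ρ => ρ 0 + 7 * (ρ 0 / g) + 7 :=
    ((IsExp.var 0).add ((IsExp.const 7).mul ((IsExp.var 0).div (.const g)))).add (.const 7)
  exact ((((IsExp.var 0).add (.var 1)).add (((IsExp.var 1).add (.const 1)).pow _)).add
    ((((IsExp.const 2).add ((IsExp.var 1).mul (.var 0))).add (.var 1)).add
      (((IsExp.var 0).div (.const g)).add ((IsExp.var 0).div (.const _))))).add
    (((IsExp.const 2).add ((IsExp.hostSize g).mul (.hostSize g))).add (hK.mul hK))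

/-- The covering algorithm as a machine program, for an oracle program `p`. -/
theorem exists_setCover_program (p : RAMProg) {g : ℕ} (hg : 0 < g) :
    ∃ (prog : RAMProg) (κ : ℕ), (∀ n m, workSize g n m ≤ (n + m + 2) ^ κ) ∧
      ∀ (x : SetCoverInst) (T : ℕ), 1 ≤ T → GoodOracle g x.n x.m (RAMCmd.OracleRuns p T) →
        prog.Runs (RAMState.start (setCover.encode x))
          ((workSize g x.n x.m + 2) ^ κ * (2 ^ (x.n / g + x.n / g ^ 2) * T))
          (setCover.Correct x) := by
  obtain ⟨a⟩ := exists_algoExps g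
  obtain ⟨eB, hB⟩ := IsExp.workSize g
  obtain ⟨κ₁, h₁⟩ := eB.eval_le
  obtain ⟨prog, κ₂, h₂⟩ := RAMCmd.program_runs p a.main eB a.len 11
  have hvar : ∀ n m, RAMCmd.initVar n m 0 = n ∧ RAMCmd.initVar n m 1 = m := fun n m => by
    simp [RAMCmd.initVar]
  refine ⟨prog, κ₁ + κ₂, fun n m => ?_, fun x T hT hO => ?_⟩
  · have h := h₁ (n + m) (fun _ => 0) (RAMCmd.initVar n m) (fun x => by
      unfold RAMCmd.initVar
      split_ifs <;> omega) fun _ => Nat.zero_le _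
    rw [hB] at h
    simp only [hvar] at h
    exact h.trans (Nat.pow_le_pow_right (by omega) (by omega))
  · have hx : (RAMCmd.initState (setCover.encode x)).var = RAMCmd.initVar x.n x.m := by
      simp [RAMCmd.initState, x.encode_eq]
    have hb := algoBounds g x.n x.m
    have hb1 : 2 + x.m * x.n + x.m ≤ workSize g x.n x.m := (Nat.le_add_right _ _).trans hb.mem
    have hb2 : x.n / g + x.n / g ^ 2 ≤ workSize g x.n x.m := (Nat.le_add_left _ _).trans hb.mem
    have hb4 := add_lt_workSize g x.n x.m
    have h := h₂ (setCover.encode x) (workSize g x.n x.m) (x.n / g + x.n / g ^ 2) T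
      (fun s => ∃ C : Finset ℕ,
        (s.var 11 = open Classical in if Coverable x.memory x.n x.m then 1 else 0) ∧
        (Coverable x.memory x.n x.m → MemCover x.memory x.n x.m C ∧
          ∀ D, MemCover x.memory x.n x.m D → C.card ≤ D.card) ∧
        ∀ d < x.m, s.mem d = if d ∈ C then 1 else 0)
      (by rw [hB, hx]; simp only [hvar]) (by rw [a.len_eval, hx, (hvar _ _).1]) hb2
      (by rw [x.length_encode]; omega) (fun a => (x.memory_le a).trans hb4) hT
      (a.main_wp hg (by rw [hx]; exact (hvar _ _).1) (by rw [hx]; exact (hvar _ _).2) hb hO rfl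
        (fun y hy => x.memory_zero hy) rfl fun s' C e1 e2 e3 => ⟨C, e1, e2, e3⟩)
    rw [a.nest_main, pow_one] at h
    refine h.mono (Nat.mul_le_mul_right _ (Nat.pow_le_pow_right (by omega) (by omega))) ?_
    rintro τ ⟨s, ⟨C, e1, e2, e3⟩, e4, e5⟩
    exact x.correct_of_memCover (e5.trans e1) e2 fun d hd => (e4 d (by omega)).trans (e3 d hd)

/-- An algorithm for kTree is an oracle for the covering algorithm. -/
theorem goodOracle {p : RAMProg} {c : ℕ} {b b' : ℝ} (hb : 0 ≤ b) (hbb : b ≤ b') (hb' : 1 ≤ b')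
    (h : ∀ x : KTreeInst, ∃ (t : ℕ) (τ : RAMState),
      RAMExec p (RAMState.start (kTree.encode x)) t τ ∧ kTree.Correct x τ ∧
        (t : ℝ) ≤ (c : ℝ) * ((kTree.size x : ℝ) + 1) ^ c * b ^ x.k) {g n m T : ℕ}
    (hT : (c : ℝ) * (2 * (workSize g n m : ℝ) + 1) ^ c * b' ^ (n + 7 * (n / g) + 7) ≤ T) :
    GoodOracle g n m (RAMCmd.OracleRuns p T) := by
  intro x hN hk
  obtain ⟨t, τ, hrun, hcorr, ht⟩ := h x
  refine ⟨τ.reg 0, hcorr, t, τ, hrun, ?_, rfl⟩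
  have hq := (algoBounds g n m).query
  have hN' : x.N ≤ workSize g n m := by
    rw [hN]
    exact (Nat.le_mul_self _).trans (by omega)
  have hk' : x.k ≤ workSize g n m := hk.trans ((Nat.le_mul_self _).trans (by omega))
  have hsize : (kTree.size x : ℝ) ≤ 2 * (workSize g n m : ℝ) := by
    have h1 : kTree.size x = x.N + x.k := rfl
    rw [h1]
    exact_mod_cast (by omega : x.N + x.k ≤ 2 * workSize g n m)
  have hpow : b ^ x.k ≤ b' ^ (n + 7 * (n / g) + 7) :=
    (pow_le_pow_left₀ hb hbb _).trans (pow_le_pow_right₀ hb' hk)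
  have : (t : ℝ) ≤ T := by
    refine ht.trans (le_trans ?_ hT)
    gcongr
  exact_mod_cast this

/-- With c ≤ 2 the excess of the tree size costs at most 2^(7(n/g)+7), and the guesses cost at most
2^(2(n/g)). Together this is 128 · 512^(n/g), and the choice of `g` bounds 512^(n/g) by (d/c)^n. -/
theorem exp_bound {c d : ℝ} {g : ℕ} (hc : 1 ≤ c) (hc2 : c ≤ 2) (hcd : c ≤ d)
    (hg : 512 ≤ (d / c) ^ g) (n : ℕ) :
    c ^ (n + 7 * (n / g) + 7) * 2 ^ (n / g + n / g ^ 2) ≤ 128 * d ^ n := by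
  have hc0 : 0 < c := by linarith
  have hl : 1 ≤ d / c := (one_le_div hc0).2 hcd
  have hgg : n / g ^ 2 ≤ n / g := by
    rcases Nat.eq_zero_or_pos g with rfl | h
    · simp
    · exact Nat.div_le_div_left (Nat.le_self_pow two_ne_zero g) h
  have h1 : c ^ (7 * (n / g) + 7) ≤ 2 ^ (7 * (n / g) + 7) := pow_le_pow_left₀ hc0.le hc2 _
  have h2 : (2 : ℝ) ^ (n / g + n / g ^ 2) ≤ 2 ^ (2 * (n / g)) :=
    pow_le_pow_right₀ (by norm_num) (by omega)
  have h3 : (512 : ℝ) ^ (n / g) ≤ (d / c) ^ n := by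
    calc (512 : ℝ) ^ (n / g) ≤ ((d / c) ^ g) ^ (n / g) := pow_le_pow_left₀ (by norm_num) hg _
      _ = (d / c) ^ (g * (n / g)) := (pow_mul _ _ _).symm
      _ ≤ (d / c) ^ n := pow_le_pow_right₀ hl (Nat.mul_div_le n g)
  calc c ^ (n + 7 * (n / g) + 7) * 2 ^ (n / g + n / g ^ 2)
      = c ^ n * (c ^ (7 * (n / g) + 7) * 2 ^ (n / g + n / g ^ 2)) := by
        rw [add_assoc, pow_add, mul_assoc]
    _ ≤ c ^ n * (2 ^ (7 * (n / g) + 7) * 2 ^ (2 * (n / g))) := by gcongr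
    _ = c ^ n * (128 * 512 ^ (n / g)) := by
        rw [← pow_add, show 7 * (n / g) + 7 + 2 * (n / g) = 7 + 9 * (n / g) by ring, pow_add,
          pow_mul]
        norm_num
    _ ≤ c ^ n * (128 * (d / c) ^ n) := by gcongr
    _ = 128 * d ^ n := by
        rw [div_pow]
        field_simp

/-- The running time, as a polynomial times an exponential function. -/
theorem time_bound {S B c κ P : ℕ} {X Y Z : ℝ} {T : ℕ} (hS : 1 ≤ S) (hB : B ≤ (2 * S) ^ κ)
    (hX : 1 ≤ X) (hT : (T : ℝ) ≤ c * (2 * (B : ℝ) + 1) ^ c * X + 2) (hY : 0 ≤ Y)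
    (hXY : X * Y ≤ 128 * Z) :
    ((B : ℝ) + 2) ^ P * (Y * T) ≤
      ((c + 2) * 128 * 3 ^ (P + c) * 2 ^ (κ * (P + c)) : ℕ) * (S : ℝ) ^ (κ * (P + c)) * Z := by
  have hS' : (1 : ℝ) ≤ S := by exact_mod_cast hS
  have hB' : (B : ℝ) ≤ (2 * S) ^ κ := by exact_mod_cast hB
  have h1 : (1 : ℝ) ≤ (2 * S) ^ κ := one_le_pow₀ (by linarith)
  have hB0 : (0 : ℝ) ≤ B := Nat.cast_nonneg B
  set M : ℝ := 3 * (2 * S) ^ κ with hM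
  have hT' : (T : ℝ) ≤ (c + 2) * M ^ c * X := by
    have h2 : (2 * (B : ℝ) + 1) ^ c ≤ M ^ c := pow_le_pow_left₀ (by linarith) (by linarith) _
    have h3 : (1 : ℝ) ≤ M ^ c := one_le_pow₀ (by linarith)
    have h4 : c * (2 * (B : ℝ) + 1) ^ c * X ≤ c * M ^ c * X := by gcongr
    have h5 : 1 ≤ M ^ c * X := one_le_mul_of_one_le_of_one_le h3 hX
    nlinarith
  have h6 : ((B : ℝ) + 2) ^ P ≤ M ^ P := pow_le_pow_left₀ (by linarith) (by linarith) _
  have hM0 : 0 ≤ M := by linarith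
  calc ((B : ℝ) + 2) ^ P * (Y * T) ≤ M ^ P * (Y * ((c + 2) * M ^ c * X)) := by gcongr
    _ = (c + 2) * M ^ (P + c) * (X * Y) := by rw [pow_add]; ring
    _ ≤ (c + 2) * M ^ (P + c) * (128 * Z) := by gcongr
    _ = _ := by
      rw [hM, mul_pow, ← pow_mul, mul_pow]
      push_cast
      ring

theorem theorem3 (ε : ℝ) (hε : 0 < ε) :
    ∃ δ : ℝ, 0 < δ ∧
      (kTree.SolvableInOStar (fun x : KTreeInst => (2 - ε) ^ x.k) →
        setCover.SolvableInOStar (fun x : SetCoverInst => (2 - δ) ^ x.n)) := by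
  -- A base of at least 1 makes the bound for kTree monotone in the number of vertices. The new base
  -- d below is the midpoint of b and 2, strictly between them.
  set b := max (2 - ε) 1 with hbdef
  have hb1 : 1 ≤ b := le_max_right _ _
  have hb2 : b < 2 := max_lt (by linarith) (by norm_num)
  refine ⟨(2 - b) / 2, by linarith, ?_⟩
  rintro ⟨p, c, h⟩
  -- For ε > 2 the assumed time bound is not positive on the tree with one vertex, whereas every run
  -- has positive cost.
  have hε2 : 0 ≤ 2 - ε := by
    by_contra hneg
    obtain ⟨t, τ, hrun, -, ht⟩ := h ⟨1, 1, ⊥, parentGraph 1 (fun _ => 0) fun _ h => h,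
      parentGraph_isTree one_pos _ _⟩
    have hpos : (0 : ℝ) < t := by exact_mod_cast hrun.cost_pos
    dsimp only at ht
    rw [pow_one] at ht
    exact absurd (hpos.trans_le ht) (not_lt.2 (mul_nonpos_of_nonneg_of_nonpos (by positivity)
      (not_le.1 hneg).le))
  set d := 2 - (2 - b) / 2 with hd
  have hbd : b < d := by rw [hd]; linarith
  -- The group parameter depends on ε only, so (m+1)^(g^3) and the size of the host graph are
  -- polynomial in the instance.
  obtain ⟨g, hg⟩ := pow_unbounded_of_one_lt 512 ((one_lt_div (by linarith)).2 hbd)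
  have hg0 : 0 < g := by
    rcases Nat.eq_zero_or_pos g with rfl | h
    · norm_num at hg
    · exact h
  obtain ⟨prog, κ, hκ, hprog⟩ := exists_setCover_program p hg0
  set A := (c + 2) * 128 * 3 ^ (κ + c) * 2 ^ (κ * (κ + c)) with hA
  refine ⟨prog, A + κ * (κ + c), fun x => ?_⟩
  set X : ℝ := b ^ (x.n + 7 * (x.n / g) + 7) with hX
  have hX1 : 1 ≤ X := one_le_pow₀ hb1
  -- A common time limit for all oracle calls, from the largest pattern tree that is ever queried;
  -- the added 1 makes it positive.
  set T := ⌈(c : ℝ) * (2 * (workSize g x.n x.m : ℝ) + 1) ^ c * X⌉₊ + 1 with hTdef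
  have hT1 : (c : ℝ) * (2 * (workSize g x.n x.m : ℝ) + 1) ^ c * X ≤ T :=
    (Nat.le_ceil _).trans (Nat.cast_le.2 (Nat.le_succ _))
  have hT2 : (T : ℝ) ≤ c * (2 * (workSize g x.n x.m : ℝ) + 1) ^ c * X + 2 := by
    have := Nat.ceil_lt_add_one
      (by positivity : 0 ≤ (c : ℝ) * (2 * (workSize g x.n x.m : ℝ) + 1) ^ c * X)
    rw [hTdef]
    push_cast
    linarith
  obtain ⟨t, τ, hrun, ht, hcorr⟩ := hprog x T (by omega)
    (goodOracle hε2 (le_max_left _ _) hb1 h hT1)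
  refine ⟨t, τ, hrun, hcorr, ?_⟩
  have hS : (setCover.size x : ℝ) + 1 = ((x.n + x.m + 1 : ℕ) : ℝ) := by
    have : setCover.size x = x.n + x.m := rfl
    rw [this]
    push_cast
    ring
  have hd0 : 0 ≤ d := by linarith
  have hbound := time_bound (S := x.n + x.m + 1) (P := κ) (Y := 2 ^ (x.n / g + x.n / g ^ 2))
    (Z := d ^ x.n) (by omega)
    ((hκ x.n x.m).trans (Nat.pow_le_pow_left (by omega) κ)) hX1 hT2 (by positivity)
    (exp_bound hb1 hb2.le hbd.le hg.le x.n)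
  rw [hS]
  have hS1 : (1 : ℝ) ≤ ((x.n + x.m + 1 : ℕ) : ℝ) := by exact_mod_cast Nat.le_add_left _ _
  calc (t : ℝ) ≤ ((workSize g x.n x.m : ℝ) + 2) ^ κ * (2 ^ (x.n / g + x.n / g ^ 2) * T) := by
        exact_mod_cast ht
    _ ≤ _ := hbound
    _ ≤ _ := by
      gcongr
      · exact Nat.le_add_right _ _
      · exact Nat.le_add_left _ _
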